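/- Let $k\ge 1$ and let $\pi\colon E\to\mathbb R$ be a smooth bundle (it is enough that $\pi$ is a surjective submersion), $E$ a smooth Hausdorff second countable manifold of dimension $n+1$. Let $t$ be the coordinate of $\mathbb R$, let $J^r\pi$ be the bundle of $r$-jets of local sections of $\pi$, with the coordinates $(t,q_0^A,\dots,q_r^A)$ induced by charts $(t,q^A)$ of $E$ adapted to $\pi$, and let $L\in C^\infty(J^k\pi)$ (that is, $\mathcal L=L\,dt$ is a $k$th order Lagrangian density). Let $\mathcal W=J^{2k-1}\pi\times_{J^{k-1}\pi}T^*(J^{k-1}\pi)$, with its projections $\rho_1,\rho_2$ to the two factors and $\rho_{\mathbb R}$ to $\mathbb R$. Its natural coordinates are $(t,q_0^A,\dots,q_{2k-1}^A,p,p_A^0,\dots,p_A^{k-1})$, where a covector of $J^{k-1}\pi$ is written $p\,dt+\sum_{i=0}^{k-1}p_A^i\,dq_i^A$. Put $\Omega=\rho_2^*(-d\Theta)$, with $\Theta$ the tautological $1$-form on $T^*(J^{k-1}\pi)$. Let $\hat L$ be the pullback of $L$ to $\mathcal W$, and let $\hat C\in C^\infty(\mathcal W)$, $\hat C(w)=\langle\alpha\mid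 (j^{k-1}\phi)'(t)\rangle$ for $w=(j^{2k-1}_t\phi,\alpha)$; in coordinates $\hat C=p+\sum_{i=0}^{k-1}p_A^iq_{i+1}^A$. Let $\mathcal W_o=\{\hat C=\hat L\}\subset\mathcal W$, a closed hypersurface, let $\Omega_o$ be the restriction of $\Omega$ to $\mathcal W_o$, and $\rho^o_{\mathbb R}=\rho_{\mathbb R}|_{\mathcal W_o}$. Let $\mathcal W_1\subset\mathcal W_o$ be the graph of the Legendre–Ostrogradsky map, given locally by $$p_A^{r-1}=\sum_{i=0}^{k-r}(-1)^i d_T^i\Big(\frac{\partial L}{\partial q_{r+i}^A}\Big),\qquad 1\le r\le k,$$ where $d_T$ is the total time derivative. A smooth section $\sigma$ of $\rho^o_{\mathbb R}$ over an open interval is *holonomic* if $\rho_1\circ\sigma=j^{2k-1}\phi$, where $\phi$ is the projection of $\sigma$ to $E$. A vector field $X_o$ on $\mathcal W_o$ is *$\rho^o_{\mathbb R}$-transverse* if $f=i(X_o)(\rho^o_{\mathbb R})^*dt$ vanishes nowhere. A transverse $X_o$ is a *semispray of type 1* if every section $\sigma$ of $\rho^o_{\mathbb R}$ over an open interval which is,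 up to reparametrization, an integral curve of $X_o$ (that is, $X_o(\sigma(t))=f(\sigma(t))\,\sigma'(t)$) is holonomic. Let $\psi_o\colon\mathbb R\to\mathcal W_o$ be a smooth holonomic section of $\rho^o_{\mathbb R}$. Then the following four conditions are equivalent. 1. $\psi_o^*\,i(Y)\Omega_o=0$ for every smooth vector field $Y$ on $\mathcal W_o$. 2. In all natural coordinates, for every $A$, along $\psi_o$, $$\dot p_A^0=\frac{\partial\hat L}{\partial q_0^A},\qquad \dot p_A^i=\frac{\partial\hat L}{\partial q_i^A}-p_A^{i-1}\quad(1\le i\le k-1),$$ and $\psi_o$ satisfies the constraint $p_A^{k-1}=\dfrac{\partial\hat L}{\partial q_k^A}$. 3. $i(\psi_o')(\Omega_o\circ\psi_o)=0$, where $\psi_o'\colon\mathbb R\to T\mathcal W_o$ is the velocity of $\psi_o$. 4. $\psi_o$ takes values in $\mathcal W_1$ and is an integral curve of a smooth $\rho^o_{\mathbb R}$-transverse semispray $X_o$ of type 1 on $\mathcal W_o$ which satisfies $i(X_o)\Omega_o=0$ at the points of $\mathcal W_1$. -/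

import Mathlib

open Set Filter Topology Manifold ContDiff

noncomputable section
namespace SkinnerRusk

theorem iteratedDeriv_pair {X Y : Type*} [NormedAddCommGroup X] [NormedSpace ℝ X]
    [NormedAddCommGroup Y] [NormedSpace ℝ Y] {u : ℝ → X} {v : ℝ → Y} {t : ℝ}
    (hu : ContDiffAt ℝ ∞ u t) (hv : ContDiffAt ℝ ∞ v t) (i : ℕ) :
    iteratedDeriv i (fun s => (u s, v s)) t = (iteratedDeriv i u t, iteratedDeriv i v t) := by
  simp only [iteratedDeriv_eq_iteratedFDeriv]
  rw [iteratedFDeriv_prodMk hu hv (by exact_mod_cast le_top)]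
  rfl

/-- Derivatives of order at most `i` of `g ∘ u` at `t` only depend on those of `u`. -/
theorem iteratedDeriv_comp_congr (i : ℕ) : ∀ {X Y : Type} [NormedAddCommGroup X] [NormedSpace ℝ X]
    [NormedAddCommGroup Y] [NormedSpace ℝ Y] (g : X → Y) (u v : ℝ → X) (t : ℝ),
    ContDiffAt ℝ ∞ g (u t) → ContDiffAt ℝ ∞ u t → ContDiffAt ℝ ∞ v t →
    (∀ j ≤ i, iteratedDeriv j u t = iteratedDeriv j v t) →
    iteratedDeriv i (fun s => g (u s)) t = iteratedDeriv i (fun s => g (v s)) t := by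
  induction i with
  | zero =>
    intro X Y _ _ _ _ g u v t _ _ _ h
    have := h 0 le_rfl
    simp only [iteratedDeriv_zero] at this ⊢
    rw [this]
  | succ i ih =>
    intro X Y _ _ _ _ g u v t hg hu hv h
    have huv : u t = v t := by simpa using h 0 (Nat.zero_le _)
    have key : ∀ w : ℝ → X, ContDiffAt ℝ ∞ g (w t) → ContDiffAt ℝ ∞ w t →
        iteratedDeriv (i + 1) (fun s => g (w s)) t =
          iteratedDeriv i (fun s => (fun p : X × X => fderiv ℝ g p.1 p.2) (w s, deriv w s)) t := by
      intro w hgw hw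
      rw [iteratedDeriv_succ']
      apply Filter.EventuallyEq.iteratedDeriv_eq
      have h1 : ∀ᶠ x in 𝓝 (w t), ContDiffAt ℝ 1 g x :=
        (hgw.of_le (by exact_mod_cast le_top)).eventually (by simp)
      have h2 : ∀ᶠ s in 𝓝 t, ContDiffAt ℝ 1 w s :=
        (hw.of_le (by exact_mod_cast le_top)).eventually (by simp)
      filter_upwards [hw.continuousAt.eventually h1, h2] with s hs1 hs2
      exact fderiv_comp_deriv s (hs1.differentiableAt (by simp)) (hs2.differentiableAt (by simp))
    rw [key u hg hu, key v (huv ▸ hg) hv]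
    have hdu : ∀ w : ℝ → X, ContDiffAt ℝ ∞ w t → ContDiffAt ℝ ∞ (deriv w) t := fun w hw => by
      have : ContDiffAt ℝ ∞ (fderiv ℝ w) t := hw.fderiv_right (by simp)
      exact this.clm_apply contDiffAt_const
    refine ih (fun p : X × X => fderiv ℝ g p.1 p.2) (fun s => (u s, deriv u s))
      (fun s => (v s, deriv v s)) t ?_ ?_ ?_ ?_
    · have : ContDiffAt ℝ ∞ (fderiv ℝ g) (u t) := hg.fderiv_right (by simp)
      exact ContDiffAt.clm_apply (f := fun p : X × X => fderiv ℝ g p.1)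
        (ContDiffAt.comp (u t, deriv u t) this contDiffAt_fst) contDiffAt_snd
    · exact hu.prodMk (hdu u hu)
    · exact hv.prodMk (hdu v hv)
    · intro j hj
      rw [iteratedDeriv_pair hu (hdu u hu), iteratedDeriv_pair hv (hdu v hv), h j (by omega),
        ← iteratedDeriv_succ', ← iteratedDeriv_succ', h (j + 1) (by omega)]

/-- Iterated partial derivatives in the last variable of a smooth function are smooth. -/
theorem contDiffOn_iteratedDeriv_right {Z Y : Type*} [NormedAddCommGroup Z] [NormedSpace ℝ Z]
    [NormedAddCommGroup Y] [NormedSpace ℝ Y] {G : Z × ℝ → Y} {U : Set (Z × ℝ)} (hU : IsOpen U)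
    (hG : ContDiffOn ℝ ∞ G U) (i : ℕ) :
    ContDiffOn ℝ ∞ (fun p : Z × ℝ => iteratedDeriv i (fun s => G (p.1, s)) p.2) U := by
  induction i with
  | zero => simpa using hG
  | succ i ih =>
    have h1 : ContDiffOn ℝ ∞ (fun p : Z × ℝ =>
        fderiv ℝ (fun p : Z × ℝ => iteratedDeriv i (fun s => G (p.1, s)) p.2) p ((0 : Z), (1 : ℝ)))
        U := (ih.fderiv_of_isOpen hU (by simp)).clm_apply contDiffOn_const
    refine h1.congr fun p hp => ?_
    rw [iteratedDeriv_succ]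
    have hd : DifferentiableAt ℝ (fun p : Z × ℝ => iteratedDeriv i (fun s => G (p.1, s)) p.2)
        (p.1, p.2) := (ih.contDiffAt (hU.mem_nhds hp)).differentiableAt (by simp)
    have hl : HasDerivAt (fun s : ℝ => ((p.1, s) : Z × ℝ)) ((0 : Z), (1 : ℝ)) p.2 :=
      (hasDerivAt_const p.2 p.1).prodMk (hasDerivAt_id p.2)
    exact (hd.hasFDerivAt.comp_hasDerivAt p.2 hl).deriv

/-- Coordinates `(t, q^A)` of a fibred manifold over the line with `n`-dimensional fibres. -/
abbrev BaseModel (n : ℕ) : Type := ℝ × (Fin n → ℝ)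

/-- Coordinates `(t, q_0^A, …, q_r^A)` of `r`-jets. -/
abbrev JetModel (n r : ℕ) : Type := ℝ × (Fin (r + 1) → Fin n → ℝ)

/-- The polynomial curve with derivatives `q_0, …, q_r` at time `t`. -/
def taylorCurve {n r : ℕ} (z : JetModel n r) (s : ℝ) : Fin n → ℝ :=
  ∑ i : Fin (r + 1), ((s - z.1) ^ (i : ℕ) * ((i : ℕ).factorial : ℝ)⁻¹) • z.2 i

theorem contDiff_taylorCurve {n r : ℕ} :
    ContDiff ℝ ∞ (fun p : JetModel n r × ℝ => taylorCurve p.1 p.2) := by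
  unfold taylorCurve
  fun_prop

theorem iteratedDeriv_taylorCurve {n r : ℕ} (z : JetModel n r) (i : Fin (r + 1)) :
    iteratedDeriv i (taylorCurve z) z.1 = z.2 i := by
  unfold taylorCurve
  have key : ∀ m : ℕ, iteratedDeriv (i : ℕ) (fun s : ℝ => (s - z.1) ^ m * ((m.factorial : ℝ)⁻¹)) z.1
      = if m = i then 1 else 0 := by
    intro m
    have h1 : iteratedDeriv (i : ℕ) (fun s : ℝ => (s - z.1) ^ m) z.1
        = if (i : ℕ) = m then (m.factorial : ℝ) else 0 := by
      have h := congrFun (iteratedDeriv_comp_sub_const (i : ℕ) (fun s : ℝ => s ^ m) z.1) z.1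
      rw [h, sub_self, iteratedDeriv_fun_pow_zero]
      push_cast
      rfl
    have h2 : (fun s : ℝ => (s - z.1) ^ m * ((m.factorial : ℝ)⁻¹))
        = ((m.factorial : ℝ)⁻¹) • fun s : ℝ => (s - z.1) ^ m := by
      funext s
      rw [Pi.smul_apply, smul_eq_mul, mul_comm]
    rw [h2, iteratedDeriv_const_smul_field, h1]
    have hm : (m.factorial : ℝ) ≠ 0 := by positivity
    rcases eq_or_ne m (i : ℕ) with h | h
    · rw [if_pos h, if_pos h.symm, smul_eq_mul, inv_mul_cancel₀ hm]
    · rw [if_neg h, if_neg h.symm, smul_zero]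
  rw [iteratedDeriv_fun_sum (fun j _ => by fun_prop)]
  rw [Finset.sum_eq_single i]
  · rw [iteratedDeriv_smul_const (by fun_prop), key]; simp
  · intro j _ hj
    rw [iteratedDeriv_smul_const (by fun_prop), key, if_neg (by omega)]; simp
  · simp


theorem isOpen_jet_trans_source {n r : ℕ} {E : Type*} [TopologicalSpace E]
    (e e' : OpenPartialHomeomorph E (BaseModel n)) :
    IsOpen {z : JetModel n r | (z.1, z.2 0) ∈ e.target ∩ e.symm ⁻¹' e'.source} :=
  (e.isOpen_inter_preimage_symm e'.open_source).preimage
    (f := fun z : JetModel n r => ((z.1, z.2 0) : BaseModel n)) (by fun_prop)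

section Jets

variable {n : ℕ} {E : Type*} [TopologicalSpace E] [ChartedSpace (BaseModel n) E]

/-- A chart `(t, q^A)` of `E` is adapted to `π` if its first coordinate `t` is `π`. -/
def IsAdapted (π : E → ℝ) (e : OpenPartialHomeomorph E (BaseModel n)) : Prop :=
  e ∈ IsManifold.maximalAtlas 𝓘(ℝ, BaseModel n) ∞ E ∧ ∀ x ∈ e.source, (e x).1 = π x

variable (n E) in
/-- A smooth bundle over the line with `n`-dimensional fibres: a surjection `π : E → ℝ` with adapted
charts around every point, i.e. a surjective submersion. No local triviality is asked for. -/
structure Fibred where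
  proj : E → ℝ
  surjective : Function.Surjective proj
  exists_adapted : ∀ x : E, ∃ e : OpenPartialHomeomorph E (BaseModel n),
    IsAdapted proj e ∧ x ∈ e.source

variable (π : Fibred n E)

/-- `φ` is a smooth section of `π` in a neighbourhood of the time `t`. -/
def IsSectionNear (φ : ℝ → E) (t : ℝ) : Prop :=
  ∀ᶠ s in 𝓝 t, ContMDiffAt 𝓘(ℝ, ℝ) 𝓘(ℝ, BaseModel n) ∞ φ s ∧ π.proj (φ s) = s

/-- Local sections `φ` of `π` around a base time `t`. -/
structure LocalSection where
  time : ℝ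
  map : ℝ → E
  isSection : IsSectionNear π map time

/-- The coordinates `q_i^A = d^i φ^A / dt^i` of the local section `φ`. -/
def LocalSection.coord {π : Fibred n E} (φ : LocalSection π)
    (e : OpenPartialHomeomorph E (BaseModel n)) (i : ℕ) : Fin n → ℝ :=
  iteratedDeriv i (fun s => (e (φ.map s)).2) φ.time

/-- Two local sections have the same `r`-jet if they have the same time and the same value there,
and in adapted charts the same derivatives up to order `r`. -/
def jetSetoid (r : ℕ) : Setoid (LocalSection π) where
  r φ χ := φ.time = χ.time ∧ φ.map φ.time = χ.map χ.time ∧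
    ∀ e, IsAdapted π.proj e → φ.map φ.time ∈ e.source → ∀ i ≤ r, φ.coord e i = χ.coord e i
  iseqv :=
    { refl := fun _ => ⟨rfl, rfl, fun _ _ _ _ _ => rfl⟩
      symm := fun h => ⟨h.1.symm, h.2.1.symm,
        fun e he hs i hi => (h.2.2 e he (h.2.1 ▸ hs) i hi).symm⟩
      trans := fun h h' => ⟨h.1.trans h'.1, h.2.1.trans h'.2.1, fun e he hs i hi =>
        (h.2.2 e he hs i hi).trans (h'.2.2 e he (h.2.1 ▸ hs) i hi)⟩ }

/-- The jet bundle `J^r π`. -/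
def Jet (r : ℕ) : Type _ := Quotient (jetSetoid π r)

variable {π}

/-- The `r`-jet of a local section. -/
def LocalSection.jet (r : ℕ) (φ : LocalSection π) : Jet π r := Quotient.mk (jetSetoid π r) φ

/-- A local section representing a jet. -/
def Jet.rep {r : ℕ} (y : Jet π r) : LocalSection π := Quotient.out y

theorem Jet.jet_rep {r : ℕ} (y : Jet π r) : y.rep.jet r = y := Quotient.out_eq y

theorem LocalSection.jet_eq_iff {r : ℕ} {φ χ : LocalSection π} :
    φ.jet r = χ.jet r ↔ φ.time = χ.time ∧ φ.map φ.time = χ.map χ.time ∧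
      ∀ e, IsAdapted π.proj e → φ.map φ.time ∈ e.source → ∀ i ≤ r, φ.coord e i = χ.coord e i :=
  ⟨fun h => Quotient.exact h, fun h => Quotient.sound h⟩

/-- The projection `π^r : J^r π → E`. -/
def Jet.point {r : ℕ} (y : Jet π r) : E :=
  Quotient.lift (s := jetSetoid π r) (fun φ => φ.map φ.time) (fun _ _ h => h.2.1) y

/-- The projection `π̄^r : J^r π → ℝ`. -/
def Jet.time {r : ℕ} (y : Jet π r) : ℝ :=
  Quotient.lift (s := jetSetoid π r) (fun φ => φ.time) (fun _ _ h => h.1) y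

@[simp] theorem LocalSection.point_jet (r : ℕ) (φ : LocalSection π) :
    (φ.jet r).point = φ.map φ.time := rfl

@[simp] theorem LocalSection.time_jet (r : ℕ) (φ : LocalSection π) :
    (φ.jet r).time = φ.time := rfl

/-- The projection `π^s_r : J^s π → J^r π` for `r ≤ s`. -/
def Jet.proj {r s : ℕ} (h : r ≤ s) (y : Jet π s) : Jet π r :=
  Quotient.lift (s := jetSetoid π s) (fun φ => φ.jet r)
    (fun _ _ hφ => LocalSection.jet_eq_iff.2
      ⟨hφ.1, hφ.2.1, fun e he hs i hi => hφ.2.2 e he hs i (hi.trans h)⟩) y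

@[simp] theorem LocalSection.proj_jet {r s : ℕ} (h : r ≤ s) (φ : LocalSection π) :
    Jet.proj h (φ.jet s) = φ.jet r := rfl

theorem isSectionNear_symm {e : OpenPartialHomeomorph E (BaseModel n)} (he : IsAdapted π.proj e)
    {u : ℝ → Fin n → ℝ} (hu : ContDiff ℝ ∞ u) {t : ℝ} (ht : (t, u t) ∈ e.target) :
    IsSectionNear π (fun s => e.symm (s, u s)) t := by
  have hc : ContDiff ℝ ∞ (fun s => ((s, u s) : BaseModel n)) := contDiff_id.prodMk hu
  filter_upwards [hc.continuous.continuousAt.preimage_mem_nhds (e.open_target.mem_nhds ht)]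
    with s hs
  refine ⟨?_, ?_⟩
  · exact (contMDiffAt_symm_of_mem_maximalAtlas he.1 hs).comp s hc.contDiffAt.contMDiffAt
  · rw [← he.2 _ (e.map_target hs), e.right_inv hs]

instance {r : ℕ} : Nonempty (Jet π r) := by
  obtain ⟨x, -⟩ := π.surjective 0
  obtain ⟨e, he, hx⟩ := π.exists_adapted x
  exact ⟨LocalSection.jet r ⟨(e x).1, _, isSectionNear_symm he (u := fun _ => (e x).2)
    contDiff_const (e.map_source hx)⟩⟩

variable (π) in
open Classical in
/-- The prolongation `j^r φ : ℝ → J^r π`; it has a junk value at the times near which `φ` is not a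
smooth section of `π`. -/
def prolong (r : ℕ) (φ : ℝ → E) (t : ℝ) : Jet π r :=
  if h : IsSectionNear π φ t then LocalSection.jet r ⟨t, φ, h⟩ else Classical.arbitrary _

theorem prolong_of {r : ℕ} {φ : ℝ → E} {t : ℝ} (h : IsSectionNear π φ t) :
    prolong π r φ t = LocalSection.jet r ⟨t, φ, h⟩ := dif_pos h

/-- The coordinates `(t, q_0^A, …, q_r^A)` on `J^r π` induced by an adapted chart of `E`. -/
def jetCoord (r : ℕ) (e : OpenPartialHomeomorph E (BaseModel n)) (y : Jet π r) : JetModel n r :=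
  (y.time, fun i => y.rep.coord e i)

/-- The jet with given coordinates. -/
def ofJetCoord (r : ℕ) (e : OpenPartialHomeomorph E (BaseModel n)) (z : JetModel n r) : Jet π r :=
  prolong π r (fun s => e.symm (s, taylorCurve z s)) z.1

theorem taylorCurve_self {r : ℕ} (z : JetModel n r) : taylorCurve z z.1 = z.2 0 := by
  simpa using iteratedDeriv_taylorCurve z 0

theorem contDiff_taylorCurve_right {r : ℕ} (z : JetModel n r) : ContDiff ℝ ∞ (taylorCurve z) :=
  contDiff_taylorCurve.comp (contDiff_const.prodMk contDiff_id)

theorem jetCoord_jet {r : ℕ} {e : OpenPartialHomeomorph E (BaseModel n)} (he : IsAdapted π.proj e)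
    {φ : LocalSection π} (hφ : φ.map φ.time ∈ e.source) :
    jetCoord r e (φ.jet r) = (φ.time, fun i : Fin (r + 1) => φ.coord e i) := by
  have h := LocalSection.jet_eq_iff.1 (φ.jet r).jet_rep
  refine Prod.ext rfl (funext fun i => ?_)
  exact h.2.2 e he (h.2.1 ▸ hφ) i (by omega)

theorem LocalSection.coord_zero {e : OpenPartialHomeomorph E (BaseModel n)} (φ : LocalSection π) :
    φ.coord e 0 = (e (φ.map φ.time)).2 := by
  simp [LocalSection.coord]

theorem isSectionNear_taylor {r : ℕ} {e : OpenPartialHomeomorph E (BaseModel n)}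
    (he : IsAdapted π.proj e) {z : JetModel n r} (hz : (z.1, z.2 0) ∈ e.target) :
    IsSectionNear π (fun s => e.symm (s, taylorCurve z s)) z.1 :=
  isSectionNear_symm he (contDiff_taylorCurve_right z) (by rwa [taylorCurve_self])

theorem ofJetCoord_eq {r : ℕ} {e : OpenPartialHomeomorph E (BaseModel n)}
    (he : IsAdapted π.proj e) {z : JetModel n r} (hz : (z.1, z.2 0) ∈ e.target) :
    ofJetCoord (π := π) r e z = LocalSection.jet r ⟨z.1, _, isSectionNear_taylor he hz⟩ :=
  prolong_of _

theorem jetCoord_ofJetCoord {r : ℕ} {e e' : OpenPartialHomeomorph E (BaseModel n)}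
    (he : IsAdapted π.proj e) (he' : IsAdapted π.proj e') {z : JetModel n r}
    (hz : (z.1, z.2 0) ∈ e.target) (hz' : e.symm (z.1, z.2 0) ∈ e'.source) :
    jetCoord r e' (ofJetCoord (π := π) r e z) = (z.1, fun i : Fin (r + 1) =>
      iteratedDeriv i (fun s => (e' (e.symm (s, taylorCurve z s))).2) z.1) := by
  rw [ofJetCoord_eq he hz, jetCoord_jet he' (by simpa [taylorCurve_self] using hz')]
  rfl

theorem contDiffAt_of_isSectionNear {e : OpenPartialHomeomorph E (BaseModel n)}
    (he : IsAdapted π.proj e) {φ : ℝ → E} {t : ℝ} (h : IsSectionNear π φ t)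
    (ht : φ t ∈ e.source) : ContDiffAt ℝ ∞ (fun s => e (φ s)) t :=
  ((contMDiffAt_of_mem_maximalAtlas he.1 ht).comp t h.self_of_nhds.1).contDiffAt

theorem ofJetCoord_jetCoord {r : ℕ} {e : OpenPartialHomeomorph E (BaseModel n)}
    (he : IsAdapted π.proj e) {y : Jet π r} (hy : y.point ∈ e.source) :
    ofJetCoord r e (jetCoord r e y) = y := by
  obtain ⟨φ, rfl⟩ : ∃ φ : LocalSection π, φ.jet r = y := ⟨_, y.jet_rep⟩
  rw [LocalSection.point_jet] at hy
  rw [jetCoord_jet he hy]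
  set z : JetModel n r := (φ.time, fun i : Fin (r + 1) => φ.coord e i) with hzdef
  have hπ : π.proj (φ.map φ.time) = φ.time := φ.isSection.self_of_nhds.2
  have hz0 : ((z.1, z.2 0) : BaseModel n) = e (φ.map φ.time) :=
    Prod.ext ((he.2 _ hy).trans hπ).symm (by simp [hzdef, LocalSection.coord_zero])
  have hz : ((z.1, z.2 0) : BaseModel n) ∈ e.target := hz0 ▸ e.map_source hy
  have hp : e.symm (z.1, z.2 0) = φ.map φ.time := by rw [hz0, e.left_inv hy]
  rw [ofJetCoord_eq he hz]
  symm
  rw [LocalSection.jet_eq_iff]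
  refine ⟨rfl, ?_, ?_⟩
  · simp only [taylorCurve_self, hp]
  intro e' he' hs i hi
  let u : ℝ → BaseModel n := fun s => e (φ.map s)
  let v : ℝ → BaseModel n := fun s => (s, taylorCurve z s)
  let g : BaseModel n → Fin n → ℝ := fun x => (e' (e.symm x)).2
  have hu : ContDiffAt ℝ ∞ u φ.time := contDiffAt_of_isSectionNear he φ.isSection hy
  have hv : ContDiffAt ℝ ∞ v φ.time :=
    (contDiff_id.prodMk (contDiff_taylorCurve_right z)).contDiffAt
  have hg : ContDiffAt ℝ ∞ g (u φ.time) := by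
    have h1 : ContMDiffAt 𝓘(ℝ, BaseModel n) 𝓘(ℝ, BaseModel n) ∞ (e' ∘ e.symm) (u φ.time) :=
      ContMDiffAt.comp _ (contMDiffAt_of_mem_maximalAtlas he'.1 (by simpa [u, e.left_inv hy] using hs))
        (contMDiffAt_symm_of_mem_maximalAtlas he.1 (e.map_source hy))
    exact h1.contDiffAt.snd
  have hev : ∀ᶠ s in 𝓝 φ.time, φ.map s ∈ e.source ∧ π.proj (φ.map s) = s := by
    filter_upwards [φ.isSection.self_of_nhds.1.continuousAt.preimage_mem_nhds
      (e.open_source.mem_nhds hy), φ.isSection] with s h1 h2 using ⟨h1, h2.2⟩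
  have hu' : u =ᶠ[𝓝 φ.time] fun s => (s, (e (φ.map s)).2) := by
    filter_upwards [hev] with s hs
    exact Prod.ext ((he.2 _ hs.1).trans hs.2) rfl
  have hjet : ∀ j ≤ i, iteratedDeriv j u φ.time = iteratedDeriv j v φ.time := by
    intro j hj
    rw [hu'.iteratedDeriv_eq j, iteratedDeriv_pair (u := fun s : ℝ => s) contDiffAt_id hu.snd,
      iteratedDeriv_pair (u := fun s : ℝ => s) contDiffAt_id
        (contDiff_taylorCurve_right z).contDiffAt]
    refine Prod.ext rfl ?_
    exact (iteratedDeriv_taylorCurve z ⟨j, by omega⟩).symm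
  have main := iteratedDeriv_comp_congr i g u v φ.time hg hu hv hjet
  have hl : (fun s => (e' (φ.map s)).2) =ᶠ[𝓝 φ.time] fun s => g (u s) := by
    filter_upwards [hev] with s hs
    simp only [g, u, e.left_inv hs.1]
  exact (hl.iteratedDeriv_eq i).trans main


variable (π) in
/-- The chart of `J^r π` induced by an adapted chart of `E`, before there is a topology. -/
def jetPartialEquiv (r : ℕ) (e : OpenPartialHomeomorph E (BaseModel n))
    (he : IsAdapted π.proj e) : PartialEquiv (Jet π r) (JetModel n r) where
  toFun := jetCoord r e
  invFun := ofJetCoord r e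
  source := {y | y.point ∈ e.source}
  target := {z | (z.1, z.2 0) ∈ e.target}
  map_source' y hy := by
    obtain ⟨φ, rfl⟩ : ∃ φ : LocalSection π, φ.jet r = y := ⟨_, y.jet_rep⟩
    have hy' : φ.map φ.time ∈ e.source := hy
    have h0 : ((φ.time, φ.coord e 0) : BaseModel n) = e (φ.map φ.time) :=
      Prod.ext ((he.2 _ hy').trans φ.isSection.self_of_nhds.2).symm φ.coord_zero
    rw [jetCoord_jet he hy']
    change (φ.time, φ.coord e 0) ∈ e.target
    rw [h0]
    exact e.map_source hy'
  map_target' z hz := by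
    have hz' : (z.1, z.2 0) ∈ e.target := hz
    rw [ofJetCoord_eq he hz']
    simpa [taylorCurve_self] using e.map_target hz'
  left_inv' _ hy := ofJetCoord_jetCoord he hy
  right_inv' z hz := by
    have hz' : (z.1, z.2 0) ∈ e.target := hz
    rw [jetCoord_ofJetCoord he he hz' (e.map_target hz')]
    refine Prod.ext rfl (funext fun i => ?_)
    rw [← iteratedDeriv_taylorCurve z i]
    apply Filter.EventuallyEq.iteratedDeriv_eq
    have hc : Continuous fun s => ((s, taylorCurve z s) : BaseModel n) :=
      continuous_id.prodMk (contDiff_taylorCurve_right z).continuous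
    filter_upwards [hc.continuousAt.preimage_mem_nhds (e.open_target.mem_nhds
      (by simpa [taylorCurve_self] using hz'))] with s hs
    rw [e.right_inv hs]

theorem jetPartialEquiv_trans_source {r : ℕ} {e e' : OpenPartialHomeomorph E (BaseModel n)}
    (he : IsAdapted π.proj e) (he' : IsAdapted π.proj e') :
    ((jetPartialEquiv π r e he).symm.trans (jetPartialEquiv π r e' he')).source =
      {z | (z.1, z.2 0) ∈ e.target ∩ e.symm ⁻¹' e'.source} := by
  ext z
  rw [PartialEquiv.trans_source]
  refine and_congr_right fun hz => ?_
  have hz' : (z.1, z.2 0) ∈ e.target := hz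
  change (ofJetCoord r e z).point ∈ e'.source ↔ _
  rw [ofJetCoord_eq he hz']
  simp [taylorCurve_self]

theorem contDiffOn_jet_trans {r : ℕ} {e e' : OpenPartialHomeomorph E (BaseModel n)}
    (he : IsAdapted π.proj e) (he' : IsAdapted π.proj e') :
    ContDiffOn ℝ ∞ ((jetPartialEquiv π r e he).symm.trans (jetPartialEquiv π r e' he'))
      ((jetPartialEquiv π r e he).symm.trans (jetPartialEquiv π r e' he')).source := by
  rw [jetPartialEquiv_trans_source]
  have hT : ContDiffOn ℝ ∞ (e' ∘ e.symm) (e.target ∩ e.symm ⁻¹' e'.source) := by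
    have := (contMDiffOn_of_mem_maximalAtlas he'.1).comp'
      (contMDiffOn_symm_of_mem_maximalAtlas he.1)
    exact this.contDiffOn
  let U : Set (JetModel n r × ℝ) :=
    {p | (p.2, taylorCurve p.1 p.2) ∈ e.target ∩ e.symm ⁻¹' e'.source}
  have hc : ContDiff ℝ ∞ fun p : JetModel n r × ℝ => ((p.2, taylorCurve p.1 p.2) : BaseModel n) :=
    contDiff_snd.prodMk contDiff_taylorCurve
  have hU : IsOpen U := (e.isOpen_inter_preimage_symm e'.open_source).preimage hc.continuous
  have hG : ContDiffOn ℝ ∞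
      (fun p : JetModel n r × ℝ => (e' (e.symm (p.2, taylorCurve p.1 p.2))).2) U :=
    (hT.comp hc.contDiffOn fun _ hp => hp).snd
  have hcoord : ContDiffOn ℝ ∞ (fun z : JetModel n r => ((z.1, fun i : Fin (r + 1) =>
      iteratedDeriv i (fun s => (e' (e.symm (s, taylorCurve z s))).2) z.1) : JetModel n r))
      {z | (z.1, z.2 0) ∈ e.target ∩ e.symm ⁻¹' e'.source} := by
    refine contDiff_fst.contDiffOn.prodMk (contDiffOn_pi.2 fun i => ?_)
    have hi := contDiffOn_iteratedDeriv_right hU hG (i : ℕ)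
    refine hi.comp (f := fun z : JetModel n r => (z, z.1))
      (contDiff_id.prodMk contDiff_fst).contDiffOn fun z hz => ?_
    change ((z.1, taylorCurve z z.1) : BaseModel n) ∈ e.target ∩ e.symm ⁻¹' e'.source
    rw [taylorCurve_self]
    exact hz
  exact hcoord.congr fun z hz => jetCoord_ofJetCoord he he' hz.1 hz.2

variable (π) in
/-- The charts of `J^r π` are those induced by the adapted charts of `E`. -/
def jetCore (r : ℕ) : ChartedSpaceCore (JetModel n r) (Jet π r) where
  atlas := {c | ∃ e he, c = jetPartialEquiv π r e he}
  chartAt y := jetPartialEquiv π r (π.exists_adapted y.point).choose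
    (π.exists_adapted y.point).choose_spec.1
  mem_chart_source y := (π.exists_adapted y.point).choose_spec.2
  chart_mem_atlas _ := ⟨_, _, rfl⟩
  open_source := by
    rintro _ _ ⟨e, he, rfl⟩ ⟨e', he', rfl⟩
    rw [jetPartialEquiv_trans_source]
    exact isOpen_jet_trans_source e e'
  continuousOn_toFun := by
    rintro _ _ ⟨e, he, rfl⟩ ⟨e', he', rfl⟩
    exact (contDiffOn_jet_trans he he').continuousOn

instance (r : ℕ) : TopologicalSpace (Jet π r) := (jetCore π r).toTopologicalSpace

instance (r : ℕ) : ChartedSpace (JetModel n r) (Jet π r) := (jetCore π r).toChartedSpace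

/-- The chart `(t, q_0^A, …, q_r^A)` of `J^r π` induced by an adapted chart `(t, q^A)` of `E`. -/
def jetChart (r : ℕ) (e : OpenPartialHomeomorph E (BaseModel n)) (he : IsAdapted π.proj e) :
    OpenPartialHomeomorph (Jet π r) (JetModel n r) :=
  (jetCore π r).openPartialHomeomorph (jetPartialEquiv π r e he) ⟨e, he, rfl⟩

theorem jetChart_mem_atlas (r : ℕ) {e : OpenPartialHomeomorph E (BaseModel n)}
    (he : IsAdapted π.proj e) : jetChart r e he ∈ atlas (JetModel n r) (Jet π r) :=
  mem_iUnion₂.2 ⟨_, ⟨e, he, rfl⟩, rfl⟩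

instance (r : ℕ) : IsManifold 𝓘(ℝ, JetModel n r) ∞ (Jet π r) := by
  apply isManifold_of_contDiffOn
  intro c c' hc hc'
  obtain ⟨_, ⟨e, he, rfl⟩, rfl⟩ := mem_iUnion₂.1 hc
  obtain ⟨_, ⟨e', he', rfl⟩, rfl⟩ := mem_iUnion₂.1 hc'
  simp only [modelWithCornersSelf_coe, modelWithCornersSelf_coe_symm, Function.id_comp,
    Function.comp_id, preimage_id, range_id, inter_univ]
  exact contDiffOn_jet_trans he he'

theorem jetChart_mem_maximalAtlas (r : ℕ) {e : OpenPartialHomeomorph E (BaseModel n)}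
    (he : IsAdapted π.proj e) :
    jetChart r e he ∈ IsManifold.maximalAtlas 𝓘(ℝ, JetModel n r) ∞ (Jet π r) :=
  IsManifold.subset_maximalAtlas (jetChart_mem_atlas r he)

theorem contMDiff_jetProj {r s : ℕ} (h : r ≤ s) :
    ContMDiff 𝓘(ℝ, JetModel n s) 𝓘(ℝ, JetModel n r) ∞ (Jet.proj h : Jet π s → Jet π r) := by
  intro y
  obtain ⟨e, he, hy⟩ := π.exists_adapted y.point
  have hys : y ∈ (jetChart s e he).source := hy
  let c : JetModel n s → JetModel n r := fun z => (z.1, fun i => z.2 ⟨i, by omega⟩)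
  have hc : ContDiff ℝ ∞ c := by
    simp only [c]; fun_prop
  have hmap : c (jetChart s e he y) ∈ (jetChart r e he).target :=
    (jetPartialEquiv π s e he).map_source hy
  have h1 : ContMDiffAt 𝓘(ℝ, JetModel n s) 𝓘(ℝ, JetModel n r) ∞
      ((jetChart r e he).symm ∘ c ∘ jetChart s e he) y :=
    (contMDiffAt_symm_of_mem_maximalAtlas (jetChart_mem_maximalAtlas r he) hmap).comp y
      (hc.contMDiff.contMDiffAt.comp y
        (contMDiffAt_of_mem_maximalAtlas (jetChart_mem_maximalAtlas s he) hys))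
  refine h1.congr_of_eventuallyEq ?_
  filter_upwards [(jetChart s e he).open_source.mem_nhds hys] with y' hy'
  obtain ⟨φ, rfl⟩ : ∃ φ : LocalSection π, φ.jet s = y' := ⟨_, y'.jet_rep⟩
  have hφ : φ.map φ.time ∈ e.source := hy'
  have hcc : c (jetChart s e he (φ.jet s)) = jetChart r e he (φ.jet r) :=
    (congrArg c (jetCoord_jet (r := s) he hφ)).trans (jetCoord_jet (r := r) he hφ).symm
  change φ.jet r = (jetChart r e he).symm (c (jetChart s e he (φ.jet s)))
  rw [hcc, (jetChart r e he).left_inv]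
  exact hφ

variable (π) in
/-- The projection `π^s_r : J^s π → J^r π` as a smooth map. -/
def jetProj {r s : ℕ} (h : r ≤ s) :
    ContMDiffMap 𝓘(ℝ, JetModel n s) 𝓘(ℝ, JetModel n r) (Jet π s) (Jet π r) ∞ :=
  ⟨Jet.proj h, contMDiff_jetProj h⟩

end Jets

section Phase

variable {n : ℕ} {E : Type*} [TopologicalSpace E] [ChartedSpace (BaseModel n) E] {π : Fibred n E}

/-- The cotangent space `T^*_y (J^r π)`. -/
abbrev CotangentSpace {r : ℕ} (y : Jet π r) : Type :=
  TangentSpace 𝓘(ℝ, JetModel n r) y →L[ℝ] Bundle.Trivial (Jet π r) ℝ y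

variable (π) in
/-- The cotangent bundle `T^*(J^r π)`, a smooth vector bundle over `J^r π`. -/
abbrev Cotangent (r : ℕ) : Type _ :=
  Bundle.TotalSpace (JetModel n r →L[ℝ] ℝ) (CotangentSpace (π := π) (r := r))

variable (π) in
/-- The extended jet-momentum bundle `W = J^{2k-1} π ×_{J^{k-1} π} T^*(J^{k-1} π)`, the pullback of
the cotangent bundle of `J^{k-1} π` to `J^{2k-1} π`; a point is a pair `⟨y, α⟩`. -/
abbrev Phase (k : ℕ) : Type _ :=
  Bundle.TotalSpace (JetModel n (k - 1) →L[ℝ] ℝ)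
    (Bundle.Pullback (jetProj π (show k - 1 ≤ 2 * k - 1 by omega))
      (CotangentSpace (π := π) (r := k - 1)))

/-- The model of the manifold `T^*(J^r π)`. -/
abbrev cotangentModel (n r : ℕ) := 𝓘(ℝ, JetModel n r).prod 𝓘(ℝ, JetModel n r →L[ℝ] ℝ)

/-- The model of the manifold `W`. -/
abbrev phaseModel (n k : ℕ) :=
  𝓘(ℝ, JetModel n (2 * k - 1)).prod 𝓘(ℝ, JetModel n (k - 1) →L[ℝ] ℝ)

/-- The projection `ρ₁ : W → J^{2k-1} π`. -/
def rho1 {k : ℕ} (w : Phase π k) : Jet π (2 * k - 1) := w.proj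

/-- The projection `ρ₂ : W → T^*(J^{k-1} π)`. -/
def rho2 {k : ℕ} (w : Phase π k) : Cotangent π (k - 1) :=
  Bundle.Pullback.lift (jetProj π (show k - 1 ≤ 2 * k - 1 by omega)) w

/-- The projection `W → E`. -/
def rhoE {k : ℕ} (w : Phase π k) : E := (rho1 w).point

/-- The projection `ρ_ℝ : W → ℝ`. -/
def rhoR {k : ℕ} (w : Phase π k) : ℝ := (rho1 w).time

/-- The exterior derivative `dθ` of a `1`-form `θ` on a manifold `M` without boundary. In the
preferred chart `c` at `x` it is `dθ(u, v) = D_u θ(v) - D_v θ(u)`. -/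
def extDerivOneForm {V H M : Type*} [NormedAddCommGroup V] [NormedSpace ℝ V] [TopologicalSpace H]
    (I : ModelWithCorners ℝ V H) [TopologicalSpace M] [ChartedSpace H M]
    (θ : ∀ x : M, TangentSpace I x →L[ℝ] ℝ) (x : M) (u v : TangentSpace I x) : ℝ :=
  let c := extChartAt I x
  let θc : V → V →L[ℝ] ℝ := fun z => (θ (c.symm z)).comp (mfderiv 𝓘(ℝ, V) I c.symm z)
  let uc : V := mfderiv I 𝓘(ℝ, V) c x u
  let vc : V := mfderiv I 𝓘(ℝ, V) c x v
  fderiv ℝ θc (c x) uc vc - fderiv ℝ θc (c x) vc uc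

/-- The tautological `1`-form on `T^*(J^r π)`: `⟨Θ(α) | u⟩ = ⟨α | T(proj) u⟩`. -/
def tautologicalForm (r : ℕ) (a : Cotangent π r) : TangentSpace (cotangentModel n r) a →L[ℝ] ℝ :=
  ContinuousLinearMap.comp (show TangentSpace 𝓘(ℝ, JetModel n r) a.proj →L[ℝ] ℝ from a.snd)
    (mfderiv (cotangentModel n r) 𝓘(ℝ, JetModel n r)
      (Bundle.TotalSpace.proj : Cotangent π r → Jet π r) a)

/-- The canonical symplectic form `-dΘ` on `T^*(J^r π)`. -/
def canonicalForm (r : ℕ) (a : Cotangent π r) (u v : TangentSpace (cotangentModel n r) a) : ℝ :=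
  -extDerivOneForm (cotangentModel n r) (tautologicalForm r) a u v

/-- The `2`-form `Ω = ρ₂^*(-dΘ)` on `W`; on vectors tangent to `W_o` it is the form `Ω_o`. -/
def omega {k : ℕ} (w : Phase π k) (u v : TangentSpace (phaseModel n k) w) : ℝ :=
  canonicalForm (k - 1) (rho2 w)
    (mfderiv (phaseModel n k) (cotangentModel n (k - 1)) (rho2 (π := π)) w u)
    (mfderiv (phaseModel n k) (cotangentModel n (k - 1)) (rho2 (π := π)) w v)

/-- The function `Ĉ` with `⟨α | T(j^{k-1} φ ∘ ρ_ℝ) u⟩ = Ĉ dt(u)` at `w = ⟨y, α⟩`, where the local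
section `φ` represents `y`; that is, `Ĉ(w) = ⟨α | (j^{k-1} φ)'(t)⟩`. The left-hand side is the
coupling `1`-form. -/
def couplingFun {k : ℕ} (w : Phase π k) : ℝ :=
  (show JetModel n (k - 1) →L[ℝ] ℝ from w.snd)
    (mfderiv 𝓘(ℝ, ℝ) 𝓘(ℝ, JetModel n (k - 1)) (prolong π (k - 1) (rho1 w).rep.map) (rhoR w) (1 : ℝ))

/-- The pullback `L̂` to `W` of a function `L` on `J^k π`. -/
def liftLagrangian {k : ℕ} (hk : 1 ≤ k) (L : Jet π k → ℝ) (w : Phase π k) : ℝ :=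
  L (Jet.proj (show k ≤ 2 * k - 1 by omega) (rho1 w))

/-- The Hamiltonian submanifold `W_o = {Ĉ dt = L̂ dt}` of `W`. -/
def hamiltonianSubmanifold {k : ℕ} (hk : 1 ≤ k) (L : Jet π k → ℝ) : Set (Phase π k) :=
  {w | couplingFun w = liftLagrangian hk L w}

/-- The tangent space `T_w W_o = ker d(Ĉ - L̂)` of the hypersurface `W_o` at one of its points. -/
def tangentWo {k : ℕ} (hk : 1 ≤ k) (L : Jet π k → ℝ) (w : Phase π k) :
    Set (TangentSpace (phaseModel n k) w) :=
  {u | mfderiv (phaseModel n k) 𝓘(ℝ, ℝ) (fun w' => couplingFun w' - liftLagrangian hk L w') w u = 0}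

/-- `X` is a smooth vector field on `W_o` (its values outside of `W_o` are irrelevant). -/
def IsVectorFieldWo {k : ℕ} (hk : 1 ≤ k) (L : Jet π k → ℝ)
    (X : ∀ w : Phase π k, TangentSpace (phaseModel n k) w) : Prop :=
  ContMDiffOn (phaseModel n k) (phaseModel n k).tangent ∞
    (fun w => (⟨w, X w⟩ : TangentBundle (phaseModel n k) (Phase π k)))
    (hamiltonianSubmanifold hk L) ∧
  ∀ w ∈ hamiltonianSubmanifold hk L, X w ∈ tangentWo hk L w

/-- `σ` is on the set `s` of times a smooth section of `ρ_ℝ^o : W_o → ℝ`. -/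
def IsSectionOn {k : ℕ} (hk : 1 ≤ k) (L : Jet π k → ℝ) (σ : ℝ → Phase π k) (s : Set ℝ) : Prop :=
  ContMDiffOn 𝓘(ℝ, ℝ) (phaseModel n k) ∞ σ s ∧
    ∀ t ∈ s, σ t ∈ hamiltonianSubmanifold hk L ∧ rhoR (σ t) = t

/-- The section `σ` is holonomic (of type `1`) on the open set `s`: there `ρ₁ ∘ σ` is the prolongation
`j^{2k-1} φ` of the section `φ = π^{2k-1} ∘ ρ₁ ∘ σ` of `π`. -/
def IsHolonomicOn {k : ℕ} (σ : ℝ → Phase π k) (s : Set ℝ) : Prop :=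
  ∀ t ∈ s, rho1 (σ t) = prolong π (2 * k - 1) (fun t' => rhoE (σ t')) t

/-- The velocity `σ'(t)`. -/
def velocity {k : ℕ} (σ : ℝ → Phase π k) (t : ℝ) : TangentSpace (phaseModel n k) (σ t) :=
  mfderiv 𝓘(ℝ, ℝ) (phaseModel n k) σ t (1 : ℝ)

/-- The function `i(X) ρ_ℝ^* dt`. -/
def timeComponent {k : ℕ} (X : ∀ w : Phase π k, TangentSpace (phaseModel n k) w)
    (w : Phase π k) : ℝ :=
  mfderiv (phaseModel n k) 𝓘(ℝ, ℝ) (rhoR (π := π)) w (X w)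

/-- `X` is transverse to `ρ_ℝ^o`. -/
def IsTransverse {k : ℕ} (hk : 1 ≤ k) (L : Jet π k → ℝ)
    (X : ∀ w : Phase π k, TangentSpace (phaseModel n k) w) : Prop :=
  ∀ w ∈ hamiltonianSubmanifold hk L, timeComponent X w ≠ 0

/-- `X` is a semispray of type `1` in `W_o`: its local integral sections are holonomic. Integral
sections are the sections which are integral curves up to the parametrization, that is, integral
curves of `X` itself if `i(X) ρ_ℝ^* dt = 1`, and those of `X / i(X) ρ_ℝ^* dt` if `X` is just
transverse. -/
def IsSemispray {k : ℕ} (hk : 1 ≤ k) (L : Jet π k → ℝ)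
    (X : ∀ w : Phase π k, TangentSpace (phaseModel n k) w) : Prop :=
  ∀ (a b : ℝ) (σ : ℝ → Phase π k), IsSectionOn hk L σ (Ioo a b) →
    (∀ t ∈ Ioo a b, X (σ t) = timeComponent X (σ t) • velocity σ t) → IsHolonomicOn σ (Ioo a b)

/-- The coordinate direction of `q_i^A`, where `i ≤ r`. -/
def jetUnit (r : ℕ) (i : ℕ) (A : Fin n) : JetModel n r :=
  (0, fun j B => if (j : ℕ) = i ∧ B = A then 1 else 0)

/-- The natural coordinate `p_A^i` of `w = ⟨y, α⟩`: the value of `α` at the coordinate vector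
`∂/∂q_i^A` of `J^{k-1} π`. -/
def momentum {k : ℕ} {e : OpenPartialHomeomorph E (BaseModel n)} (he : IsAdapted π.proj e)
    (i : ℕ) (A : Fin n) (w : Phase π k) : ℝ :=
  (show JetModel n (k - 1) →L[ℝ] ℝ from w.snd)
    (mfderiv 𝓘(ℝ, JetModel n (k - 1)) 𝓘(ℝ, JetModel n (k - 1)) (jetChart (k - 1) e he).symm
      (jetChart (k - 1) e he (rho2 w).proj) (jetUnit (k - 1) i A))

/-- The partial derivative `∂L/∂q_i^A` at a point of `J^k π`. -/
def partialDeriv {k : ℕ} (L : Jet π k → ℝ) {e : OpenPartialHomeomorph E (BaseModel n)}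
    (he : IsAdapted π.proj e) (i : ℕ) (A : Fin n) (y : Jet π k) : ℝ :=
  fderiv ℝ (fun z => L ((jetChart k e he).symm z)) (jetChart k e he y) (jetUnit k i A)

/-- The partial derivative `∂L̂/∂q_i^A`, where `i ≤ k`, at a point of `W`. -/
def liftPartialDeriv {k : ℕ} (hk : 1 ≤ k) (L : Jet π k → ℝ)
    {e : OpenPartialHomeomorph E (BaseModel n)} (he : IsAdapted π.proj e) (i : ℕ) (A : Fin n)
    (w : Phase π k) : ℝ :=
  partialDeriv L he i A (Jet.proj (show k ≤ 2 * k - 1 by omega) (rho1 w))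

/-- The graph `W_1 ⊆ W_o` of the Legendre-Ostrogradsky map,
`p_A^{r-1} = ∑_{i=0}^{k-r} (-1)^i d_T^i (∂L/∂q_{r+i}^A)` for `1 ≤ r ≤ k`, where `d_T^i f` at the jet
of `φ` is the `i`-th derivative of `f ∘ j^k φ`. -/
def legendreGraph {k : ℕ} (hk : 1 ≤ k) (L : Jet π k → ℝ) : Set (Phase π k) :=
  {w | w ∈ hamiltonianSubmanifold hk L ∧
    ∀ (e : OpenPartialHomeomorph E (BaseModel n)) (he : IsAdapted π.proj e), rhoE w ∈ e.source →
      ∀ r, 1 ≤ r → r ≤ k → ∀ A : Fin n, momentum he (r - 1) A w =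
        ∑ i ∈ Finset.range (k - r + 1), (-1) ^ i * iteratedDeriv i
          (fun s => partialDeriv L he (r + i) A (prolong π k (rho1 w).rep.map s)) (rhoR w)}

end Phase
end SkinnerRusk
end

/-! In natural coordinates `Ω(u, v) = v_p(u_q) - u_p(v_q)`, where `u_q` is the part of `u` tangent
to `J^{k-1}π` and `u_p` its momentum part (`omega_eq`), and `T W_o` is the kernel of `d(Ĉ - L̂)`
(`mem_tangentWo_iff`). Let `u` have the holonomic jet part `(1, q_1, …, q_k)`. Then `v_p` enters
`Ω(u, v)` only through its value on that vector, and tangency of `v` expresses this value by `dL`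
and the momenta of the base point. So `Ω(u, ·)` on `T W_o` is the pullback of a linear form `Λ` on
the coordinates of `J^k π` (`omega_eq_equationForm`). All vectors `∂/∂q_i^A`, `i ≤ k`, lift to `T
W_o`, because `∂Ĉ/∂p = 1`. Moreover `Λ(u) = Ω(u, u) = 0` is automatic and `dt(u) = 1`, so the
equation says exactly that `Λ(∂/∂q_i^A) = 0` for `0 ≤ i ≤ k` (`omega_eq_zero_iff`). For `i < k`
these are the equations for the derivatives of the momenta; for `i = k`, where there is no momentum
to differentiate, it is the constraint. Hence 2 ⇔ 3. The equivalence 1 ⇔ 3 is skew symmetry together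
with the extension of a single tangent vector of `W_o` to a vector field.

For 3 ⇒ 4, the constraint and the equations with `i ≥ 1` determine `p^{k-1}, …, p^0` recursively,
which yields the Ostrogradsky momenta (`momentum_eq_sum`, `mem_legendreGraph`). The semispray is
glued by a partition of unity (`exists_semispray`): tangency to `W_o`, holonomy, the equation at
points of `W_1` and the value `ψ'` along the curve are convex conditions on the value of the field
at each point. Local solutions are explicit (`localField`). Their top jet component `Q` is
arbitrary, since at a point of `W_1` the equation needs only the constraint; thus `L` need not be
regular. To match `ψ'`, the top component of `ψ'` is extended from the image of `ψ`, which is closed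
because `ψ` is a section. Finally 4 ⇒ 3 is evaluation at `ψ(t) ∈ W_1`. -/

noncomputable section
namespace SkinnerRusk

set_option linter.unusedSectionVars false

/-! ### Coordinates of the cotangent bundle induced by an arbitrary chart -/

section Cotangent

open Bundle

variable {V M : Type*} [NormedAddCommGroup V] [NormedSpace ℝ V] [TopologicalSpace M]
  [ChartedSpace V M] [IsManifold 𝓘(ℝ, V) ∞ M]

variable (V M) in
/-- The cotangent bundle of a manifold. -/
abbrev CotangentBundle : Type _ :=
  TotalSpace (V →L[ℝ] ℝ) (fun y : M => TangentSpace 𝓘(ℝ, V) y →L[ℝ] Trivial M ℝ y)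

/-- The fibre coordinate of a covector in a chart. -/
def cotFibre (c : OpenPartialHomeomorph M V) (a : CotangentBundle V M) : V →L[ℝ] ℝ :=
  (show V →L[ℝ] ℝ from a.snd).comp (mfderiv 𝓘(ℝ, V) 𝓘(ℝ, V) c.symm (c a.proj))

/-- The covector with given coordinates in a chart. -/
def cotMk (c : OpenPartialHomeomorph M V) (z : V) (β : V →L[ℝ] ℝ) : CotangentBundle V M :=
  ⟨c.symm z, β.comp (mfderiv 𝓘(ℝ, V) 𝓘(ℝ, V) c (c.symm z))⟩

/-- The trivialization of the hom bundle conjugates by those of its two factors. That of the trivial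
factor does nothing, and the inverse of the tangent one is the derivative of the inverse chart. This
ties the manifold structure of the bundle to `cotFibre`. -/
theorem triv_snd {y₀ : M} {a : CotangentBundle V M} (ha : a.proj ∈ (chartAt V y₀).source) :
    (trivializationAt (V →L[ℝ] ℝ)
      (fun y : M => TangentSpace 𝓘(ℝ, V) y →L[ℝ] Trivial M ℝ y) y₀ a).2 = cotFibre (chartAt V y₀) a := by
  rw [hom_trivializationAt_apply]
  have : IsManifold 𝓘(ℝ, V) 1 M := IsManifold.of_le (n := ∞) (by simp)
  have h := TangentBundle.symmL_trivializationAt (I := 𝓘(ℝ, V)) ha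
  simp only [modelWithCornersSelf_coe, range_id, mfderivWithin_univ] at h
  ext v
  simp [ContinuousLinearMap.inCoordinates, cotFibre]
  exact congrArg (fun T : V →L[ℝ] V => (show V →L[ℝ] ℝ from a.snd) (T v)) h

theorem mdifferentiableAt_chart {c : OpenPartialHomeomorph M V}
    (hc : c ∈ IsManifold.maximalAtlas 𝓘(ℝ, V) ∞ M) {y : M} (hy : y ∈ c.source) :
    MDifferentiableAt 𝓘(ℝ, V) 𝓘(ℝ, V) c y :=
  (contMDiffAt_of_mem_maximalAtlas hc hy).mdifferentiableAt (by simp)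

theorem mdifferentiableAt_chart_symm {c : OpenPartialHomeomorph M V}
    (hc : c ∈ IsManifold.maximalAtlas 𝓘(ℝ, V) ∞ M) {z : V} (hz : z ∈ c.target) :
    MDifferentiableAt 𝓘(ℝ, V) 𝓘(ℝ, V) c.symm z :=
  (contMDiffAt_symm_of_mem_maximalAtlas hc hz).mdifferentiableAt (by simp)

theorem mfderiv_chart_symm_chart {c : OpenPartialHomeomorph M V}
    (hc : c ∈ IsManifold.maximalAtlas 𝓘(ℝ, V) ∞ M) {y : M} (hy : y ∈ c.source)
    (v : TangentSpace 𝓘(ℝ, V) y) :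
    (mfderiv 𝓘(ℝ, V) 𝓘(ℝ, V) c.symm (c y) : V →L[ℝ] V)
      ((mfderiv 𝓘(ℝ, V) 𝓘(ℝ, V) c y : V →L[ℝ] V) v) = v := by
  have h := mfderiv_comp (I := 𝓘(ℝ, V)) (I' := 𝓘(ℝ, V)) (I'' := 𝓘(ℝ, V)) y
    (mdifferentiableAt_chart_symm hc (c.map_source hy)) (mdifferentiableAt_chart hc hy)
  have h' : c.symm ∘ c =ᶠ[𝓝 y] id := by
    filter_upwards [c.open_source.mem_nhds hy] with y' hy' using c.left_inv hy'
  rw [h'.mfderiv_eq, mfderiv_id] at h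
  exact (congrArg (fun T : V →L[ℝ] V => T v) h).symm

theorem mfderiv_chart_chart_symm {c : OpenPartialHomeomorph M V}
    (hc : c ∈ IsManifold.maximalAtlas 𝓘(ℝ, V) ∞ M) {z : V} (hz : z ∈ c.target) (v : V) :
    (mfderiv 𝓘(ℝ, V) 𝓘(ℝ, V) c (c.symm z) : V →L[ℝ] V)
      ((mfderiv 𝓘(ℝ, V) 𝓘(ℝ, V) c.symm z : V →L[ℝ] V) v) = v := by
  have h := mfderiv_comp (I := 𝓘(ℝ, V)) (I' := 𝓘(ℝ, V)) (I'' := 𝓘(ℝ, V)) z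
    (mdifferentiableAt_chart hc (c.map_target hz)) (mdifferentiableAt_chart_symm hc hz)
  have h' : c ∘ c.symm =ᶠ[𝓝 z] id := by
    filter_upwards [c.open_target.mem_nhds hz] with y' hy' using c.right_inv hy'
  rw [h'.mfderiv_eq, mfderiv_id] at h
  exact (congrArg (fun T : V →L[ℝ] V => T v) h).symm

/-- The derivative of a change of charts. -/
theorem fderiv_chart_comp_symm {c c' : OpenPartialHomeomorph M V}
    (hc : c ∈ IsManifold.maximalAtlas 𝓘(ℝ, V) ∞ M)
    (hc' : c' ∈ IsManifold.maximalAtlas 𝓘(ℝ, V) ∞ M) {z : V} (hz : z ∈ c.target)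
    (hz' : c.symm z ∈ c'.source) (v : V) :
    fderiv ℝ (c' ∘ c.symm) z v = (mfderiv 𝓘(ℝ, V) 𝓘(ℝ, V) c' (c.symm z) : V →L[ℝ] V)
      ((mfderiv 𝓘(ℝ, V) 𝓘(ℝ, V) c.symm z : V →L[ℝ] V) v) := by
  have h := mfderiv_comp (I := 𝓘(ℝ, V)) (I' := 𝓘(ℝ, V)) (I'' := 𝓘(ℝ, V)) z
    (mdifferentiableAt_chart hc' hz') (mdifferentiableAt_chart_symm hc hz)
  rw [mfderiv_eq_fderiv] at h
  exact congrArg (fun T : V →L[ℝ] V => T v) h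

theorem contDiffAt_chart_comp_symm {c c' : OpenPartialHomeomorph M V}
    (hc : c ∈ IsManifold.maximalAtlas 𝓘(ℝ, V) ∞ M)
    (hc' : c' ∈ IsManifold.maximalAtlas 𝓘(ℝ, V) ∞ M) {z : V} (hz : z ∈ c.target)
    (hz' : c.symm z ∈ c'.source) : ContDiffAt ℝ ∞ (c' ∘ c.symm) z :=
  ((contMDiffAt_of_mem_maximalAtlas hc' hz').comp z
    (contMDiffAt_symm_of_mem_maximalAtlas hc hz)).contDiffAt

/-- Covectors transform by the Jacobian of the change of charts. Through this an arbitrary chart of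
the maximal atlas, such as a jet chart, is compared with the preferred one. -/
theorem cotFibre_eq_comp {c c' : OpenPartialHomeomorph M V}
    (hc : c ∈ IsManifold.maximalAtlas 𝓘(ℝ, V) ∞ M)
    (hc' : c' ∈ IsManifold.maximalAtlas 𝓘(ℝ, V) ∞ M) {a : CotangentBundle V M}
    (ha : a.proj ∈ c.source) (ha' : a.proj ∈ c'.source) :
    cotFibre c a = (cotFibre c' a).comp (fderiv ℝ (c' ∘ c.symm) (c a.proj)) := by
  ext v
  have h := fderiv_chart_comp_symm hc hc' (c.map_source ha) (by rwa [c.left_inv ha]) v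
  rw [ContinuousLinearMap.comp_apply, h, c.left_inv ha]
  exact congrArg (show V →L[ℝ] ℝ from a.snd) (mfderiv_chart_symm_chart hc' ha' _).symm

theorem cotFibre_cotMk {c c' : OpenPartialHomeomorph M V}
    (hc : c ∈ IsManifold.maximalAtlas 𝓘(ℝ, V) ∞ M)
    (hc' : c' ∈ IsManifold.maximalAtlas 𝓘(ℝ, V) ∞ M) {z : V} (hz : z ∈ c.target)
    (hz' : c.symm z ∈ c'.source) (β : V →L[ℝ] ℝ) :
    cotFibre c' (cotMk c z β) = β.comp (fderiv ℝ (c ∘ c'.symm) (c' (c.symm z))) := by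
  ext v
  have h := fderiv_chart_comp_symm hc' hc (c'.map_source hz')
    (by rw [c'.left_inv hz']; exact c.map_target hz) v
  rw [ContinuousLinearMap.comp_apply, h, c'.left_inv hz']
  rfl

theorem cotFibre_cotMk_self {c : OpenPartialHomeomorph M V}
    (hc : c ∈ IsManifold.maximalAtlas 𝓘(ℝ, V) ∞ M) {z : V} (hz : z ∈ c.target)
    (β : V →L[ℝ] ℝ) : cotFibre c (cotMk c z β) = β := by
  ext v
  have := mfderiv_chart_chart_symm hc hz v
  change β ((mfderiv 𝓘(ℝ, V) 𝓘(ℝ, V) c (c.symm z) : V →L[ℝ] V)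
    ((mfderiv 𝓘(ℝ, V) 𝓘(ℝ, V) c.symm (c (c.symm z)) : V →L[ℝ] V) v)) = β v
  rw [c.right_inv hz]
  exact congrArg β this

theorem cotMk_cotFibre {c : OpenPartialHomeomorph M V}
    (hc : c ∈ IsManifold.maximalAtlas 𝓘(ℝ, V) ∞ M) {a : CotangentBundle V M}
    (ha : a.proj ∈ c.source) : cotMk c (c a.proj) (cotFibre c a) = a := by
  obtain ⟨y, α⟩ := a
  have ha : y ∈ c.source := ha
  -- The base point `c.symm (c y)` is equal to `y` only propositionally, so it is generalized before
  -- covectors over the two points are compared.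
  have key : ∀ y', y' = y → (⟨y', (cotFibre c ⟨y, α⟩).comp (mfderiv 𝓘(ℝ, V) 𝓘(ℝ, V) c y')⟩ :
      CotangentBundle V M) = ⟨y, α⟩ := by
    rintro _ rfl
    congr 1
    ext v
    exact congrArg (show V →L[ℝ] ℝ from α) (mfderiv_chart_symm_chart hc ha v)
  exact key _ (c.left_inv ha)

/-- Smoothness on the total space refers to the preferred trivialization at `a`; the fibre
coordinate in `c` differs from that one by a Jacobian depending smoothly on the base point. -/
theorem contMDiffAt_cotFibre {c : OpenPartialHomeomorph M V}
    (hc : c ∈ IsManifold.maximalAtlas 𝓘(ℝ, V) ∞ M) {a : CotangentBundle V M}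
    (ha : a.proj ∈ c.source) :
    ContMDiffAt (𝓘(ℝ, V).prod 𝓘(ℝ, V →L[ℝ] ℝ)) 𝓘(ℝ, V →L[ℝ] ℝ) ∞ (cotFibre c) a := by
  have hp : ContMDiffAt (𝓘(ℝ, V).prod 𝓘(ℝ, V →L[ℝ] ℝ)) 𝓘(ℝ, V) ∞
      (TotalSpace.proj : CotangentBundle V M → M) a := contMDiffAt_proj _
  have hc' := IsManifold.chart_mem_maximalAtlas (I := 𝓘(ℝ, V)) (n := ∞) a.proj
  have h1 := ((contMDiffAt_totalSpace (f := fun a : CotangentBundle V M => a)).1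
    (contMDiffAt_id (I := 𝓘(ℝ, V).prod 𝓘(ℝ, V →L[ℝ] ℝ)) (n := ∞) (x := a))).2
  have hf : ContDiffAt ℝ ∞ (fderiv ℝ (chartAt V a.proj ∘ c.symm)) (c a.proj) :=
    (contDiffAt_chart_comp_symm hc hc' (c.map_source ha)
      (by rw [c.left_inv ha]; exact mem_chart_source V a.proj)).fderiv_right (by simp)
  have h2 : ContMDiffAt (𝓘(ℝ, V).prod 𝓘(ℝ, V →L[ℝ] ℝ)) 𝓘(ℝ, V →L[ℝ] V) ∞
      (fun a' : CotangentBundle V M => fderiv ℝ (chartAt V a.proj ∘ c.symm) (c a'.proj)) a :=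
    hf.contMDiffAt.comp a ((contMDiffAt_of_mem_maximalAtlas hc ha).comp a hp)
  refine (h1.clm_comp h2).congr_of_eventuallyEq ?_
  filter_upwards [hp.continuousAt.preimage_mem_nhds (c.open_source.mem_nhds ha),
    hp.continuousAt.preimage_mem_nhds (chart_source_mem_nhds V a.proj)] with a' h h'
  rw [triv_snd h', cotFibre_eq_comp hc hc' h h']

theorem contMDiffAt_cotMk {c : OpenPartialHomeomorph M V}
    (hc : c ∈ IsManifold.maximalAtlas 𝓘(ℝ, V) ∞ M) {x : V × (V →L[ℝ] ℝ)}
    (hx : x.1 ∈ c.target) :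
    ContMDiffAt 𝓘(ℝ, V × (V →L[ℝ] ℝ)) (𝓘(ℝ, V).prod 𝓘(ℝ, V →L[ℝ] ℝ)) ∞
      (fun x : V × (V →L[ℝ] ℝ) => cotMk c x.1 x.2) x := by
  have hfst : ContMDiffAt 𝓘(ℝ, V × (V →L[ℝ] ℝ)) 𝓘(ℝ, V) ∞ (fun x : V × (V →L[ℝ] ℝ) => x.1) x :=
    contDiffAt_fst.contMDiffAt
  have hsnd : ContMDiffAt 𝓘(ℝ, V × (V →L[ℝ] ℝ)) 𝓘(ℝ, V →L[ℝ] ℝ) ∞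
    (fun x : V × (V →L[ℝ] ℝ) => x.2) x := contDiffAt_snd.contMDiffAt
  have hp : ContMDiffAt 𝓘(ℝ, V × (V →L[ℝ] ℝ)) 𝓘(ℝ, V) ∞
      (fun x : V × (V →L[ℝ] ℝ) => c.symm x.1) x :=
    (contMDiffAt_symm_of_mem_maximalAtlas hc hx).comp x hfst
  rw [contMDiffAt_totalSpace]
  refine ⟨hp, ?_⟩
  set y := c.symm x.1 with hy
  have hys : y ∈ (chartAt V y).source := mem_chart_source V y
  have hc' := IsManifold.chart_mem_maximalAtlas (I := 𝓘(ℝ, V)) (n := ∞) y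
  have hf : ContDiffAt ℝ ∞ (fderiv ℝ (c ∘ (chartAt V y).symm)) (chartAt V y y) :=
    (contDiffAt_chart_comp_symm hc' hc (mem_chart_target V y)
      (by rw [(chartAt V y).left_inv hys]; exact c.map_target hx)).fderiv_right (by simp)
  have h2 : ContMDiffAt 𝓘(ℝ, V × (V →L[ℝ] ℝ)) 𝓘(ℝ, V →L[ℝ] V) ∞
      (fun x' : V × (V →L[ℝ] ℝ) => fderiv ℝ (c ∘ (chartAt V y).symm) (chartAt V y (c.symm x'.1))) x :=
    hf.contMDiffAt.comp x ((contMDiffAt_of_mem_maximalAtlas hc' hys).comp x hp)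
  refine (hsnd.clm_comp h2).congr_of_eventuallyEq ?_
  filter_upwards [hp.continuousAt.preimage_mem_nhds (chart_source_mem_nhds V y),
    hfst.continuousAt.preimage_mem_nhds (c.open_target.mem_nhds hx)] with x' h h'
  have h3 : (cotMk c x'.1 x'.2).proj ∈ (chartAt V y).source := h
  exact (triv_snd h3).trans (cotFibre_cotMk hc hc' h' h _)

end Cotangent

/-! ### Natural coordinates and topology of `W` -/

section PhaseCharts

variable {n k : ℕ} {E : Type*} [TopologicalSpace E] [ChartedSpace (BaseModel n) E] {π : Fibred n E}

theorem contMDiff_rho1 : ContMDiff (phaseModel n k) 𝓘(ℝ, JetModel n (2 * k - 1)) ∞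
    (rho1 : Phase π k → _) := Bundle.contMDiff_proj _

theorem contMDiff_rho2 : ContMDiff (phaseModel n k) (cotangentModel n (k - 1)) ∞
    (rho2 : Phase π k → _) := by
  intro w
  rw [Bundle.contMDiffAt_totalSpace]
  refine ⟨(jetProj π (show k - 1 ≤ 2 * k - 1 by omega)).contMDiff.comp contMDiff_rho1 w, ?_⟩
  exact ((Bundle.contMDiffAt_totalSpace (f := fun w : Phase π k => w)).1
    (contMDiffAt_id (I := phaseModel n k) (n := ∞) (x := w))).2

/-- The fibre coordinate of a point of a pullback bundle is that of its image under `rho2`, so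
smoothness into `W` can be tested on the two factors. -/
theorem contMDiffAt_phase {V H N : Type*} [NormedAddCommGroup V] [NormedSpace ℝ V]
    [TopologicalSpace H] {I : ModelWithCorners ℝ V H} [TopologicalSpace N] [ChartedSpace H N]
    {f : N → Phase π k} {x : N}
    (h1 : ContMDiffAt I 𝓘(ℝ, JetModel n (2 * k - 1)) ∞ (fun x => rho1 (f x)) x)
    (h2 : ContMDiffAt I (cotangentModel n (k - 1)) ∞ (fun x => rho2 (f x)) x) :
    ContMDiffAt I (phaseModel n k) ∞ f x := by
  rw [Bundle.contMDiffAt_totalSpace]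
  exact ⟨h1, (Bundle.contMDiffAt_totalSpace.1 h2).2⟩

/-- The coordinates `(t, q_0^A, …, q_{2k-1}^A; p, p_A^i)` of `W` form a vector of this space. -/
abbrev PhaseCoord (n k : ℕ) : Type :=
  JetModel n (2 * k - 1) × (JetModel n (k - 1) →L[ℝ] ℝ)

/-- Forgetting the coordinates `q_i^A` with `i > r`. -/
def truncate {n : ℕ} {r s : ℕ} (h : r ≤ s) : JetModel n s →L[ℝ] JetModel n r :=
  (ContinuousLinearMap.fst ℝ _ _).prod ((ContinuousLinearMap.pi fun i : Fin (r + 1) =>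
    ContinuousLinearMap.proj (⟨i, by omega⟩ : Fin (s + 1))).comp (ContinuousLinearMap.snd ℝ _ _))

@[simp] theorem truncate_fst {r s : ℕ} (h : r ≤ s) (z : JetModel n s) : (truncate h z).1 = z.1 := rfl

@[simp] theorem truncate_snd {r s : ℕ} (h : r ≤ s) (z : JetModel n s) (i : Fin (r + 1)) :
    (truncate h z).2 i = z.2 ⟨i, by omega⟩ := rfl

theorem jetChart_proj {r s : ℕ} (h : r ≤ s) {e : OpenPartialHomeomorph E (BaseModel n)}
    (he : IsAdapted π.proj e) {y : Jet π s} (hy : y.point ∈ e.source) :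
    jetChart r e he (Jet.proj h y) = truncate h (jetChart s e he y) := by
  obtain ⟨φ, rfl⟩ : ∃ φ : LocalSection π, φ.jet s = y := ⟨_, y.jet_rep⟩
  exact (jetCoord_jet (r := r) he hy).trans (congrArg (truncate h) (jetCoord_jet (r := s) he hy)).symm

theorem point_proj {r s : ℕ} (h : r ≤ s) (y : Jet π s) : (Jet.proj h y).point = y.point := by
  obtain ⟨φ, rfl⟩ : ∃ φ : LocalSection π, φ.jet s = y := ⟨_, y.jet_rep⟩
  rfl

theorem proj_jetChart_symm {r s : ℕ} (h : r ≤ s) {e : OpenPartialHomeomorph E (BaseModel n)}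
    (he : IsAdapted π.proj e) {z : JetModel n s} (hz : z ∈ (jetChart s e he).target) :
    Jet.proj h ((jetChart s e he).symm z) = (jetChart r e he).symm (truncate h z) := by
  have hy : (jetChart s e he).symm z ∈ (jetChart s e he).source := (jetChart s e he).map_target hz
  have h1 := jetChart_proj h he (y := (jetChart s e he).symm z) hy
  rw [(jetChart s e he).right_inv hz] at h1
  rw [← h1, (jetChart r e he).left_inv]
  change (Jet.proj h _).point ∈ e.source
  rw [point_proj]
  exact hy

variable (π k) in
/-- The chart of `W` induced by an adapted chart of `E`: the point with given coordinates. -/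
def phaseMk (e : OpenPartialHomeomorph E (BaseModel n)) (he : IsAdapted π.proj e)
    (x : PhaseCoord n k) : Phase π k :=
  ⟨(jetChart (2 * k - 1) e he).symm x.1,
    x.2.comp (mfderiv 𝓘(ℝ, JetModel n (k - 1)) 𝓘(ℝ, JetModel n (k - 1)) (jetChart (k - 1) e he)
      (Jet.proj (show k - 1 ≤ 2 * k - 1 by omega) ((jetChart (2 * k - 1) e he).symm x.1)))⟩

/-- The natural coordinates of `W` induced by an adapted chart of `E`. -/
def phaseCoord (e : OpenPartialHomeomorph E (BaseModel n)) (he : IsAdapted π.proj e)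
    (w : Phase π k) : PhaseCoord n k :=
  (jetChart (2 * k - 1) e he (rho1 w), cotFibre (jetChart (k - 1) e he) (rho2 w))

variable {e : OpenPartialHomeomorph E (BaseModel n)} (he : IsAdapted π.proj e)

theorem isOpen_rhoE_source (he : IsAdapted π.proj e) : IsOpen {w : Phase π k | rhoE w ∈ e.source} :=
  (jetChart (2 * k - 1) e he).open_source.preimage (contMDiff_rho1 (n := n)).continuous

theorem isOpen_phaseTarget :
    IsOpen {x : PhaseCoord n k | x.1 ∈ (jetChart (π := π) (2 * k - 1) e he).target} :=
  (jetChart (2 * k - 1) e he).open_target.preimage continuous_fst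

theorem rho2_proj_mem {w : Phase π k} (hw : rhoE w ∈ e.source) :
    (rho2 w).proj ∈ (jetChart (k - 1) e he).source := by
  change (Jet.proj (show k - 1 ≤ 2 * k - 1 by omega) (rho1 w)).point ∈ e.source
  rwa [point_proj]

theorem contMDiffAt_phaseCoord {w : Phase π k} (hw : rhoE w ∈ e.source) :
    ContMDiffAt (phaseModel n k) 𝓘(ℝ, PhaseCoord n k) ∞ (phaseCoord e he) w := by
  refine ContMDiffAt.prodMk_space ?_ ?_
  · exact (contMDiffAt_of_mem_maximalAtlas (jetChart_mem_maximalAtlas (2 * k - 1) he) hw).comp w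
      (contMDiff_rho1 w)
  · exact (contMDiffAt_cotFibre (jetChart_mem_maximalAtlas (k - 1) he)
      (rho2_proj_mem he hw)).comp w (contMDiff_rho2 w)

/-- The target of a jet chart restricts only `(t, q_0)`, which truncation keeps. -/
theorem truncate_mem_target {r s : ℕ} (h : r ≤ s) {z : JetModel n s}
    (hz : z ∈ (jetChart (π := π) s e he).target) : truncate h z ∈ (jetChart (π := π) r e he).target :=
  hz

theorem rho2_phaseMk {x : PhaseCoord n k} (hx : x.1 ∈ (jetChart (π := π) (2 * k - 1) e he).target) :
    rho2 (phaseMk k π e he x) = cotMk (jetChart (k - 1) e he) (truncate (by omega) x.1) x.2 := by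
  have h := proj_jetChart_symm (show k - 1 ≤ 2 * k - 1 by omega) he hx
  unfold cotMk
  rw [← h]
  rfl

theorem rhoE_phaseMk {x : PhaseCoord n k} (hx : x.1 ∈ (jetChart (π := π) (2 * k - 1) e he).target) :
    rhoE (phaseMk k π e he x) ∈ e.source :=
  (jetChart (2 * k - 1) e he).map_target hx

theorem phaseCoord_mem_target {w : Phase π k} (hw : rhoE w ∈ e.source) :
    (phaseCoord e he w).1 ∈ (jetChart (π := π) (2 * k - 1) e he).target :=
  (jetChart (2 * k - 1) e he).map_source hw

theorem phaseCoord_phaseMk {x : PhaseCoord n k}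
    (hx : x.1 ∈ (jetChart (π := π) (2 * k - 1) e he).target) :
    phaseCoord e he (phaseMk k π e he x) = x := by
  refine Prod.ext ((jetChart (2 * k - 1) e he).right_inv hx) ?_
  change cotFibre (jetChart (k - 1) e he) (rho2 (phaseMk k π e he x)) = x.2
  rw [rho2_phaseMk he hx]
  exact cotFibre_cotMk_self (jetChart_mem_maximalAtlas (k - 1) he) (truncate_mem_target he _ hx) _

theorem phase_ext {w w' : Phase π k} (h1 : rho1 w = rho1 w') (h2 : rho2 w = rho2 w') : w = w' := by
  obtain ⟨y, α⟩ := w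
  obtain ⟨y', α'⟩ := w'
  obtain rfl : y = y' := h1
  congr 1
  exact eq_of_heq (Bundle.TotalSpace.mk.inj h2).2

theorem phaseMk_phaseCoord (he : IsAdapted π.proj e) {w : Phase π k} (hw : rhoE w ∈ e.source) :
    phaseMk k π e he (phaseCoord e he w) = w := by
  refine phase_ext ((jetChart (2 * k - 1) e he).left_inv hw) ?_
  rw [rho2_phaseMk he (phaseCoord_mem_target he hw)]
  have h := jetChart_proj (show k - 1 ≤ 2 * k - 1 by omega) he (y := rho1 w) hw
  have h2 := cotMk_cotFibre (jetChart_mem_maximalAtlas (k - 1) he) (rho2_proj_mem he hw)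
  refine Eq.trans ?_ h2
  exact congrArg (fun z => cotMk (jetChart (k - 1) e he) z _) h.symm

theorem contMDiffAt_phaseMk {x : PhaseCoord n k}
    (hx : x.1 ∈ (jetChart (π := π) (2 * k - 1) e he).target) :
    ContMDiffAt 𝓘(ℝ, PhaseCoord n k) (phaseModel n k) ∞ (phaseMk k π e he) x := by
  refine contMDiffAt_phase ?_ ?_
  · exact (contMDiffAt_symm_of_mem_maximalAtlas (jetChart_mem_maximalAtlas (2 * k - 1) he) hx).comp x
      contDiffAt_fst.contMDiffAt
  · let c : PhaseCoord n k → JetModel n (k - 1) × (JetModel n (k - 1) →L[ℝ] ℝ) :=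
      fun x => (truncate (by omega) x.1, x.2)
    have hc : ContDiff ℝ ∞ c := ((truncate _).contDiff.comp contDiff_fst).prodMk contDiff_snd
    have h := (contMDiffAt_cotMk (jetChart_mem_maximalAtlas (π := π) (k - 1) he) (x := c x)
      (truncate_mem_target he _ hx)).comp x hc.contMDiff.contMDiffAt
    refine h.congr_of_eventuallyEq ?_
    filter_upwards [(isOpen_phaseTarget he).mem_nhds hx] with x' hx' using rho2_phaseMk he hx'

/-- The natural coordinates of `W` as a chart. -/
def phaseChart : OpenPartialHomeomorph (Phase π k) (PhaseCoord n k) where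
  toFun := phaseCoord e he
  invFun := phaseMk k π e he
  source := {w | rhoE w ∈ e.source}
  target := {x | x.1 ∈ (jetChart (π := π) (2 * k - 1) e he).target}
  map_source' _ hw := phaseCoord_mem_target he hw
  map_target' _ hx := rhoE_phaseMk he hx
  left_inv' _ hw := phaseMk_phaseCoord he hw
  right_inv' _ hx := phaseCoord_phaseMk he hx
  open_source := isOpen_rhoE_source he
  open_target := isOpen_phaseTarget he
  continuousOn_toFun _ hw := (contMDiffAt_phaseCoord he hw).continuousAt.continuousWithinAt
  continuousOn_invFun _ hx := (contMDiffAt_phaseMk he hx).continuousAt.continuousWithinAt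

theorem rhoE_eq {w : Phase π k} (hw : rhoE w ∈ e.source) :
    rhoE w = e.symm ((phaseCoord e he w).1.1, (phaseCoord e he w).1.2 0) := by
  change (rho1 w).point = _
  have hw' : (rho1 w).point ∈ e.source := hw
  change _ = e.symm ((jetCoord (2 * k - 1) e (rho1 w)).1, (jetCoord (2 * k - 1) e (rho1 w)).2 0)
  obtain ⟨φ, hφ⟩ : ∃ φ : LocalSection π, φ.jet _ = rho1 w := ⟨_, (rho1 w).jet_rep⟩
  rw [← hφ] at hw' ⊢
  have hs : φ.map φ.time ∈ e.source := hw'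
  rw [jetCoord_jet he hs]
  simp only [Fin.coe_ofNat_eq_mod, Nat.zero_mod, φ.coord_zero]
  have h0 : ((φ.time, (e (φ.map φ.time)).2) : BaseModel n) = e (φ.map φ.time) :=
    Prod.ext ((he.2 _ hs).trans φ.isSection.self_of_nhds.2).symm rfl
  rw [h0, e.left_inv hs]
  rfl

theorem contMDiff_rhoE :
    ContMDiff (phaseModel n k) 𝓘(ℝ, BaseModel n) ∞ (rhoE : Phase π k → E) := by
  intro w
  obtain ⟨e, he, hw⟩ := π.exists_adapted (rhoE w)
  have h1 : ContMDiffAt 𝓘(ℝ, PhaseCoord n k) 𝓘(ℝ, BaseModel n) ∞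
      (fun x : PhaseCoord n k => ((x.1.1, x.1.2 0) : BaseModel n)) (phaseCoord e he w) :=
    ContDiffAt.contMDiffAt (by fun_prop)
  have h2 := (contMDiffAt_symm_of_mem_maximalAtlas he.1 (phaseCoord_mem_target he hw)).comp w
    (h1.comp w (contMDiffAt_phaseCoord he hw))
  refine h2.congr_of_eventuallyEq ?_
  filter_upwards [(isOpen_rhoE_source he).mem_nhds hw] with w' hw' using rhoE_eq he hw'

theorem continuous_rhoE : Continuous (rhoE : Phase π k → E) := (contMDiff_rhoE (n := n)).continuous

theorem proj_rhoE (w : Phase π k) : π.proj (rhoE w) = rhoR w := by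
  obtain ⟨φ, hφ⟩ : ∃ φ : LocalSection π, φ.jet _ = rho1 w := ⟨_, (rho1 w).jet_rep⟩
  unfold rhoE rhoR
  rw [← hφ]
  exact φ.isSection.self_of_nhds.2

/-- Distinct points over one point of `E` lie in a common natural chart; points over different
points of `E` are separated in `E`. -/
instance [T2Space E] : T2Space (Phase π k) := by
  refine ⟨fun w w' hne => ?_⟩
  by_cases h : rhoE w = rhoE w'
  · obtain ⟨e, he, hw⟩ := π.exists_adapted (rhoE w)
    have hw' : rhoE w' ∈ e.source := h ▸ hw
    have hn : phaseChart he w ≠ phaseChart he w' := fun hc =>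
      hne ((phaseChart (k := k) he).injOn hw hw' hc)
    obtain ⟨U, U', hU, hU', hm, hm', hd⟩ := t2_separation hn
    refine ⟨_, _, (phaseChart he).isOpen_inter_preimage hU, (phaseChart he).isOpen_inter_preimage hU',
      ⟨hw, hm⟩, ⟨hw', hm'⟩, ?_⟩
    exact (hd.preimage _).mono inter_subset_right inter_subset_right
  · obtain ⟨U, U', hU, hU', hm, hm', hd⟩ := t2_separation h
    exact ⟨_, _, hU.preimage continuous_rhoE, hU'.preimage continuous_rhoE, hm, hm', hd.preimage _⟩

/-- Countably many adapted charts cover `E`, and the natural charts over them cover `W`. With the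
Hausdorff property and finite dimension this provides partitions of unity on `W`. -/
instance [SecondCountableTopology E] : SecondCountableTopology (Phase π k) := by
  choose e he hx using π.exists_adapted
  obtain ⟨s, hs, hU⟩ := TopologicalSpace.isOpen_iUnion_countable (fun x : E => (e x).source)
    (fun x => (e x).open_source)
  have hcover : ⋃ x : s, {w : Phase π k | rhoE w ∈ (e x).source} = univ := by
    refine eq_univ_of_forall fun w => ?_
    have : rhoE w ∈ ⋃ x ∈ s, (e x).source := hU ▸ mem_iUnion.2 ⟨rhoE w, hx _⟩
    obtain ⟨x, hxs, hx⟩ := mem_iUnion₂.1 this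
    exact mem_iUnion.2 ⟨⟨x, hxs⟩, hx⟩
  have : Countable s := hs.to_subtype
  have (x : s) : SecondCountableTopology {w : Phase π k | rhoE w ∈ (e x).source} :=
    (phaseChart (k := k) (he x)).secondCountableTopology_source
  exact TopologicalSpace.secondCountableTopology_of_countable_cover
    (fun x : s => isOpen_rhoE_source (he x)) hcover

instance [SecondCountableTopology E] : SigmaCompactSpace (Phase π k) := by
  have : LocallyCompactSpace (Phase π k) := Manifold.locallyCompact_of_finiteDimensional (phaseModel n k)
  infer_instance

instance : IsManifold (phaseModel n k) ∞ (Phase π k) := inferInstance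

end PhaseCharts

/-! ### Exterior derivative of `β ∘ dτ` -/

/-- In the exterior derivative of the pulled back `1`-form `g ∘ Df`, the second derivatives of `f`
cancel. -/
theorem fderiv_comp_fderiv_antisymm {X Y : Type*} [NormedAddCommGroup X] [NormedSpace ℝ X]
    [NormedAddCommGroup Y] [NormedSpace ℝ Y] {f : X → Y} {g : X → Y →L[ℝ] ℝ} {x : X}
    (hf : ContDiffAt ℝ ∞ f x) (hg : DifferentiableAt ℝ g x) (u v : X) :
    fderiv ℝ (fun z => (g z).comp (fderiv ℝ f z)) x u v -
      fderiv ℝ (fun z => (g z).comp (fderiv ℝ f z)) x v u =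
    fderiv ℝ g x u (fderiv ℝ f x v) - fderiv ℝ g x v (fderiv ℝ f x u) := by
  have hf' : DifferentiableAt ℝ (fderiv ℝ f) x :=
    (hf.fderiv_right (m := ∞) (by simp)).differentiableAt (by simp)
  have hsymm : IsSymmSndFDerivAt ℝ f x := hf.isSymmSndFDerivAt (by
    rw [minSmoothness_of_isRCLikeNormedField]; exact ENat.LEInfty.out)
  rw [(hg.hasFDerivAt.clm_comp hf'.hasFDerivAt).fderiv]
  have hs := hsymm u v
  simp [hs]

/-- The exterior derivative of a `1`-form which is `β ∘ dτ` for vector valued functions `τ`, `β`. -/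
theorem extDerivOneForm_eq {V H M Y : Type*} [NormedAddCommGroup V] [NormedSpace ℝ V]
    [TopologicalSpace H] {I : ModelWithCorners ℝ V H} [I.Boundaryless] [TopologicalSpace M]
    [ChartedSpace H M] [IsManifold I ∞ M] [NormedAddCommGroup Y] [NormedSpace ℝ Y]
    {θ : ∀ x : M, TangentSpace I x →L[ℝ] ℝ} {τ : M → Y} {β : M → Y →L[ℝ] ℝ} {x : M}
    (hτ : ∀ᶠ y in 𝓝 x, ContMDiffAt I 𝓘(ℝ, Y) ∞ τ y) (hβ : ContMDiffAt I 𝓘(ℝ, Y →L[ℝ] ℝ) ∞ β x)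
    (hθ : ∀ᶠ y in 𝓝 x, ∀ u : TangentSpace I y, θ y u = β y (mfderiv I 𝓘(ℝ, Y) τ y u))
    (u v : TangentSpace I x) :
    extDerivOneForm I θ x u v =
      (show Y →L[ℝ] ℝ from mfderiv I 𝓘(ℝ, Y →L[ℝ] ℝ) β x u) (mfderiv I 𝓘(ℝ, Y) τ x v) -
      (show Y →L[ℝ] ℝ from mfderiv I 𝓘(ℝ, Y →L[ℝ] ℝ) β x v) (mfderiv I 𝓘(ℝ, Y) τ x u) := by
  have hsymm : ContMDiffAt 𝓘(ℝ, V) I ∞ (extChartAt I x).symm (extChartAt I x x) :=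
    (contMDiffOn_extChartAt_symm (n := ∞) x).contMDiffAt (extChartAt_target_mem_nhds x)
  have hca : (extChartAt I x).symm (extChartAt I x x) = x := extChartAt_to_inv x
  have hτs : ContDiffAt ℝ ∞ (τ ∘ (extChartAt I x).symm) (extChartAt I x x) := by
    refine ContMDiffAt.contDiffAt (ContMDiffAt.comp (extChartAt I x x) ?_ hsymm)
    rw [hca]; exact hτ.self_of_nhds
  have hβs : ContDiffAt ℝ ∞ (β ∘ (extChartAt I x).symm) (extChartAt I x x) := by
    refine ContMDiffAt.contDiffAt (ContMDiffAt.comp (extChartAt I x x) ?_ hsymm)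
    rw [hca]; exact hβ
  -- The expression `β ∘ Dτ` of the form is needed on a whole neighbourhood, since it is about to be
  -- differentiated.
  have hθ' : (fun z => (θ ((extChartAt I x).symm z)).comp
        (mfderiv 𝓘(ℝ, V) I (extChartAt I x).symm z) : V → V →L[ℝ] ℝ) =ᶠ[𝓝 (extChartAt I x x)]
      fun z => ((β ∘ (extChartAt I x).symm) z).comp (fderiv ℝ (τ ∘ (extChartAt I x).symm) z) := by
    have h1 : ∀ᶠ z in 𝓝 (extChartAt I x x),
        ContMDiffAt I 𝓘(ℝ, Y) ∞ τ ((extChartAt I x).symm z) ∧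
        ∀ u : TangentSpace I ((extChartAt I x).symm z), θ ((extChartAt I x).symm z) u =
          β ((extChartAt I x).symm z) (mfderiv I 𝓘(ℝ, Y) τ ((extChartAt I x).symm z) u) := by
      refine hsymm.continuousAt.eventually (p := fun y => ContMDiffAt I 𝓘(ℝ, Y) ∞ τ y ∧
        ∀ u : TangentSpace I y, θ y u = β y (mfderiv I 𝓘(ℝ, Y) τ y u)) ?_
      rw [hca]
      exact hτ.and hθ
    filter_upwards [h1, extChartAt_target_mem_nhds (I := I) x] with z hz hz'
    have hsz : MDifferentiableAt 𝓘(ℝ, V) I (extChartAt I x).symm z :=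
      ((contMDiffOn_extChartAt_symm (n := ∞) x).contMDiffAt
        ((isOpen_extChartAt_target x).mem_nhds hz')).mdifferentiableAt (by simp)
    have h2 := mfderiv_comp z (hz.1.mdifferentiableAt (by simp)) hsz
    rw [mfderiv_eq_fderiv] at h2
    refine ContinuousLinearMap.ext fun v => ?_
    exact (hz.2 (mfderiv 𝓘(ℝ, V) I (extChartAt I x).symm z v)).trans
      (congrArg (fun T : V →L[ℝ] Y => β ((extChartAt I x).symm z) (T v)) h2.symm)
  have hchain : ∀ {Y : Type _} [NormedAddCommGroup Y] [NormedSpace ℝ Y] (f : M → Y)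
      (_ : ContDiffAt ℝ ∞ (f ∘ (extChartAt I x).symm) (extChartAt I x x)) (u : TangentSpace I x),
      fderiv ℝ (f ∘ (extChartAt I x).symm) (extChartAt I x x)
        (mfderiv I 𝓘(ℝ, V) (extChartAt I x) x u) = mfderiv I 𝓘(ℝ, Y) f x u := by
    intro Y _ _ f hf u
    have h1 : MDifferentiableAt 𝓘(ℝ, V) 𝓘(ℝ, Y)
      (f ∘ (extChartAt I x).symm) (extChartAt I x x) :=
        (hf.differentiableAt (by simp)).mdifferentiableAt
    have h2 : MDifferentiableAt I 𝓘(ℝ, V) (extChartAt I x) x :=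
      mdifferentiableAt_extChartAt (mem_chart_source _ x)
    have h3 := mfderiv_comp x h1 h2
    have h4 : (f ∘ (extChartAt I x).symm) ∘ extChartAt I x =ᶠ[𝓝 x] f := by
      filter_upwards [extChartAt_source_mem_nhds (I := I) x] with a' ha'
      simp only [Function.comp, (extChartAt I x).left_inv ha']
    rw [h4.mfderiv_eq, mfderiv_eq_fderiv] at h3
    exact (congrArg (fun T => T u) h3).symm
  have hmain := fderiv_comp_fderiv_antisymm hτs (hβs.differentiableAt (by simp))
    (mfderiv I 𝓘(ℝ, V) (extChartAt I x) x u) (mfderiv I 𝓘(ℝ, V) (extChartAt I x) x v)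
  rw [← hθ'.fderiv_eq, hchain τ hτs, hchain τ hτs] at hmain
  refine hmain.trans (congrArg₂ (fun a b => a - b) ?_ ?_)
  · exact congrArg (fun T : Y →L[ℝ] ℝ => T (mfderiv I 𝓘(ℝ, Y) τ x v)) (hchain β hβs u)
  · exact congrArg (fun T : Y →L[ℝ] ℝ => T (mfderiv I 𝓘(ℝ, Y) τ x u)) (hchain β hβs v)

/-! ### The form `Ω` in natural coordinates -/

section PhaseForms

variable {n k : ℕ} {E : Type*} [TopologicalSpace E] [ChartedSpace (BaseModel n) E] {π : Fibred n E}
variable {e : OpenPartialHomeomorph E (BaseModel n)} (he : IsAdapted π.proj e)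

theorem contMDiffAt_jetChart_proj {r : ℕ} {a : Cotangent π r} (ha : a.proj ∈ (jetChart r e he).source) :
    ContMDiffAt (cotangentModel n r) 𝓘(ℝ, JetModel n r) ∞
      (fun a : Cotangent π r => jetChart r e he a.proj) a :=
  (contMDiffAt_of_mem_maximalAtlas (jetChart_mem_maximalAtlas r he) ha).comp a
    (Bundle.contMDiffAt_proj _)

/-- Inserting the identity `T c⁻¹ ∘ T c` between the covector and the projected vector gives `Θ = p
· dq`, the shape required by `extDerivOneForm_eq`. -/
theorem tautologicalForm_eq {r : ℕ} {a : Cotangent π r} (ha : a.proj ∈ (jetChart r e he).source)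
    (u : TangentSpace (cotangentModel n r) a) :
    tautologicalForm r a u = cotFibre (jetChart r e he) a
      (mfderiv (cotangentModel n r) 𝓘(ℝ, JetModel n r)
        (fun a : Cotangent π r => jetChart r e he a.proj) a u) := by
  have hc := jetChart_mem_maximalAtlas (π := π) r he
  have hp : MDifferentiableAt (cotangentModel n r) 𝓘(ℝ, JetModel n r)
      (Bundle.TotalSpace.proj : Cotangent π r → Jet π r) a :=
    (Bundle.contMDiffAt_proj _ (n := ∞)).mdifferentiableAt (by simp)
  have h := mfderiv_comp a (mdifferentiableAt_chart hc ha) hp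
  have h' : mfderiv (cotangentModel n r) 𝓘(ℝ, JetModel n r)
        (fun a : Cotangent π r => jetChart r e he a.proj) a u =
      (mfderiv 𝓘(ℝ, JetModel n r) 𝓘(ℝ, JetModel n r) (jetChart r e he) a.proj :
        JetModel n r →L[ℝ] JetModel n r) (mfderiv (cotangentModel n r) 𝓘(ℝ, JetModel n r)
          (Bundle.TotalSpace.proj : Cotangent π r → Jet π r) a u) :=
    congrArg (fun T => T u) h
  rw [h']
  exact congrArg (show JetModel n r →L[ℝ] ℝ from a.snd)
    (mfderiv_chart_symm_chart hc ha _).symm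

/-- The canonical form in natural coordinates. -/
theorem canonicalForm_eq {r : ℕ} {a : Cotangent π r} (ha : a.proj ∈ (jetChart r e he).source)
    (u v : TangentSpace (cotangentModel n r) a) :
    canonicalForm r a u v =
      -((show JetModel n r →L[ℝ] ℝ from mfderiv (cotangentModel n r) 𝓘(ℝ, JetModel n r →L[ℝ] ℝ)
            (cotFibre (jetChart r e he)) a u)
          (mfderiv (cotangentModel n r) 𝓘(ℝ, JetModel n r)
            (fun a : Cotangent π r => jetChart r e he a.proj) a v) -
        (show JetModel n r →L[ℝ] ℝ from mfderiv (cotangentModel n r) 𝓘(ℝ, JetModel n r →L[ℝ] ℝ)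
            (cotFibre (jetChart r e he)) a v)
          (mfderiv (cotangentModel n r) 𝓘(ℝ, JetModel n r)
            (fun a : Cotangent π r => jetChart r e he a.proj) a u)) := by
  have hopen : IsOpen {a : Cotangent π r | a.proj ∈ (jetChart r e he).source} :=
    (jetChart r e he).open_source.preimage (FiberBundle.continuous_proj _ _)
  refine congrArg Neg.neg (extDerivOneForm_eq (θ := tautologicalForm r)
    (τ := fun a : Cotangent π r => jetChart r e he a.proj) (β := cotFibre (jetChart r e he))
    ?_ ?_ ?_ u v)
  · filter_upwards [hopen.mem_nhds ha] with a' ha' using contMDiffAt_jetChart_proj he ha'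
  · exact contMDiffAt_cotFibre (jetChart_mem_maximalAtlas r he) ha
  · filter_upwards [hopen.mem_nhds ha] with a' ha' u using tautologicalForm_eq he ha' u

/-- The coordinates of a tangent vector of `W`. -/
def vecCoord (w : Phase π k) (u : TangentSpace (phaseModel n k) w) : PhaseCoord n k :=
  mfderiv (phaseModel n k) 𝓘(ℝ, PhaseCoord n k) (phaseCoord e he) w u

variable {w : Phase π k} (hw : rhoE w ∈ e.source)

/-- The device by which functions on `W` are differentiated: an expression in natural coordinates
near `w` suffices. -/
theorem mfderiv_comp_phaseCoord {Y : Type*} [NormedAddCommGroup Y] [NormedSpace ℝ Y]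
    (hw : rhoE w ∈ e.source)
    {f : Phase π k → Y} {g : PhaseCoord n k → Y} (hg : DifferentiableAt ℝ g (phaseCoord e he w))
    (hfg : f =ᶠ[𝓝 w] g ∘ phaseCoord e he) (u : TangentSpace (phaseModel n k) w) :
    mfderiv (phaseModel n k) 𝓘(ℝ, Y) f w u =
      fderiv ℝ g (phaseCoord e he w) (vecCoord he w u) := by
  rw [hfg.mfderiv_eq, mfderiv_comp w hg.mdifferentiableAt
    ((contMDiffAt_phaseCoord he hw).mdifferentiableAt (by simp)), mfderiv_eq_fderiv]
  rfl

/-- The form `Ω` in natural coordinates. -/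
theorem omega_eq (hk : 1 ≤ k) (hw : rhoE w ∈ e.source) (u v : TangentSpace (phaseModel n k) w) :
    omega w u v =
      (vecCoord he w v).2 (truncate (show k - 1 ≤ 2 * k - 1 by omega) (vecCoord he w u).1) -
      (vecCoord he w u).2 (truncate (show k - 1 ≤ 2 * k - 1 by omega) (vecCoord he w v).1) := by
  have h2 : MDifferentiableAt (phaseModel n k) (cotangentModel n (k - 1)) (rho2 (π := π)) w :=
    (contMDiff_rho2 w).mdifferentiableAt (by simp)
  have ha := rho2_proj_mem (k := k) he hw
  have h3 := (contMDiffAt_jetChart_proj he ha).mdifferentiableAt (by simp)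
  have h4 := (contMDiffAt_cotFibre (jetChart_mem_maximalAtlas (k - 1) he) ha).mdifferentiableAt
    (by simp)
  have hq : ∀ u : TangentSpace (phaseModel n k) w,
      mfderiv (cotangentModel n (k - 1)) 𝓘(ℝ, JetModel n (k - 1))
        (fun a : Cotangent π (k - 1) => jetChart (k - 1) e he a.proj) (rho2 w)
        (mfderiv (phaseModel n k) (cotangentModel n (k - 1)) (rho2 (π := π)) w u) =
      truncate (show k - 1 ≤ 2 * k - 1 by omega) (vecCoord he w u).1 := by
    intro u
    have h5 := congrArg (fun T => T u) (mfderiv_comp w h3 h2)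
    refine h5.symm.trans ?_
    let g : PhaseCoord n k →L[ℝ] JetModel n (k - 1) :=
      (truncate (show k - 1 ≤ 2 * k - 1 by omega)).comp (ContinuousLinearMap.fst ℝ _ _)
    have h6 := mfderiv_comp_phaseCoord (w := w) he hw (g := g) g.differentiableAt
      (f := (fun a : Cotangent π (k - 1) => jetChart (k - 1) e he a.proj) ∘ rho2) (by
        filter_upwards [(isOpen_rhoE_source he).mem_nhds hw] with w' hw'
        exact jetChart_proj (show k - 1 ≤ 2 * k - 1 by omega) he hw') u
    rw [g.fderiv] at h6
    exact h6
  have hp : ∀ u : TangentSpace (phaseModel n k) w,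
      mfderiv (cotangentModel n (k - 1)) 𝓘(ℝ, JetModel n (k - 1) →L[ℝ] ℝ)
        (cotFibre (jetChart (k - 1) e he)) (rho2 w)
        (mfderiv (phaseModel n k) (cotangentModel n (k - 1)) (rho2 (π := π)) w u) =
      (vecCoord he w u).2 := by
    intro u
    have h5 := congrArg (fun T => T u) (mfderiv_comp w h4 h2)
    refine h5.symm.trans ?_
    let g : PhaseCoord n k →L[ℝ] (JetModel n (k - 1) →L[ℝ] ℝ) := ContinuousLinearMap.snd ℝ _ _
    have h6 := mfderiv_comp_phaseCoord (w := w) he hw (g := g) g.differentiableAt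
      (f := cotFibre (jetChart (k - 1) e he) ∘ rho2) Filter.EventuallyEq.rfl u
    rw [g.fderiv] at h6
    exact h6
  have happ : ∀ {T T' : JetModel n (k - 1) →L[ℝ] ℝ} {x x' : JetModel n (k - 1)}, T = T' → x = x' →
    T x = T' x' := fun h h' => by rw [h, h']
  refine (canonicalForm_eq he ha _ _).trans ((neg_sub _ _).trans ?_)
  exact congrArg₂ (fun a b => a - b) (happ (hp v) (hq u)) (happ (hp u) (hq v))

end PhaseForms

theorem contDiffAt_iteratedDeriv {X : Type*} [NormedAddCommGroup X] [NormedSpace ℝ X] {f : ℝ → X}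
    {t : ℝ} (hf : ContDiffAt ℝ ∞ f t) (i : ℕ) : ContDiffAt ℝ ∞ (iteratedDeriv i f) t := by
  induction i with
  | zero => simpa using hf
  | succ i ih =>
    rw [iteratedDeriv_succ]
    have h : ContDiffAt ℝ ∞ (fderiv ℝ (iteratedDeriv i f)) t := ih.fderiv_right (by simp)
    exact h.clm_apply contDiffAt_const

/-! ### The coupling function and the tangent spaces of `W_o` -/

section Coupling

variable {n k : ℕ} {E : Type*} [TopologicalSpace E] [ChartedSpace (BaseModel n) E] {π : Fibred n E}
variable {e : OpenPartialHomeomorph E (BaseModel n)} (he : IsAdapted π.proj e)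

/-- The tangent vector of `W` at `w` with given coordinates. -/
def vecMk (w : Phase π k) (x : PhaseCoord n k) : TangentSpace (phaseModel n k) w :=
  (mfderiv 𝓘(ℝ, PhaseCoord n k) (phaseModel n k) (phaseMk k π e he) (phaseCoord e he w) :
    PhaseCoord n k →L[ℝ] PhaseCoord n k) x

theorem vecCoord_vecMk {w : Phase π k} (hw : rhoE w ∈ e.source) (x : PhaseCoord n k) :
    vecCoord he w (vecMk he w x) = x := by
  have ht := phaseCoord_mem_target he hw
  have h1 := (contMDiffAt_phaseMk he ht).mdifferentiableAt (n := ∞) (by simp)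
  have hww := phaseMk_phaseCoord he hw
  have h2 : MDifferentiableAt (phaseModel n k) 𝓘(ℝ, PhaseCoord n k) (phaseCoord e he)
      (phaseMk k π e he (phaseCoord e he w)) := by
    rw [hww]; exact (contMDiffAt_phaseCoord he hw).mdifferentiableAt (n := ∞) (by simp)
  have h := mfderiv_comp (phaseCoord e he w) h2 h1
  have h' : phaseCoord e he ∘ phaseMk k π e he =ᶠ[𝓝 (phaseCoord e he w)] id := by
    filter_upwards [(isOpen_phaseTarget he).mem_nhds ht] with x' hx' using phaseCoord_phaseMk he hx'
  rw [h'.mfderiv_eq, mfderiv_id] at h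
  have h3 := (congrArg (fun T : PhaseCoord n k →L[ℝ] PhaseCoord n k => T x) h).symm
  refine Eq.trans ?_ h3
  change (mfderiv (phaseModel n k) 𝓘(ℝ, PhaseCoord n k) (phaseCoord e he) w :
    PhaseCoord n k →L[ℝ] PhaseCoord n k) _ =
    (mfderiv (phaseModel n k) 𝓘(ℝ, PhaseCoord n k) (phaseCoord e he)
      (phaseMk k π e he (phaseCoord e he w)) : PhaseCoord n k →L[ℝ] PhaseCoord n k) _
  rw [hww]
  rfl

theorem vecMk_vecCoord {w : Phase π k} (hw : rhoE w ∈ e.source)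
    (u : TangentSpace (phaseModel n k) w) : vecMk he w (vecCoord he w u) = u := by
  have ht := phaseCoord_mem_target he hw
  have h1 := (contMDiffAt_phaseMk he ht).mdifferentiableAt (n := ∞) (by simp)
  have h2 := (contMDiffAt_phaseCoord he hw).mdifferentiableAt (n := ∞) (by simp)
  have h := mfderiv_comp w h1 h2
  have h' : phaseMk k π e he ∘ phaseCoord e he =ᶠ[𝓝 w] id := by
    filter_upwards [(isOpen_rhoE_source he).mem_nhds hw] with w' hw' using phaseMk_phaseCoord he hw'
  rw [h'.mfderiv_eq, mfderiv_id] at h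
  exact (congrArg (fun T : PhaseCoord n k →L[ℝ] PhaseCoord n k => T u) h).symm

/-- A vector field with smooth components is smooth. -/
theorem contMDiffOn_vecMk {V : Phase π k → PhaseCoord n k}
    {s : Set (Phase π k)} (hs : s ⊆ {w | rhoE w ∈ e.source})
    (hV : ContMDiffOn (phaseModel n k) 𝓘(ℝ, PhaseCoord n k) ∞ V s) :
    ContMDiffOn (phaseModel n k) (phaseModel n k).tangent ∞
      (fun w => (⟨w, vecMk he w (V w)⟩ : TangentBundle (phaseModel n k) (Phase π k))) s := by
  set t : Set (PhaseCoord n k) := {x | x.1 ∈ (jetChart (π := π) (2 * k - 1) e he).target}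
  have ht : IsOpen t := isOpen_phaseTarget he
  have h1 : ContMDiffOn 𝓘(ℝ, PhaseCoord n k) (phaseModel n k) ∞ (phaseMk k π e he) t :=
    fun x hx => (contMDiffAt_phaseMk he hx).contMDiffWithinAt
  -- The field is the tangent map of the inverse chart applied to `w ↦ (phaseCoord w, V w)`. The
  -- result lies over `phaseMk (phaseCoord w)`, and `hgen` below moves it to `w`.
  have h2 := h1.contMDiffOn_tangentMapWithin (m := ∞) (by simp) ht.uniqueMDiffOn
  have h3 : ContMDiffOn (phaseModel n k) (𝓘(ℝ, PhaseCoord n k)).tangent ∞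
      (fun w => (⟨phaseCoord e he w, V w⟩ : TangentBundle 𝓘(ℝ, PhaseCoord n k) (PhaseCoord n k))) s := by
    intro w hw
    rw [Bundle.contMDiffWithinAt_totalSpace]
    refine ⟨(contMDiffAt_phaseCoord he (hs hw)).contMDiffWithinAt, ?_⟩
    simpa using hV w hw
  refine (h2.comp h3 fun w hw => phaseCoord_mem_target he (hs hw)).congr fun w hw => ?_
  have hww := phaseMk_phaseCoord he (hs hw)
  have hgen : ∀ (w' : Phase π k) (x : PhaseCoord n k), w' = w →
      (⟨w, x⟩ : TangentBundle (phaseModel n k) (Phase π k)) = ⟨w', x⟩ := by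
    rintro _ x rfl; rfl
  refine (hgen _ _ hww).trans ?_
  simp only [Function.comp, tangentMapWithin]
  rw [mfderivWithin_of_mem_nhds (ht.mem_nhds (phaseCoord_mem_target he (hs hw)))]
  rfl

/-- The linear map `(t, q_0, …, q_s) ↦ (0, q_1, …, q_{r+1})`. -/
def shift {n : ℕ} {r s : ℕ} (h : r + 1 ≤ s) : JetModel n s →L[ℝ] JetModel n r :=
  ContinuousLinearMap.prod 0 ((ContinuousLinearMap.pi fun i : Fin (r + 1) =>
    ContinuousLinearMap.proj (⟨i + 1, by omega⟩ : Fin (s + 1))).comp (ContinuousLinearMap.snd ℝ _ _))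

@[simp] theorem shift_fst {r s : ℕ} (h : r + 1 ≤ s) (z : JetModel n s) : (shift h z).1 = 0 := rfl

@[simp] theorem shift_snd {r s : ℕ} (h : r + 1 ≤ s) (z : JetModel n s) (i : Fin (r + 1)) :
    (shift h z).2 i = z.2 ⟨i + 1, by omega⟩ := rfl

/-- The velocity `(1, q_1, …, q_{r+1})` of the prolongation of a section. -/
def holonomicVelocity {n : ℕ} {r s : ℕ} (h : r + 1 ≤ s) (z : JetModel n s) : JetModel n r :=
  (1, 0) + shift h z

@[simp] theorem holonomicVelocity_fst {r s : ℕ} (h : r + 1 ≤ s) (z : JetModel n s) :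
    (holonomicVelocity h z).1 = 1 := by simp [holonomicVelocity]

@[simp] theorem holonomicVelocity_snd {r s : ℕ} (h : r + 1 ≤ s) (z : JetModel n s)
    (i : Fin (r + 1)) : (holonomicVelocity h z).2 i = z.2 ⟨i + 1, by omega⟩ := by
  simp [holonomicVelocity]

theorem jetChart_prolong (r : ℕ) {φ : ℝ → E} {t : ℝ} (h : IsSectionNear π φ t)
    (ht : φ t ∈ e.source) : jetChart r e he (prolong π r φ t) =
      (t, fun i : Fin (r + 1) => iteratedDeriv i (fun s => (e (φ s)).2) t) := by
  rw [prolong_of h]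
  exact jetCoord_jet (r := r) he (φ := ⟨t, φ, h⟩) ht

theorem IsSectionNear.eventually {φ : ℝ → E} {t : ℝ} (h : IsSectionNear π φ t) :
    ∀ᶠ s in 𝓝 t, IsSectionNear π φ s := eventually_eventually_nhds.2 h

theorem IsSectionNear.eventually_mem {φ : ℝ → E} {t : ℝ} (h : IsSectionNear π φ t)
    (ht : φ t ∈ e.source) : ∀ᶠ s in 𝓝 t, φ s ∈ e.source :=
  h.self_of_nhds.1.continuousAt.preimage_mem_nhds (e.open_source.mem_nhds ht)

theorem contDiffAt_jetChart_prolong (r : ℕ) {φ : ℝ → E} {t : ℝ} (h : IsSectionNear π φ t)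
    (ht : φ t ∈ e.source) : ContDiffAt ℝ ∞ (fun s => jetChart r e he (prolong π r φ s)) t := by
  have h1 : (fun s => jetChart r e he (prolong π r φ s)) =ᶠ[𝓝 t]
      fun s => (s, fun i : Fin (r + 1) => iteratedDeriv i (fun s => (e (φ s)).2) s) := by
    filter_upwards [h.eventually, h.eventually_mem ht] with s hs hs'
    exact jetChart_prolong he r hs hs'
  refine ContDiffAt.congr_of_eventuallyEq ?_ h1
  refine contDiffAt_id.prodMk (contDiffAt_pi.2 fun i => ?_)
  have h2 : ContDiffAt ℝ ∞ (fun s => (e (φ s)).2) t := (contDiffAt_of_isSectionNear he h ht).snd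
  exact contDiffAt_iteratedDeriv h2 i

/-- The velocity of the prolongation of a section in natural coordinates. -/
theorem hasDerivAt_jetChart_prolong {r s : ℕ} (hrs : r + 1 ≤ s) {φ : ℝ → E} {t : ℝ}
    (h : IsSectionNear π φ t) (ht : φ t ∈ e.source) :
    HasDerivAt (fun s => jetChart r e he (prolong π r φ s))
      (holonomicVelocity hrs (jetChart s e he (prolong π s φ t))) t := by
  have h1 : (fun s => jetChart r e he (prolong π r φ s)) =ᶠ[𝓝 t]
      fun s => (s, fun i : Fin (r + 1) => iteratedDeriv i (fun s => (e (φ s)).2) s) := by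
    filter_upwards [h.eventually, h.eventually_mem ht] with s hs hs'
    exact jetChart_prolong he r hs hs'
  refine HasDerivAt.congr_of_eventuallyEq ?_ h1
  have h2 : ContDiffAt ℝ ∞ (fun s => (e (φ s)).2) t := (contDiffAt_of_isSectionNear he h ht).snd
  have h4 : holonomicVelocity hrs (jetChart s e he (prolong π s φ t)) =
      (1, fun i : Fin (r + 1) => iteratedDeriv (i + 1) (fun s => (e (φ s)).2) t) := by
    refine Prod.ext (by simp) (funext fun i => ?_)
    rw [holonomicVelocity_snd, jetChart_prolong he s h ht]
  rw [h4]
  refine (hasDerivAt_id t).prodMk (hasDerivAt_pi.2 fun i => ?_)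
  rw [iteratedDeriv_succ]
  exact ((contDiffAt_iteratedDeriv h2 i).differentiableAt (by simp)).hasDerivAt

theorem rep_time (w : Phase π k) : (rho1 w).rep.time = rhoR w :=
  congrArg Jet.time (rho1 w).jet_rep

theorem isSectionNear_rep (w : Phase π k) : IsSectionNear π (rho1 w).rep.map (rhoR w) :=
  rep_time w ▸ (rho1 w).rep.isSection

theorem prolong_rep {w : Phase π k} {r : ℕ} (hr : r ≤ 2 * k - 1) :
    prolong π r (rho1 w).rep.map (rhoR w) = Jet.proj hr (rho1 w) := by
  rw [← rep_time, prolong_of (rho1 w).rep.isSection]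
  exact congrArg (Jet.proj hr) (rho1 w).jet_rep

theorem rep_map_time (w : Phase π k) : (rho1 w).rep.map (rhoR w) = rhoE w := by
  rw [← rep_time]
  exact congrArg Jet.point (rho1 w).jet_rep

theorem proj_self {r : ℕ} (y : Jet π r) : Jet.proj le_rfl y = y := by
  obtain ⟨φ, rfl⟩ : ∃ φ : LocalSection π, φ.jet r = y := ⟨_, y.jet_rep⟩
  rfl

/-- The velocity of the prolongation of a section representing the jet `ρ₁(w)`. -/
theorem mfderiv_prolong_rep {w : Phase π k} (hw : rhoE w ∈ e.source) {r : ℕ}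
    (hr : r + 1 ≤ 2 * k - 1) :
    (mfderiv 𝓘(ℝ, ℝ) 𝓘(ℝ, JetModel n r) (prolong π r (rho1 w).rep.map) (rhoR w) :
      ℝ →L[ℝ] JetModel n r) 1 =
    (mfderiv 𝓘(ℝ, JetModel n r) 𝓘(ℝ, JetModel n r) (jetChart r e he).symm
      (jetChart r e he (Jet.proj (show r ≤ 2 * k - 1 by omega) (rho1 w))) :
        JetModel n r →L[ℝ] JetModel n r) (holonomicVelocity hr (phaseCoord e he w).1) := by
  set φ := (rho1 w).rep with hφ
  have hsec : IsSectionNear π φ.map (rhoR w) := isSectionNear_rep w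
  have hs : φ.map (rhoR w) ∈ e.source := by rw [hφ, rep_map_time]; exact hw
  have hprol := prolong_rep (w := w) (show r ≤ 2 * k - 1 by omega)
  -- The velocity of `j^r φ` involves only `q_1, …, q_{r+1}`, and `r + 1 ≤ 2k - 1`; so it depends on
  -- the jet and not on the chosen representative.
  have hd := hasDerivAt_jetChart_prolong he hr hsec hs
  rw [hφ, prolong_rep le_rfl, proj_self, ← hφ] at hd
  have hev : prolong π r φ.map =ᶠ[𝓝 (rhoR w)]
      (jetChart r e he).symm ∘ fun s => jetChart r e he (prolong π r φ.map s) := by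
    filter_upwards [hsec.eventually, hsec.eventually_mem hs] with s h h'
    refine ((jetChart r e he).left_inv ?_).symm
    rw [prolong_of h]
    exact h'
  have hmem : Jet.proj (show r ≤ 2 * k - 1 by omega) (rho1 w) ∈ (jetChart r e he).source := by
    change (Jet.proj (show r ≤ 2 * k - 1 by omega) (rho1 w)).point ∈ e.source
    rwa [point_proj]
  have hsymm : MDifferentiableAt 𝓘(ℝ, JetModel n r) 𝓘(ℝ, JetModel n r)
      (jetChart r e he).symm (jetChart r e he (prolong π r φ.map (rhoR w))) := by
    rw [hprol]
    exact mdifferentiableAt_chart_symm (jetChart_mem_maximalAtlas r he)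
      ((jetChart r e he).map_source hmem)
  have h := mfderiv_comp (I := 𝓘(ℝ, ℝ)) (rhoR w) hsymm hd.differentiableAt.mdifferentiableAt
  rw [← hev.mfderiv_eq, mfderiv_eq_fderiv] at h
  refine (congrArg (fun T : ℝ →L[ℝ] JetModel n r => T 1) h).trans
      ((congrArg (mfderiv 𝓘(ℝ, JetModel n r) 𝓘(ℝ, JetModel n r)
        (jetChart r e he).symm (jetChart r e he (prolong π r φ.map (rhoR w))) :
          JetModel n r →L[ℝ] JetModel n r) hd.deriv).trans ?_)
  rw [hprol]
  rfl

/-- The coupling function is `p + p_A^i q_{i+1}^A` in natural coordinates. -/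
theorem couplingFun_eq (hk : 1 ≤ k) {w : Phase π k} (hw : rhoE w ∈ e.source) :
    couplingFun w = (phaseCoord e he w).2
      (holonomicVelocity (show k - 1 + 1 ≤ 2 * k - 1 by omega) (phaseCoord e he w).1) :=
  congrArg (show JetModel n (k - 1) →L[ℝ] ℝ from w.snd)
    (mfderiv_prolong_rep he hw (show k - 1 + 1 ≤ 2 * k - 1 by omega))

/-- A function on `J^k π` in natural coordinates. -/
def localLagrangian (L : Jet π k → ℝ) (z : JetModel n k) : ℝ := L ((jetChart k e he).symm z)

theorem contDiffAt_localLagrangian {L : Jet π k → ℝ}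
    (hL : ContMDiff 𝓘(ℝ, JetModel n k) 𝓘(ℝ, ℝ) ∞ L) {z : JetModel n k}
    (hz : z ∈ (jetChart (π := π) k e he).target) : ContDiffAt ℝ ∞ (localLagrangian he L) z :=
  ((hL _).comp z (contMDiffAt_symm_of_mem_maximalAtlas (jetChart_mem_maximalAtlas k he)
    hz)).contDiffAt

theorem liftLagrangian_eq (hk : 1 ≤ k) (L : Jet π k → ℝ) {w : Phase π k} (hw : rhoE w ∈ e.source) :
    liftLagrangian hk L w = localLagrangian he L
      (truncate (show k ≤ 2 * k - 1 by omega) (phaseCoord e he w).1) := by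
  have h := jetChart_proj (show k ≤ 2 * k - 1 by omega) he (y := rho1 w) hw
  unfold localLagrangian liftLagrangian
  refine congrArg L ?_
  refine Eq.trans ?_ (congrArg _ h)
  refine ((jetChart k e he).left_inv ?_).symm
  change (Jet.proj (show k ≤ 2 * k - 1 by omega) (rho1 w)).point ∈ e.source
  rwa [point_proj]

/-- The differential of `Ĉ - L̂` in natural coordinates. -/
def hamiltonianDeriv (hk : 1 ≤ k) (L : Jet π k → ℝ) (x : PhaseCoord n k) : PhaseCoord n k →L[ℝ] ℝ :=
  (ContinuousLinearMap.apply ℝ ℝ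
      (holonomicVelocity (show k - 1 + 1 ≤ 2 * k - 1 by omega) x.1)).comp
      (ContinuousLinearMap.snd ℝ _ _) +
    (x.2.comp (shift (show k - 1 + 1 ≤ 2 * k - 1 by omega)) -
      (fderiv ℝ (localLagrangian he L) (truncate (show k ≤ 2 * k - 1 by omega) x.1)).comp
        (truncate (show k ≤ 2 * k - 1 by omega))).comp (ContinuousLinearMap.fst ℝ _ _)

theorem hamiltonianDeriv_apply (hk : 1 ≤ k) (L : Jet π k → ℝ) (x y : PhaseCoord n k) :
    hamiltonianDeriv he hk L x y =
      y.2 (holonomicVelocity (show k - 1 + 1 ≤ 2 * k - 1 by omega) x.1) +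
      (x.2 (shift (show k - 1 + 1 ≤ 2 * k - 1 by omega) y.1) -
      fderiv ℝ (localLagrangian he L) (truncate (show k ≤ 2 * k - 1 by omega) x.1)
        (truncate (show k ≤ 2 * k - 1 by omega) y.1)) := rfl

theorem contDiff_holonomicVelocity {r s : ℕ} (h : r + 1 ≤ s) :
    ContDiff ℝ ∞ (holonomicVelocity (n := n) h) :=
  contDiff_const.add (shift h).contDiff

/-- The function `Ĉ - L̂` in natural coordinates. -/
def hamiltonianCoord (hk : 1 ≤ k) (L : Jet π k → ℝ) (x : PhaseCoord n k) : ℝ :=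
  x.2 (holonomicVelocity (show k - 1 + 1 ≤ 2 * k - 1 by omega) x.1) -
    localLagrangian he L (truncate (show k ≤ 2 * k - 1 by omega) x.1)

theorem hamiltonianCoord_phaseCoord (hk : 1 ≤ k) (L : Jet π k → ℝ) {w : Phase π k}
    (hw : rhoE w ∈ e.source) :
    couplingFun w - liftLagrangian hk L w = hamiltonianCoord he hk L (phaseCoord e he w) := by
  rw [couplingFun_eq he hk hw, liftLagrangian_eq he hk L hw]
  rfl

theorem hasFDerivAt_hamiltonianCoord (hk : 1 ≤ k) {L : Jet π k → ℝ}
    (hL : ContMDiff 𝓘(ℝ, JetModel n k) 𝓘(ℝ, ℝ) ∞ L) {w : Phase π k} (hw : rhoE w ∈ e.source) :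
    HasFDerivAt (hamiltonianCoord he hk L) (hamiltonianDeriv he hk L (phaseCoord e he w))
      (phaseCoord e he w) := by
  set x := phaseCoord e he w with hx
  have hz : truncate (show k ≤ 2 * k - 1 by omega) x.1 ∈ (jetChart (π := π) k e he).target :=
    truncate_mem_target he (show k ≤ 2 * k - 1 by omega) (phaseCoord_mem_target he hw)
  have h1 : HasFDerivAt (fun x : PhaseCoord n k =>
      holonomicVelocity (show k - 1 + 1 ≤ 2 * k - 1 by omega) x.1)
      ((shift (show k - 1 + 1 ≤ 2 * k - 1 by omega)).comp (ContinuousLinearMap.fst ℝ _ _)) x :=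
    ((shift (n := n) (show k - 1 + 1 ≤ 2 * k - 1 by omega)).comp
      (ContinuousLinearMap.fst ℝ _ (JetModel n (k - 1) →L[ℝ] ℝ))).hasFDerivAt.const_add _
  have h2 := (contDiffAt_localLagrangian he hL hz).differentiableAt (by simp)
  have h3 := h2.hasFDerivAt.comp x ((truncate (n := n) (show k ≤ 2 * k - 1 by omega)).comp
    (ContinuousLinearMap.fst ℝ _ (JetModel n (k - 1) →L[ℝ] ℝ))).hasFDerivAt
  have h4 := ((hasFDerivAt_snd (p := x)).clm_apply h1).sub h3
  refine h4.congr_fderiv ?_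
  refine ContinuousLinearMap.ext fun y => ?_
  rw [hamiltonianDeriv_apply]
  simp
  ring

/-- Tangency becomes one linear equation on components. In it the component along `∂/∂p` has
coefficient `1`, the time component of the holonomic velocity, so a multiple of `∂/∂p` can always
correct a vector to a tangent one. -/
theorem mem_tangentWo_iff (hk : 1 ≤ k) {L : Jet π k → ℝ}
    (hL : ContMDiff 𝓘(ℝ, JetModel n k) 𝓘(ℝ, ℝ) ∞ L) {w : Phase π k} (hw : rhoE w ∈ e.source)
    (u : TangentSpace (phaseModel n k) w) :
    u ∈ tangentWo hk L w ↔ hamiltonianDeriv he hk L (phaseCoord e he w) (vecCoord he w u) = 0 := by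
  have hg := hasFDerivAt_hamiltonianCoord he hk hL hw
  have h := mfderiv_comp_phaseCoord (w := w) he hw hg.differentiableAt
    (f := fun w' => couplingFun w' - liftLagrangian hk L w') (by
      filter_upwards [(isOpen_rhoE_source he).mem_nhds hw] with w' hw'
      exact hamiltonianCoord_phaseCoord he hk L hw') u
  rw [hg.fderiv] at h
  exact ⟨fun hu => h.symm.trans hu, fun hu => h.trans hu⟩

theorem timeComponent_eq (X : ∀ w : Phase π k, TangentSpace (phaseModel n k) w) {w : Phase π k}
    (hw : rhoE w ∈ e.source) : timeComponent X w = (vecCoord he w (X w)).1.1 := by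
  let g : PhaseCoord n k →L[ℝ] ℝ :=
    (ContinuousLinearMap.fst ℝ _ _).comp (ContinuousLinearMap.fst ℝ _ _)
  have h := mfderiv_comp_phaseCoord (w := w) he hw (g := g) g.differentiableAt
    (f := rhoR) Filter.EventuallyEq.rfl (X w)
  rw [g.fderiv] at h
  exact h

end Coupling

/-! ### The dynamical equation at a point and its coordinate form -/

section Equations

variable {n k : ℕ} {E : Type*} [TopologicalSpace E] [ChartedSpace (BaseModel n) E] {π : Fibred n E}
variable {e : OpenPartialHomeomorph E (BaseModel n)} (he : IsAdapted π.proj e)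

theorem isSectionNear_rhoE {σ : ℝ → Phase π k} {s : Set ℝ} (hs : IsOpen s)
    (hσ : ContMDiffOn 𝓘(ℝ, ℝ) (phaseModel n k) ∞ σ s) (hR : ∀ t ∈ s, rhoR (σ t) = t)
    {t : ℝ} (ht : t ∈ s) : IsSectionNear π (fun t' => rhoE (σ t')) t := by
  filter_upwards [hs.mem_nhds ht] with t' ht'
  refine ⟨(contMDiff_rhoE (σ t')).comp t' (hσ.contMDiffAt (hs.mem_nhds ht')), ?_⟩
  rw [proj_rhoE, hR t' ht']

theorem hasDerivAt_phaseCoord {σ : ℝ → Phase π k} {t : ℝ}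
    (hσ : ContMDiffAt 𝓘(ℝ, ℝ) (phaseModel n k) ∞ σ t) (hw : rhoE (σ t) ∈ e.source) :
    HasDerivAt (fun s => phaseCoord e he (σ s)) (vecCoord he (σ t) (velocity σ t)) t := by
  have h1 := (contMDiffAt_phaseCoord he hw).mdifferentiableAt (n := ∞) (by simp)
  have h2 := hσ.mdifferentiableAt (n := ∞) (by simp)
  have h3 := mfderiv_comp t h1 h2
  have h4 : DifferentiableAt ℝ (fun s => phaseCoord e he (σ s)) t :=
    (h1.comp t h2).differentiableAt
  have h5 := h4.hasDerivAt
  rw [mfderiv_eq_fderiv] at h3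
  have h6 : deriv (fun s => phaseCoord e he (σ s)) t = vecCoord he (σ t) (velocity σ t) :=
    congrArg (fun T : ℝ →L[ℝ] PhaseCoord n k => T 1) h3
  rwa [h6] at h5

/-- The velocity of a holonomic section. -/
theorem truncate_velocity {σ : ℝ → Phase π k} {s : Set ℝ} (hs : IsOpen s)
    (hσ : ContMDiffOn 𝓘(ℝ, ℝ) (phaseModel n k) ∞ σ s) (hR : ∀ t ∈ s, rhoR (σ t) = t)
    (hol : IsHolonomicOn σ s) {t : ℝ} (ht : t ∈ s) (hw : rhoE (σ t) ∈ e.source)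
    {r : ℕ} (hr : r ≤ 2 * k - 1) (hr' : r + 1 ≤ 2 * k - 1) :
    truncate hr (vecCoord he (σ t) (velocity σ t)).1 =
      holonomicVelocity hr' (phaseCoord e he (σ t)).1 := by
  have h1 := hasDerivAt_phaseCoord he (hσ.contMDiffAt (hs.mem_nhds ht)) hw
  have h2 : HasDerivAt (fun s => truncate hr (phaseCoord e he (σ s)).1)
      (truncate hr (vecCoord he (σ t) (velocity σ t)).1) t :=
    ((truncate (n := n) hr).comp (ContinuousLinearMap.fst ℝ _ (JetModel n (k - 1) →L[ℝ] ℝ))).hasFDerivAt.comp_hasDerivAt t h1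
  have hsec := isSectionNear_rhoE hs hσ hR ht
  have h3 := hasDerivAt_jetChart_prolong he hr' hsec hw
  have hol_t : prolong π (2 * k - 1) (fun t' => rhoE (σ t')) t = rho1 (σ t) := (hol t ht).symm
  rw [hol_t] at h3
  refine h2.unique (h3.congr_of_eventuallyEq ?_)
  -- Holonomy is needed near `t`: there the truncated coordinates of `σ` are those of `j^r φ`, whose
  -- derivative is known.
  filter_upwards [hs.mem_nhds ht, hsec.eventually, hsec.eventually_mem hw] with t' ht' hs' hw'
  have h4 := jetChart_proj hr he (y := rho1 (σ t')) hw'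
  refine h4.symm.trans (congrArg _ ?_)
  rw [hol t' ht', prolong_of hs', prolong_of hs']
  rfl

/-- Extending a vector of coordinates by zeros. -/
def extendZero {n : ℕ} (r s : ℕ) : JetModel n r →L[ℝ] JetModel n s :=
  (ContinuousLinearMap.fst ℝ _ _).prod ((ContinuousLinearMap.pi fun i : Fin (s + 1) =>
    if h : (i : ℕ) < r + 1 then ContinuousLinearMap.proj (⟨i, h⟩ : Fin (r + 1)) else 0).comp
      (ContinuousLinearMap.snd ℝ _ _))

theorem extendZero_snd {r s : ℕ} (z : JetModel n r) (i : Fin (s + 1)) :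
    (extendZero r s z).2 i = if h : (i : ℕ) < r + 1 then z.2 ⟨i, h⟩ else 0 := by
  change (if h : (i : ℕ) < r + 1 then
    ContinuousLinearMap.proj (R := ℝ) (φ := fun _ : Fin (r + 1) => Fin n → ℝ) (⟨i, h⟩ : Fin (r + 1))
      else 0 : (Fin (r + 1) → Fin n → ℝ) →L[ℝ] Fin n → ℝ) z.2 = _
  split_ifs <;> rfl

theorem truncate_extendZero {r s : ℕ} (h : r ≤ s) (z : JetModel n r) :
    truncate h (extendZero r s z) = z := by
  refine Prod.ext rfl (funext fun i => ?_)
  rw [truncate_snd, extendZero_snd, dif_pos i.2]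

theorem truncate_truncate {q r s : ℕ} (h : q ≤ r) (h' : r ≤ s) (z : JetModel n s) :
    truncate h (truncate h' z) = truncate (h.trans h') z := rfl

theorem shift_truncate {q r s : ℕ} (h : q + 1 ≤ r) (h' : r ≤ s) (z : JetModel n s) :
    shift h (truncate h' z) = shift (h.trans h') z := rfl

/-- The linear form on `T J^k π` which vanishes along the solutions of the dynamical equation. -/
def equationForm (hk : 1 ≤ k) (L : Jet π k → ℝ) (x : PhaseCoord n k)
    (p : JetModel n (k - 1) →L[ℝ] ℝ) : JetModel n k →L[ℝ] ℝ :=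
  fderiv ℝ (localLagrangian he L) (truncate (show k ≤ 2 * k - 1 by omega) x.1) -
    x.2.comp (shift (show k - 1 + 1 ≤ k by omega)) - p.comp (truncate (show k - 1 ≤ k by omega))

theorem equationForm_apply (hk : 1 ≤ k) (L : Jet π k → ℝ) (x : PhaseCoord n k)
    (p : JetModel n (k - 1) →L[ℝ] ℝ) (ζ : JetModel n k) :
    equationForm he hk L x p ζ =
      fderiv ℝ (localLagrangian he L) (truncate (show k ≤ 2 * k - 1 by omega) x.1) ζ -
      x.2 (shift (show k - 1 + 1 ≤ k by omega) ζ) - p (truncate (show k - 1 ≤ k by omega) ζ) := rfl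

/-- With `u_q` equal to the holonomic velocity, the momentum part of `v` occurs in `Ω(u, v)` only
through its value there. The tangency equation of `v` trades that value for terms in the jet part of
`v` up to order `k`. -/
theorem omega_eq_equationForm (hk : 1 ≤ k) {L : Jet π k → ℝ}
    (hL : ContMDiff 𝓘(ℝ, JetModel n k) 𝓘(ℝ, ℝ) ∞ L) {w : Phase π k} (hw : rhoE w ∈ e.source)
    {u v : TangentSpace (phaseModel n k) w}
    (hu : truncate (show k - 1 ≤ 2 * k - 1 by omega) (vecCoord he w u).1 =
      holonomicVelocity (show k - 1 + 1 ≤ 2 * k - 1 by omega) (phaseCoord e he w).1)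
    (hv : v ∈ tangentWo hk L w) :
    omega w u v = equationForm he hk L (phaseCoord e he w) (vecCoord he w u).2
      (truncate (show k ≤ 2 * k - 1 by omega) (vecCoord he w v).1) := by
  rw [mem_tangentWo_iff he hk hL hw, hamiltonianDeriv_apply] at hv
  rw [omega_eq he hk hw, hu, equationForm_apply, truncate_truncate, shift_truncate]
  linarith

theorem eq_sum_jetUnit {r : ℕ} (z : JetModel n r) (hz : z.1 = 0) :
    z = ∑ i : Fin (r + 1), ∑ A : Fin n, z.2 i A • jetUnit r i A := by
  refine Prod.ext ?_ (funext fun j => funext fun B => ?_)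
  · simp [Prod.fst_sum, jetUnit, hz]
  · simp only [Prod.snd_sum, Finset.sum_apply, Prod.smul_snd, Pi.smul_apply, jetUnit, smul_eq_mul,
      mul_ite, mul_one, mul_zero]
    rw [Finset.sum_eq_single j, Finset.sum_eq_single B]
    · simp
    · intro A _ hA; simp [hA.symm]
    · simp
    · intro i _ hi
      refine Finset.sum_eq_zero fun A _ => ?_
      rw [if_neg]
      rintro ⟨h, -⟩
      exact hi (Fin.ext h.symm)
    · simp

/-- The vectors `∂/∂q_i^A` span the kernel of `dt`, so a single further vector transverse to this
kernel completes the test. -/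
theorem clm_eq_zero {r : ℕ} {q : JetModel n r →L[ℝ] ℝ} (h : ∀ i ≤ r, ∀ A : Fin n, q (jetUnit r i A) = 0)
    {υ : JetModel n r} (hυ : υ.1 = 1) (hq : q υ = 0) : q = 0 := by
  have h0 : ∀ z : JetModel n r, z.1 = 0 → q z = 0 := by
    intro z hz
    rw [eq_sum_jetUnit z hz]
    simp only [map_sum, map_smul]
    refine Finset.sum_eq_zero fun i _ => Finset.sum_eq_zero fun A _ => ?_
    rw [h i (by omega) A, smul_zero]
  refine ContinuousLinearMap.ext fun ζ => ?_
  have h3 : q (ζ - ζ.1 • υ) = 0 := h0 _ (by simp [hυ])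
  rw [map_sub, map_smul, hq, smul_zero, sub_zero] at h3
  exact h3

/-- In one direction each `∂/∂q_i^A` lifts to a tangent vector of `W_o`. In the other, `Ω(u, u) = 0`
supplies the missing direction, so the equation in the time direction follows from the rest. -/
theorem omega_eq_zero_iff (hk : 1 ≤ k) {L : Jet π k → ℝ}
    (hL : ContMDiff 𝓘(ℝ, JetModel n k) 𝓘(ℝ, ℝ) ∞ L) {w : Phase π k} (hw : rhoE w ∈ e.source)
    {u : TangentSpace (phaseModel n k) w}
    (hu : truncate (show k - 1 ≤ 2 * k - 1 by omega) (vecCoord he w u).1 =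
      holonomicVelocity (show k - 1 + 1 ≤ 2 * k - 1 by omega) (phaseCoord e he w).1)
    (hut : u ∈ tangentWo hk L w) :
    (∀ v ∈ tangentWo hk L w, omega w u v = 0) ↔
    ∀ i ≤ k, ∀ A : Fin n, equationForm he hk L (phaseCoord e he w) (vecCoord he w u).2
      (jetUnit k i A) = 0 := by
  set Λ := equationForm he hk L (phaseCoord e he w) (vecCoord he w u).2 with hΛ
  constructor
  · intro h i _ A
    set x := phaseCoord e he w
    let z : JetModel n (2 * k - 1) := extendZero k (2 * k - 1) (jetUnit k i A)
    -- The value of `d(Ĉ - L̂)` on the jet part `z`. The momentum part `-c dt` cancels it, because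
    -- the holonomic velocity has time component `1`.
    let c : ℝ := x.2 (shift (show k - 1 + 1 ≤ 2 * k - 1 by omega) z) -
      fderiv ℝ (localLagrangian he L) (truncate (show k ≤ 2 * k - 1 by omega) x.1)
        (truncate (show k ≤ 2 * k - 1 by omega) z)
    let v := vecMk he w (z, -c • ContinuousLinearMap.fst ℝ _ _)
    have hv : v ∈ tangentWo hk L w := by
      rw [mem_tangentWo_iff he hk hL hw, vecCoord_vecMk he hw, hamiltonianDeriv_apply]
      simp [c, x]
    have h1 := omega_eq_equationForm he hk hL hw hu hv
    rw [h v hv, vecCoord_vecMk he hw] at h1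
    change 0 = Λ (truncate (show k ≤ 2 * k - 1 by omega) (extendZero k (2 * k - 1) (jetUnit k i A))) at h1
    rw [truncate_extendZero] at h1
    exact h1.symm
  · intro h v hv
    rw [omega_eq_equationForm he hk hL hw hu hv, ← hΛ]
    set ζ := truncate (show k ≤ 2 * k - 1 by omega) (vecCoord he w v).1
    set υ := truncate (show k ≤ 2 * k - 1 by omega) (vecCoord he w u).1 with hυ
    have h1 : Λ υ = 0 := by
      rw [hΛ, hυ, ← omega_eq_equationForm he hk hL hw hu hut, omega_eq he hk hw, sub_self]
    have h2 : υ.1 = 1 := by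
      have := congrArg Prod.fst hu
      rw [holonomicVelocity_fst] at this
      exact this
    rw [clm_eq_zero h h2 h1]
    rfl

/-- The case of interest is `i = r + 1`: truncating `∂/∂q_k` to order `k - 1` gives `0`. -/
theorem jetUnit_of_lt {r i : ℕ} (h : r < i) (A : Fin n) : jetUnit r i A = 0 := by
  refine Prod.ext rfl (funext fun j => funext fun B => ?_)
  simp only [jetUnit]
  rw [if_neg (by omega)]
  rfl

theorem truncate_jetUnit {r s : ℕ} (h : r ≤ s) (i : ℕ) (A : Fin n) :
    truncate h (jetUnit s i A) = jetUnit r i A := rfl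

theorem shift_jetUnit_succ {r s : ℕ} (h : r + 1 ≤ s) (i : ℕ) (A : Fin n) :
    shift h (jetUnit s (i + 1) A) = jetUnit r i A := by
  refine Prod.ext rfl (funext fun j => funext fun B => ?_)
  simp [jetUnit]

theorem shift_jetUnit_zero {r s : ℕ} (h : r + 1 ≤ s) (A : Fin n) :
    shift h (jetUnit s 0 A) = 0 := by
  refine Prod.ext rfl (funext fun j => funext fun B => ?_)
  simp [jetUnit]

theorem liftPartialDeriv_eq (hk : 1 ≤ k) (L : Jet π k → ℝ) (i : ℕ) (A : Fin n) {w : Phase π k}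
    (hw : rhoE w ∈ e.source) : liftPartialDeriv hk L he i A w =
      fderiv ℝ (localLagrangian he L)
        (truncate (show k ≤ 2 * k - 1 by omega) (phaseCoord e he w).1) (jetUnit k i A) := by
  have h := jetChart_proj (show k ≤ 2 * k - 1 by omega) he (y := rho1 w) hw
  unfold liftPartialDeriv partialDeriv
  rw [h]
  rfl

/-- The shift kills `∂/∂q_0`, so no momentum of the base point enters for `i = 0`. The truncation
kills `∂/∂q_k`, so `p` does not enter for `i = k` and a constraint remains. In between both terms
survive. -/
theorem equationForm_jetUnit_eq_zero_iff (hk : 1 ≤ k) (L : Jet π k → ℝ) {w : Phase π k}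
    (hw : rhoE w ∈ e.source) (p : JetModel n (k - 1) →L[ℝ] ℝ) (A : Fin n) :
    (∀ i ≤ k, equationForm he hk L (phaseCoord e he w) p (jetUnit k i A) = 0) ↔
      p (jetUnit (k - 1) 0 A) = liftPartialDeriv hk L he 0 A w ∧
      (∀ i : ℕ, 1 ≤ i → i ≤ k - 1 → p (jetUnit (k - 1) i A) =
        liftPartialDeriv hk L he i A w - momentum he (i - 1) A w) ∧
      momentum he (k - 1) A w = liftPartialDeriv hk L he k A w := by
  have h0 : equationForm he hk L (phaseCoord e he w) p (jetUnit k 0 A) =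
      liftPartialDeriv hk L he 0 A w - p (jetUnit (k - 1) 0 A) := by
    rw [equationForm_apply, shift_jetUnit_zero, truncate_jetUnit, liftPartialDeriv_eq he hk L 0 A hw,
      map_zero, sub_zero]
  have h1 : ∀ i, 1 ≤ i → equationForm he hk L (phaseCoord e he w) p (jetUnit k i A) =
      liftPartialDeriv hk L he i A w - momentum he (i - 1) A w - p (jetUnit (k - 1) i A) := by
    intro i hi
    obtain ⟨j, rfl⟩ := Nat.exists_eq_add_of_le' hi
    rw [equationForm_apply, shift_jetUnit_succ, truncate_jetUnit, liftPartialDeriv_eq he hk L _ A hw]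
    rfl
  have hlast : p (jetUnit (k - 1) k A) = 0 := by
    rw [jetUnit_of_lt (by omega), map_zero]
  constructor
  · intro h
    refine ⟨?_, fun i hi hi' => ?_, ?_⟩
    · have := h 0 (by omega); rw [h0] at this; linarith
    · have := h i (by omega); rw [h1 i hi] at this; linarith
    · have := h k le_rfl; rw [h1 k hk, hlast] at this; linarith
  · rintro ⟨ha, hb, hc⟩ i hi
    rcases Nat.eq_zero_or_pos i with rfl | hpos
    · rw [h0]; linarith
    · rw [h1 i hpos]
      rcases eq_or_lt_of_le hi with rfl | hlt
      · rw [hlast]; linarith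
      · rw [hb i hpos (by omega)]; ring

/-- The function `Ĉ - L̂` vanishes along a curve in `W_o`, hence so does its derivative. -/
theorem velocity_mem_tangentWo (hk : 1 ≤ k) {L : Jet π k → ℝ}
    (hL : ContMDiff 𝓘(ℝ, JetModel n k) 𝓘(ℝ, ℝ) ∞ L) {σ : ℝ → Phase π k} {t : ℝ}
    (hσ : ContMDiffAt 𝓘(ℝ, ℝ) (phaseModel n k) ∞ σ t)
    (hW : ∀ᶠ s in 𝓝 t, σ s ∈ hamiltonianSubmanifold hk L) : velocity σ t ∈ tangentWo hk L (σ t) := by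
  obtain ⟨e, he, hw⟩ := π.exists_adapted (rhoE (σ t))
  rw [mem_tangentWo_iff he hk hL hw]
  have h1 := (hasFDerivAt_hamiltonianCoord he hk hL hw).comp_hasDerivAt t
    (hasDerivAt_phaseCoord he hσ hw)
  have h2 : HasDerivAt (hamiltonianCoord he hk L ∘ fun s => phaseCoord e he (σ s)) 0 t := by
    refine (hasDerivAt_const t (0 : ℝ)).congr_of_eventuallyEq ?_
    filter_upwards [hW, hσ.continuousAt.preimage_mem_nhds
      ((isOpen_rhoE_source he).mem_nhds hw)] with s hs hs'
    rw [Function.comp, ← hamiltonianCoord_phaseCoord he hk L hs', sub_eq_zero]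
    exact hs
  exact h1.unique h2

theorem hasDerivAt_momentum (i : ℕ) (A : Fin n) {σ : ℝ → Phase π k} {t : ℝ}
    (hσ : ContMDiffAt 𝓘(ℝ, ℝ) (phaseModel n k) ∞ σ t) (hw : rhoE (σ t) ∈ e.source) :
    HasDerivAt (fun s => momentum he i A (σ s))
      ((vecCoord he (σ t) (velocity σ t)).2 (jetUnit (k - 1) i A)) t :=
  ((ContinuousLinearMap.apply ℝ ℝ (jetUnit (k - 1) i A)).comp (ContinuousLinearMap.snd ℝ
    (JetModel n (2 * k - 1)) _)).hasFDerivAt.comp_hasDerivAt t (hasDerivAt_phaseCoord he hσ hw)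

/-- The equivalence of the dynamical equation and its form in natural coordinates at a time. -/
theorem omega_velocity_eq_zero_iff (hk : 1 ≤ k) {L : Jet π k → ℝ}
    (hL : ContMDiff 𝓘(ℝ, JetModel n k) 𝓘(ℝ, ℝ) ∞ L)
    {ψ : ℝ → Phase π k} (hψ : IsSectionOn hk L ψ univ) (hol : IsHolonomicOn ψ univ) {t : ℝ}
    (hw : rhoE (ψ t) ∈ e.source) :
    (∀ v ∈ tangentWo hk L (ψ t), omega (ψ t) (velocity ψ t) v = 0) ↔
      ∀ A : Fin n,
        HasDerivAt (fun s => momentum he 0 A (ψ s)) (liftPartialDeriv hk L he 0 A (ψ t)) t ∧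
        (∀ i : ℕ, 1 ≤ i → i ≤ k - 1 → HasDerivAt (fun s => momentum he i A (ψ s))
          (liftPartialDeriv hk L he i A (ψ t) - momentum he (i - 1) A (ψ t)) t) ∧
        momentum he (k - 1) A (ψ t) = liftPartialDeriv hk L he k A (ψ t) := by
  have hs : ContMDiffAt 𝓘(ℝ, ℝ) (phaseModel n k) ∞ ψ t := hψ.1.contMDiffAt univ_mem
  have htr := truncate_velocity he isOpen_univ hψ.1 (fun t ht => (hψ.2 t ht).2) hol (mem_univ t) hw
    (show k - 1 ≤ 2 * k - 1 by omega) (show k - 1 + 1 ≤ 2 * k - 1 by omega)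
  have hut := velocity_mem_tangentWo hk hL hs (Eventually.of_forall fun s => (hψ.2 s (mem_univ s)).1)
  -- By uniqueness of derivatives the differential equations are equalities for the momentum part of
  -- the velocity.
  have hd : ∀ (i : ℕ) (A : Fin n) (c : ℝ), HasDerivAt (fun s => momentum he i A (ψ s)) c t ↔
      (vecCoord he (ψ t) (velocity ψ t)).2 (jetUnit (k - 1) i A) = c := fun i A c =>
    ⟨fun h => (hasDerivAt_momentum he i A hs hw).unique h,
      fun h => h ▸ hasDerivAt_momentum he i A hs hw⟩
  rw [omega_eq_zero_iff he hk hL hw htr hut]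
  simp only [hd]
  refine ⟨fun h A => (equationForm_jetUnit_eq_zero_iff he hk L hw _ A).1 fun i hi => h i hi A,
    fun h i hi A => (equationForm_jetUnit_eq_zero_iff he hk L hw _ A).2 (h A) i hi⟩

end Equations

/-! ### Vector fields on `W_o` by partitions of unity -/

section Fields

variable {n k : ℕ} {E : Type*} [TopologicalSpace E] [ChartedSpace (BaseModel n) E] {π : Fibred n E}
variable {e : OpenPartialHomeomorph E (BaseModel n)} (he : IsAdapted π.proj e)

theorem vecCoord_add_smul (w : Phase π k) (a b : ℝ) (u v : TangentSpace (phaseModel n k) w) :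
    vecCoord he w (a • u + b • v) = a • vecCoord he w u + b • vecCoord he w v :=
  ((mfderiv (phaseModel n k) 𝓘(ℝ, PhaseCoord n k) (phaseCoord e he) w).map_add _ _).trans
    (congrArg₂ (fun x y : PhaseCoord n k => x + y)
      ((mfderiv (phaseModel n k) 𝓘(ℝ, PhaseCoord n k) (phaseCoord e he) w).map_smul a u)
      ((mfderiv (phaseModel n k) 𝓘(ℝ, PhaseCoord n k) (phaseCoord e he) w).map_smul b v))

/-- Fields are glued on all of `W`, so tangency is imposed at every point, as membership in the
kernel of `d(Ĉ - L̂)`, and not only along `W_o`. -/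
theorem convex_tangentWo (hk : 1 ≤ k) (L : Jet π k → ℝ) (w : Phase π k) :
    Convex ℝ (tangentWo hk L w) := by
  intro u hu v hv a b _ _ _
  change mfderiv (phaseModel n k) 𝓘(ℝ, ℝ) _ w (a • u + b • v) = 0
  rw [map_add, map_smul, map_smul, hu, hv, smul_zero, smul_zero, add_zero]

theorem omega_swap (hk : 1 ≤ k) (w : Phase π k) (u v : TangentSpace (phaseModel n k) w) :
    omega w u v = -omega w v u := by
  obtain ⟨e, he, hw⟩ := π.exists_adapted (rhoE w)
  rw [omega_eq he hk hw, omega_eq he hk hw, neg_sub]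

theorem omega_add_smul_left (hk : 1 ≤ k) (w : Phase π k) (a b : ℝ)
    (u u' v : TangentSpace (phaseModel n k) w) :
    omega w (a • u + b • u') v = a * omega w u v + b * omega w u' v := by
  obtain ⟨e, he, hw⟩ := π.exists_adapted (rhoE w)
  have h : ∀ x x' y : PhaseCoord n k,
      y.2 (truncate (show k - 1 ≤ 2 * k - 1 by omega) (a • x + b • x').1) -
        (a • x + b • x').2 (truncate (show k - 1 ≤ 2 * k - 1 by omega) y.1) =
      a * (y.2 (truncate (show k - 1 ≤ 2 * k - 1 by omega) x.1) -
        x.2 (truncate (show k - 1 ≤ 2 * k - 1 by omega) y.1)) +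
      b * (y.2 (truncate (show k - 1 ≤ 2 * k - 1 by omega) x'.1) -
        x'.2 (truncate (show k - 1 ≤ 2 * k - 1 by omega) y.1)) := by
    intro x x' y
    simp only [Prod.fst_add, Prod.snd_add, Prod.smul_fst, Prod.smul_snd, map_add, map_smul,
      add_apply, smul_apply, smul_eq_mul]
    ring
  exact (omega_eq he hk hw _ v).trans ((congrArg (fun z : PhaseCoord n k =>
    (vecCoord he w v).2 (truncate (show k - 1 ≤ 2 * k - 1 by omega) z.1) -
      z.2 (truncate (show k - 1 ≤ 2 * k - 1 by omega) (vecCoord he w v).1))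
    (vecCoord_add_smul he w a b u u')).trans ((h _ _ _).trans (congrArg₂ (fun c d => a * c + b * d)
      (omega_eq he hk hw u v).symm (omega_eq he hk hw u' v).symm)))

/-- Adding a multiple of `∂/∂p` to make a vector tangent to `W_o`. -/
def correct (hk : 1 ≤ k) (L : Jet π k → ℝ) (x y : PhaseCoord n k) : PhaseCoord n k :=
  (y.1, y.2 - hamiltonianDeriv he hk L x y • ContinuousLinearMap.fst ℝ _ _)

theorem vecMk_correct_mem (hk : 1 ≤ k) {L : Jet π k → ℝ}
    (hL : ContMDiff 𝓘(ℝ, JetModel n k) 𝓘(ℝ, ℝ) ∞ L) {w : Phase π k} (hw : rhoE w ∈ e.source)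
    (y : PhaseCoord n k) :
    vecMk he w (correct he hk L (phaseCoord e he w) y) ∈ tangentWo hk L w := by
  rw [mem_tangentWo_iff he hk hL hw, vecCoord_vecMk he hw]
  rw [hamiltonianDeriv_apply, correct]
  simp only [sub_apply, smul_apply,
    ContinuousLinearMap.coe_fst', holonomicVelocity_fst, hamiltonianDeriv_apply, smul_eq_mul]
  ring

theorem contDiffAt_fderiv_localLagrangian (hk : 1 ≤ k) {L : Jet π k → ℝ}
    (hL : ContMDiff 𝓘(ℝ, JetModel n k) 𝓘(ℝ, ℝ) ∞ L) {x : PhaseCoord n k}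
    (hx : x.1 ∈ (jetChart (π := π) (2 * k - 1) e he).target) :
    ContDiffAt ℝ ∞ (fun x : PhaseCoord n k => fderiv ℝ (localLagrangian he L)
      (truncate (show k ≤ 2 * k - 1 by omega) x.1)) x := by
  have hz : truncate (show k ≤ 2 * k - 1 by omega) x.1 ∈ (jetChart (π := π) k e he).target :=
    truncate_mem_target he (show k ≤ 2 * k - 1 by omega) hx
  have h : ContDiffAt ℝ ∞ (fderiv ℝ (localLagrangian he L))
      (truncate (show k ≤ 2 * k - 1 by omega) x.1) :=
    (contDiffAt_localLagrangian he hL hz).fderiv_right (by simp)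
  exact ContDiffAt.comp x h ((truncate _).contDiff.comp contDiff_fst).contDiffAt

theorem contDiffAt_correct (hk : 1 ≤ k) {L : Jet π k → ℝ}
    (hL : ContMDiff 𝓘(ℝ, JetModel n k) 𝓘(ℝ, ℝ) ∞ L) {p : PhaseCoord n k × PhaseCoord n k}
    (hp : p.1.1 ∈ (jetChart (π := π) (2 * k - 1) e he).target) :
    ContDiffAt ℝ ∞ (fun p : PhaseCoord n k × PhaseCoord n k => correct he hk L p.1 p.2) p := by
  have h1 : ContDiffAt ℝ ∞ (fun p : PhaseCoord n k × PhaseCoord n k =>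
      fderiv ℝ (localLagrangian he L) (truncate (show k ≤ 2 * k - 1 by omega) p.1.1)) p :=
    ContDiffAt.comp (f := fun p : PhaseCoord n k × PhaseCoord n k => p.1) p
      (contDiffAt_fderiv_localLagrangian he hk hL hp) contDiffAt_fst
  have h2 : ContDiffAt ℝ ∞ (fun p : PhaseCoord n k × PhaseCoord n k =>
      holonomicVelocity (show k - 1 + 1 ≤ 2 * k - 1 by omega) p.1.1) p :=
    ((contDiff_holonomicVelocity _).comp (contDiff_fst.comp contDiff_fst)).contDiffAt
  have h3 : ContDiffAt ℝ ∞ (fun p : PhaseCoord n k × PhaseCoord n k =>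
      hamiltonianDeriv he hk L p.1 p.2) p := by
    simp only [hamiltonianDeriv_apply]
    refine ContDiffAt.add (ContDiffAt.clm_apply (by fun_prop) h2) (ContDiffAt.sub
      (ContDiffAt.clm_apply (by fun_prop) (by fun_prop)) (ContDiffAt.clm_apply h1 (by fun_prop)))
  exact ContDiffAt.prodMk (by fun_prop)
    (ContDiffAt.sub (by fun_prop) (h3.smul contDiffAt_const))

theorem contMDiffOn_vecMk_correct (hk : 1 ≤ k) {L : Jet π k → ℝ}
    (hL : ContMDiff 𝓘(ℝ, JetModel n k) 𝓘(ℝ, ℝ) ∞ L) {V : Phase π k → PhaseCoord n k}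
    {s : Set (Phase π k)} (hs : s ⊆ {w | rhoE w ∈ e.source})
    (hV : ContMDiffOn (phaseModel n k) 𝓘(ℝ, PhaseCoord n k) ∞ V s) :
    ContMDiffOn (phaseModel n k) (phaseModel n k).tangent ∞
      (fun w => (⟨w, vecMk he w (correct he hk L (phaseCoord e he w) (V w))⟩ :
        TangentBundle (phaseModel n k) (Phase π k))) s := by
  refine contMDiffOn_vecMk he hs fun w hw => ?_
  have h1 : ContMDiffWithinAt (phaseModel n k) 𝓘(ℝ, PhaseCoord n k × PhaseCoord n k) ∞
      (fun w => (phaseCoord e he w, V w)) s w :=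
    (contMDiffAt_phaseCoord he (hs hw)).contMDiffWithinAt.prodMk_space (hV w hw)
  exact (contDiffAt_correct he hk hL (p := (phaseCoord e he w, V w))
    (phaseCoord_mem_target he (hs hw))).contMDiffAt.comp_contMDiffWithinAt w h1

/-- A partition of unity averages local solutions, and convexity keeps the average a solution. A
prescribed value is admissible too, as a singleton is convex. -/
theorem exists_vectorField_mem_convex [T2Space E] [SecondCountableTopology E]
    (C : ∀ w : Phase π k, Set (TangentSpace (phaseModel n k) w)) (hC : ∀ w, Convex ℝ (C w))
    (hloc : ∀ w₀ : Phase π k, ∃ U ∈ 𝓝 w₀, ∃ X : ∀ w : Phase π k, TangentSpace (phaseModel n k) w,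
      ContMDiffOn (phaseModel n k) (phaseModel n k).tangent ∞
        (fun w => (⟨w, X w⟩ : TangentBundle (phaseModel n k) (Phase π k))) U ∧
      ∀ w ∈ U, X w ∈ C w) :
    ∃ X : ∀ w : Phase π k, TangentSpace (phaseModel n k) w,
      ContMDiff (phaseModel n k) (phaseModel n k).tangent ∞
        (fun w => (⟨w, X w⟩ : TangentBundle (phaseModel n k) (Phase π k))) ∧ ∀ w, X w ∈ C w :=
  (exists_contMDiffSection_forall_mem_convex_of_local (phaseModel n k) (n := ⊤)
    (F_fiber := JetModel n (2 * k - 1) × (JetModel n (k - 1) →L[ℝ] ℝ))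
    (fun w : Phase π k => TangentSpace (phaseModel n k) w) C hC hloc).elim
      fun Y hY => ⟨Y, Y.contMDiff, hY⟩

/-- A tangent vector of `W_o` extends to a vector field. -/
theorem exists_vectorField_extending [T2Space E] [SecondCountableTopology E] (hk : 1 ≤ k)
    {L : Jet π k → ℝ} (hL : ContMDiff 𝓘(ℝ, JetModel n k) 𝓘(ℝ, ℝ) ∞ L) {w₀ : Phase π k}
    {v : TangentSpace (phaseModel n k) w₀} (hv : v ∈ tangentWo hk L w₀) :
    ∃ Y : ∀ w : Phase π k, TangentSpace (phaseModel n k) w, IsVectorFieldWo hk L Y ∧ Y w₀ = v := by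
  -- At `w₀` the second factor prescribes the value `v`; at other points its intersection is over an
  -- empty index type and imposes nothing.
  have hloc : ∀ w : Phase π k, ∃ U ∈ 𝓝 w, ∃ X : ∀ w : Phase π k, TangentSpace (phaseModel n k) w,
      ContMDiffOn (phaseModel n k) (phaseModel n k).tangent ∞
        (fun w => (⟨w, X w⟩ : TangentBundle (phaseModel n k) (Phase π k))) U ∧
      ∀ w ∈ U, X w ∈ tangentWo hk L w ∩
        ⋂ h : w₀ = w, {(h ▸ v : TangentSpace (phaseModel n k) w)} := by
    intro w
    by_cases h : w = w₀
    · subst h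
      obtain ⟨e, he, hw⟩ := π.exists_adapted (rhoE w)
      -- The constant coordinates of `v`, made tangent; at `w` itself the correction is zero because
      -- `v` is already tangent.
      refine ⟨_, (isOpen_rhoE_source he).mem_nhds hw,
        fun w' => vecMk he w' (correct he hk L (phaseCoord e he w') (vecCoord he w v)),
        contMDiffOn_vecMk_correct he hk hL Subset.rfl contMDiffOn_const, fun w' hw' => ⟨?_, mem_iInter.2 ?_⟩⟩
      · exact vecMk_correct_mem he hk hL hw' _
      · rintro rfl
        have h1 := (mem_tangentWo_iff he hk hL hw v).1 hv
        change vecMk he w (correct he hk L (phaseCoord e he w) (vecCoord he w v)) = v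
        rw [correct, h1, zero_smul, sub_zero]
        exact vecMk_vecCoord he hw v
    · refine ⟨{w₀}ᶜ, isOpen_compl_singleton.mem_nhds h, fun w' => 0,
        (Bundle.contMDiff_zeroSection ℝ (fun w : Phase π k => TangentSpace (phaseModel n k) w)).contMDiffOn,
        fun w' hw' => ⟨?_, mem_iInter.2 fun h' => absurd h'.symm hw'⟩⟩
      exact map_zero (mfderiv (phaseModel n k) 𝓘(ℝ, ℝ) _ w')
  obtain ⟨Y, hY, hY'⟩ := exists_vectorField_mem_convex _
    (fun w => (convex_tangentWo hk L w).inter (convex_iInter fun _ => convex_singleton _)) hloc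
  exact ⟨Y, ⟨hY.contMDiffOn, fun w _ => (hY' w).1⟩, mem_iInter.1 (hY' w₀).2 rfl⟩

end Fields

/-! ### Holonomic vectors and local solutions of the equation -/

section Semispray

variable {n k : ℕ} {E : Type*} [TopologicalSpace E] [ChartedSpace (BaseModel n) E] {π : Fibred n E}
variable {e : OpenPartialHomeomorph E (BaseModel n)} (he : IsAdapted π.proj e)

/-- The tangent vectors of `W` which project to the velocity of `j^{2k-2} φ`, where the jet of `φ`
is the projection of the base point. -/
def IsHolonomicVector (w : Phase π k) (u : TangentSpace (phaseModel n k) w) : Prop :=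
  (show JetModel n (2 * k - 1 - 1) from
    mfderiv (phaseModel n k) 𝓘(ℝ, JetModel n (2 * k - 1 - 1))
      (fun w : Phase π k => Jet.proj (Nat.sub_le (2 * k - 1) 1) (rho1 w)) w u) =
    (mfderiv 𝓘(ℝ, ℝ) 𝓘(ℝ, JetModel n (2 * k - 1 - 1))
      (prolong π (2 * k - 1 - 1) (rho1 w).rep.map) (rhoR w) :
        ℝ →L[ℝ] JetModel n (2 * k - 1 - 1)) 1

/-- The derivative of the inverse jet chart is injective and cancels. What remains is an affine
condition on `u`, whence convexity. -/
theorem isHolonomicVector_iff (hk : 1 ≤ k) {w : Phase π k} (hw : rhoE w ∈ e.source)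
    (u : TangentSpace (phaseModel n k) w) : IsHolonomicVector w u ↔
      truncate (Nat.sub_le (2 * k - 1) 1) (vecCoord he w u).1 =
        holonomicVelocity (show 2 * k - 1 - 1 + 1 ≤ 2 * k - 1 by omega) (phaseCoord e he w).1 := by
  have hc := jetChart_mem_maximalAtlas (π := π) (2 * k - 1 - 1) he
  have hmem : Jet.proj (Nat.sub_le (2 * k - 1) 1) (rho1 w) ∈
      (jetChart (2 * k - 1 - 1) e he).source := by
    change (Jet.proj (Nat.sub_le (2 * k - 1) 1) (rho1 w)).point ∈ e.source
    rwa [point_proj]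
  set B : JetModel n (2 * k - 1 - 1) →L[ℝ] JetModel n (2 * k - 1 - 1) :=
    mfderiv 𝓘(ℝ, JetModel n (2 * k - 1 - 1)) 𝓘(ℝ, JetModel n (2 * k - 1 - 1))
      (jetChart (2 * k - 1 - 1) e he).symm (jetChart (2 * k - 1 - 1) e he
        (Jet.proj (Nat.sub_le (2 * k - 1) 1) (rho1 w))) with hB
  have hBinj : Function.Injective B := by
    refine Function.LeftInverse.injective (g := (mfderiv 𝓘(ℝ, JetModel n (2 * k - 1 - 1))
      𝓘(ℝ, JetModel n (2 * k - 1 - 1)) (jetChart (2 * k - 1 - 1) e he)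
        ((jetChart (2 * k - 1 - 1) e he).symm (jetChart (2 * k - 1 - 1) e he
        (Jet.proj (Nat.sub_le (2 * k - 1) 1) (rho1 w)))) :
          JetModel n (2 * k - 1 - 1) →L[ℝ] JetModel n (2 * k - 1 - 1))) fun v => ?_
    exact mfderiv_chart_chart_symm hc ((jetChart (2 * k - 1 - 1) e he).map_source hmem) v
  have hf : MDifferentiableAt (phaseModel n k) 𝓘(ℝ, JetModel n (2 * k - 1 - 1))
      (fun w : Phase π k => Jet.proj (Nat.sub_le (2 * k - 1) 1) (rho1 w)) w :=
    ((contMDiff_jetProj (Nat.sub_le (2 * k - 1) 1)).comp contMDiff_rho1 w).mdifferentiableAt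
      (by simp)
  have h1 := congrArg (fun T => T u) (mfderiv_comp w (mdifferentiableAt_chart hc hmem) hf)
  let g : PhaseCoord n k →L[ℝ] JetModel n (2 * k - 1 - 1) :=
    (truncate (Nat.sub_le (2 * k - 1) 1)).comp (ContinuousLinearMap.fst ℝ _ _)
  have h2 := mfderiv_comp_phaseCoord (w := w) he hw (g := g) g.differentiableAt
    (f := jetChart (2 * k - 1 - 1) e he ∘
      fun w : Phase π k => Jet.proj (Nat.sub_le (2 * k - 1) 1) (rho1 w)) (by
      filter_upwards [(isOpen_rhoE_source he).mem_nhds hw] with w' hw'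
      exact jetChart_proj (Nat.sub_le (2 * k - 1) 1) he hw') u
  rw [g.fderiv] at h2
  have h3 : (show JetModel n (2 * k - 1 - 1) from
      mfderiv (phaseModel n k) 𝓘(ℝ, JetModel n (2 * k - 1 - 1))
      (fun w : Phase π k => Jet.proj (Nat.sub_le (2 * k - 1) 1) (rho1 w)) w u) =
      B (truncate (Nat.sub_le (2 * k - 1) 1) (vecCoord he w u).1) :=
    (mfderiv_chart_symm_chart hc hmem _).symm.trans (congrArg B (h1.symm.trans h2))
  have h4 := mfderiv_prolong_rep he hw (show 2 * k - 1 - 1 + 1 ≤ 2 * k - 1 by omega)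
  unfold IsHolonomicVector
  rw [h3, h4]
  exact hBinj.eq_iff

theorem convex_isHolonomicVector (hk : 1 ≤ k) (w : Phase π k) :
    Convex ℝ {u : TangentSpace (phaseModel n k) w | IsHolonomicVector w u} := by
  obtain ⟨e, he, hw⟩ := π.exists_adapted (rhoE w)
  intro u hu v hv a b _ _ hab
  have hu' := (isHolonomicVector_iff he hk hw u).1 hu
  have hv' := (isHolonomicVector_iff he hk hw v).1 hv
  refine (isHolonomicVector_iff he hk hw _).2 ?_
  have h := congrArg (fun y : PhaseCoord n k => truncate (Nat.sub_le (2 * k - 1) 1) y.1)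
    (vecCoord_add_smul he w a b u v)
  refine h.trans ?_
  simp only [Prod.fst_add, Prod.smul_fst, map_add, map_smul]
  rw [hu', hv', ← add_smul, hab, one_smul]

/-- The holonomic velocity starts with `1`. So holonomic fields are transverse, and no
reparametrization intervenes for their integral sections. -/
theorem IsHolonomicVector.timeComponent (hk : 1 ≤ k)
    {X : ∀ w : Phase π k, TangentSpace (phaseModel n k) w} {w : Phase π k}
    (h : IsHolonomicVector w (X w)) : timeComponent X w = 1 := by
  obtain ⟨e, he, hw⟩ := π.exists_adapted (rhoE w)
  have h1 := congrArg Prod.fst ((isHolonomicVector_iff he hk hw _).1 h)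
  rw [holonomicVelocity_fst] at h1
  rw [timeComponent_eq he X hw]
  exact h1

theorem phaseCoord_snd_zero {w : Phase π k} (hw : rhoE w ∈ e.source) :
    (e (rhoE w)).2 = (phaseCoord e he w).1.2 0 := by
  rw [rhoE_eq he hw, e.right_inv (phaseCoord_mem_target he hw)]

/-- Integral sections of holonomic vector fields are holonomic. -/
theorem isHolonomicOn_of_velocity (hk : 1 ≤ k) {σ : ℝ → Phase π k} {s : Set ℝ} (hs : IsOpen s)
    (hσ : ContMDiffOn 𝓘(ℝ, ℝ) (phaseModel n k) ∞ σ s) (hR : ∀ t ∈ s, rhoR (σ t) = t)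
    (hv : ∀ t ∈ s, IsHolonomicVector (σ t) (velocity σ t)) : IsHolonomicOn σ s := by
  intro t ht
  obtain ⟨e, he, hw⟩ := π.exists_adapted (rhoE (σ t))
  have hsec := isSectionNear_rhoE hs hσ hR ht
  have hev : ∀ᶠ t' in 𝓝 t, t' ∈ s ∧ rhoE (σ t') ∈ e.source :=
    (hs.eventually_mem ht).and (hsec.eventually_mem hw)
  -- The condition on the velocity says `dq_i/dt = q_{i+1}` for `i ≤ 2k - 2`, so induction from `q_0
  -- = φ` identifies `q_i` with the `i`-th derivative of `φ`.
  have key : ∀ i (hi : i < 2 * k - 1 + 1),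
      iteratedDeriv i (fun t' => (e (rhoE (σ t'))).2) =ᶠ[𝓝 t]
        fun t' => (phaseCoord e he (σ t')).1.2 ⟨i, hi⟩ := by
    intro i
    induction i with
    | zero =>
      intro hi
      filter_upwards [hev] with t' ht'
      rw [iteratedDeriv_zero]
      exact phaseCoord_snd_zero he ht'.2
    | succ i ih =>
      intro hi
      rw [iteratedDeriv_succ]
      refine (ih (by omega)).deriv.trans ?_
      filter_upwards [hev] with t' ht'
      have h1 := hasDerivAt_phaseCoord he (hσ.contMDiffAt (hs.mem_nhds ht'.1)) ht'.2
      have h2 : HasDerivAt (fun t' => (phaseCoord e he (σ t')).1.2 ⟨i, by omega⟩)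
          ((vecCoord he (σ t') (velocity σ t')).1.2 ⟨i, by omega⟩) t' :=
        hasDerivAt_pi.1 h1.fst.snd ⟨i, by omega⟩
      have h3 := (isHolonomicVector_iff he hk ht'.2 _).1 (hv t' ht'.1)
      have h4 := congrFun (congrArg Prod.snd h3) ⟨i, by omega⟩
      rw [holonomicVelocity_snd] at h4
      rw [h2.deriv]
      exact h4
  have hsec_t : (prolong π (2 * k - 1) (fun t' => rhoE (σ t')) t) ∈
      (jetChart (2 * k - 1) e he).source := by
    rw [prolong_of hsec]
    exact hw
  refine (jetChart (2 * k - 1) e he).injOn hw hsec_t ?_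
  rw [jetChart_prolong he _ hsec hw]
  refine Prod.ext (hR t ht) (funext fun i => ?_)
  exact ((key i i.2).self_of_nhds).symm

theorem contMDiff_rhoR : ContMDiff (phaseModel n k) 𝓘(ℝ, ℝ) ∞ (rhoR : Phase π k → ℝ) := by
  intro w
  obtain ⟨e, he, hw⟩ := π.exists_adapted (rhoE w)
  have h1 : ContMDiffAt 𝓘(ℝ, PhaseCoord n k) 𝓘(ℝ, ℝ) ∞
      (fun x : PhaseCoord n k => x.1.1) (phaseCoord e he w) :=
    ContDiffAt.contMDiffAt (by fun_prop)
  exact h1.comp w (contMDiffAt_phaseCoord he hw)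

/-- The components of the local semisprays which solve the dynamical equation on `W_1`. -/
def localField (hk : 1 ≤ k) (L : Jet π k → ℝ) (x : PhaseCoord n k) (Q : Fin n → ℝ) :
    PhaseCoord n k :=
  ((1, fun i => if h : (i : ℕ) + 1 < 2 * k - 1 + 1 then x.1.2 ⟨i + 1, h⟩ else Q),
    (fderiv ℝ (localLagrangian he L) (truncate (show k ≤ 2 * k - 1 by omega) x.1) -
      x.2.comp (shift (show k - 1 + 1 ≤ k by omega))).comp (extendZero (k - 1) k))

theorem contDiffAt_localField (hk : 1 ≤ k) {L : Jet π k → ℝ}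
    (hL : ContMDiff 𝓘(ℝ, JetModel n k) 𝓘(ℝ, ℝ) ∞ L) {p : PhaseCoord n k × (Fin n → ℝ)}
    (hp : p.1.1 ∈ (jetChart (π := π) (2 * k - 1) e he).target) :
    ContDiffAt ℝ ∞ (fun p : PhaseCoord n k × (Fin n → ℝ) => localField he hk L p.1 p.2) p := by
  have h1 : ContDiffAt ℝ ∞ (fun p : PhaseCoord n k × (Fin n → ℝ) =>
      fderiv ℝ (localLagrangian he L) (truncate (show k ≤ 2 * k - 1 by omega) p.1.1)) p :=
    ContDiffAt.comp (f := fun p : PhaseCoord n k × (Fin n → ℝ) => p.1) p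
      (contDiffAt_fderiv_localLagrangian he hk hL hp) contDiffAt_fst
  refine ContDiffAt.prodMk (contDiffAt_const.prodMk (contDiffAt_pi.2 fun i => ?_))
    (ContDiffAt.clm_comp (h1.sub (ContDiffAt.clm_comp (by fun_prop) contDiffAt_const))
      contDiffAt_const)
  by_cases h : (i : ℕ) + 1 < 2 * k - 1 + 1
  · simp only [dif_pos h]; fun_prop
  · simp only [dif_neg h]; fun_prop

theorem truncate_localField (hk : 1 ≤ k) (L : Jet π k → ℝ) (x : PhaseCoord n k) (Q : Fin n → ℝ) :
    truncate (Nat.sub_le (2 * k - 1) 1) (localField he hk L x Q).1 =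
      holonomicVelocity (show 2 * k - 1 - 1 + 1 ≤ 2 * k - 1 by omega) x.1 := by
  refine Prod.ext (by simp [localField]) (funext fun i => ?_)
  rw [holonomicVelocity_snd, truncate_snd]
  have : (i : ℕ) + 1 < 2 * k - 1 + 1 := by omega
  simp only [localField]
  rw [dif_pos this]

/-- Holonomy leaves only the last jet component free, and that is the parameter `Q`. -/
theorem eq_localField_fst (hk : 1 ≤ k) (L : Jet π k → ℝ) (x : PhaseCoord n k)
    {z : JetModel n (2 * k - 1)} (hz : truncate (Nat.sub_le (2 * k - 1) 1) z =
      holonomicVelocity (show 2 * k - 1 - 1 + 1 ≤ 2 * k - 1 by omega) x.1) :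
    z = (localField he hk L x (z.2 (Fin.last _))).1 := by
  refine Prod.ext ?_ (funext fun i => ?_)
  · have := congrArg Prod.fst hz
    rw [holonomicVelocity_fst] at this
    exact this
  · simp only [localField]
    split_ifs with h
    · have := congrFun (congrArg Prod.snd hz) ⟨i, by omega⟩
      rw [holonomicVelocity_snd] at this
      exact this
    · exact congrArg z.2 (Fin.ext (by rw [Fin.val_last]; omega))

theorem extendZero_jetUnit {r s i : ℕ} (hi : i ≤ r) (A : Fin n) :
    extendZero r s (jetUnit r i A) = jetUnit s i A := by
  refine Prod.ext rfl (funext fun j => ?_)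
  rw [extendZero_snd]
  split_ifs with h
  · rfl
  · funext B
    simp only [jetUnit]
    rw [if_neg (by omega)]
    rfl

/-- The momentum part of `localField` was chosen to solve the equations of order `i ≤ k - 1`, for
every `Q` and without any constraint on the point. Correcting by a multiple of `dt` is invisible to
`∂/∂q_i^A`. -/
theorem equationForm_localField (hk : 1 ≤ k) (L : Jet π k → ℝ) (x y : PhaseCoord n k)
    (Q : Fin n → ℝ) {i : ℕ} (hi : i ≤ k - 1) (A : Fin n) :
    equationForm he hk L x ((localField he hk L x Q).2 -
      hamiltonianDeriv he hk L x y • ContinuousLinearMap.fst ℝ _ _) (jetUnit k i A) = 0 := by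
  rw [equationForm_apply, truncate_jetUnit]
  simp only [localField, sub_apply, smul_apply, ContinuousLinearMap.comp_apply,
    ContinuousLinearMap.coe_fst', smul_eq_mul]
  rw [extendZero_jetUnit hi]
  simp [jetUnit]

/-- For `r = k` the sum has the single term `i = 0`, without total derivative. This line is all that
the equation for the field uses of `W_1`. -/
theorem partialDeriv_constraint (hk : 1 ≤ k) {L : Jet π k → ℝ} {w : Phase π k}
    (hw : rhoE w ∈ e.source) (h : w ∈ legendreGraph hk L) (A : Fin n) :
    momentum he (k - 1) A w = liftPartialDeriv hk L he k A w := by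
  have h1 := h.2 e he hw k hk le_rfl A
  simp only [Nat.sub_self, zero_add, Finset.sum_range_one, pow_zero, one_mul, iteratedDeriv_zero,
    add_zero] at h1
  rw [prolong_rep (show k ≤ 2 * k - 1 by omega)] at h1
  exact h1

/-- The equations for `i ≤ k - 1` hold by construction and the one for `i = k` is the constraint,
which holds on `W_1`. None of them involves `Q`. -/
theorem omega_localField (hk : 1 ≤ k) {L : Jet π k → ℝ}
    (hL : ContMDiff 𝓘(ℝ, JetModel n k) 𝓘(ℝ, ℝ) ∞ L) {w : Phase π k} (hw : rhoE w ∈ e.source)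
    (h : w ∈ legendreGraph hk L) (Q : Fin n → ℝ) {v : TangentSpace (phaseModel n k) w}
    (hv : v ∈ tangentWo hk L w) :
    omega w (vecMk he w (correct he hk L (phaseCoord e he w)
      (localField he hk L (phaseCoord e he w) Q))) v = 0 := by
  set x := phaseCoord e he w with hx
  set u := vecMk he w (correct he hk L x (localField he hk L x Q)) with hu
  have hu1 : vecCoord he w u = correct he hk L x (localField he hk L x Q) := vecCoord_vecMk he hw _
  refine (omega_eq_zero_iff he hk hL hw ?_ (vecMk_correct_mem he hk hL hw _)).2 ?_ v hv
  · rw [← hu, hu1]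
    have := congrArg (truncate (show k - 1 ≤ 2 * k - 1 - 1 by omega))
      (truncate_localField he hk L x Q)
    exact this
  · intro i hi A
    rw [← hu, hu1]
    rcases Nat.lt_or_ge (k - 1) i with hlt | hle
    · obtain rfl : i = k := by omega
      rw [equationForm_apply, truncate_jetUnit, jetUnit_of_lt hlt, map_zero, sub_zero,
        ← liftPartialDeriv_eq he hk L _ A hw, ← partialDeriv_constraint he hk hw h A]
      obtain ⟨j, rfl⟩ := Nat.exists_eq_add_of_le' hk
      rw [shift_jetUnit_succ]
      exact sub_self _
    · exact equationForm_localField he hk L x _ Q hle A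

/-- Holonomy fixes the jet part up to `Q`, the equations fix the momentum part on `∂/∂q_i^A`, and
tangency fixes it on the holonomic velocity. So a solution vector, in particular `ψ'`, is a value of
the local field once `Q` is read off it. -/
theorem eq_vecMk_localField (hk : 1 ≤ k) {L : Jet π k → ℝ}
    (hL : ContMDiff 𝓘(ℝ, JetModel n k) 𝓘(ℝ, ℝ) ∞ L) {w : Phase π k} (hw : rhoE w ∈ e.source)
    {u : TangentSpace (phaseModel n k) w} (hut : u ∈ tangentWo hk L w) (hu : IsHolonomicVector w u)
    (hu0 : ∀ v ∈ tangentWo hk L w, omega w u v = 0) :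
    u = vecMk he w (correct he hk L (phaseCoord e he w)
      (localField he hk L (phaseCoord e he w) ((vecCoord he w u).1.2 (Fin.last _)))) := by
  set x := phaseCoord e he w with hx
  set y := vecCoord he w u with hy
  set Q := y.1.2 (Fin.last _) with hQ
  have htr := (isHolonomicVector_iff he hk hw u).1 hu
  have h1 : y.1 = (localField he hk L x Q).1 := eq_localField_fst he hk L x htr
  have htr' : truncate (show k - 1 ≤ 2 * k - 1 by omega) y.1 =
      holonomicVelocity (show k - 1 + 1 ≤ 2 * k - 1 by omega) x.1 :=
    congrArg (truncate (show k - 1 ≤ 2 * k - 1 - 1 by omega)) htr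
  have h2 := (omega_eq_zero_iff he hk hL hw htr' hut).1 hu0
  have h3 := (mem_tangentWo_iff he hk hL hw u).1 hut
  have h4 := (mem_tangentWo_iff he hk hL hw _).1
    (vecMk_correct_mem he hk hL hw (localField he hk L x Q))
  rw [vecCoord_vecMk he hw] at h4
  have h5 : y.2 - (correct he hk L x (localField he hk L x Q)).2 = 0 := by
    refine clm_eq_zero (υ := holonomicVelocity (show k - 1 + 1 ≤ 2 * k - 1 by omega) x.1) ?_
      (holonomicVelocity_fst _ _) ?_
    · intro i hi A
      have h6 := h2 i (by omega) A
      have h7 := equationForm_localField he hk L x (localField he hk L x Q) Q hi A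
      rw [equationForm_apply, truncate_jetUnit] at h6 h7
      rw [sub_apply]
      simp only [correct]
      linarith
    · rw [hamiltonianDeriv_apply] at h3 h4
      rw [sub_apply]
      have h8 : (correct he hk L x (localField he hk L x Q)).1 = y.1 := h1.symm
      rw [h8] at h4
      linarith
  rw [← vecMk_vecCoord he hw u]
  congr 1
  exact Prod.ext h1 (sub_eq_zero.1 h5)

end Semispray

/-! ### Existence of a semispray through the given solution -/

section Existence

variable {n k : ℕ} {E : Type*} [TopologicalSpace E] [ChartedSpace (BaseModel n) E] {π : Fibred n E}
variable {e : OpenPartialHomeomorph E (BaseModel n)} (he : IsAdapted π.proj e)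

/-- The last component of the velocity of a section extends locally to a function on `W`. -/
theorem exists_extension_velocity [T2Space E] {ψ : ℝ → Phase π k}
    (hψ : ContMDiff 𝓘(ℝ, ℝ) (phaseModel n k) ∞ ψ) (hR : ∀ t, rhoR (ψ t) = t) {w : Phase π k}
    (hw : rhoE w ∈ e.source) :
    ∃ U ∈ 𝓝 w, U ⊆ {w | rhoE w ∈ e.source} ∧ ∃ Q : Phase π k → Fin n → ℝ,
      ContMDiffOn (phaseModel n k) 𝓘(ℝ, Fin n → ℝ) ∞ Q U ∧ ∀ t, ψ t ∈ U →
        Q (ψ t) = (vecCoord he (ψ t) (velocity ψ t)).1.2 (Fin.last _) := by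
  have hcR : Continuous (rhoR : Phase π k → ℝ) := (contMDiff_rhoR (n := n)).continuous
  -- This equation describes the image of the section, a closed set. At its points `Q` is made
  -- constant on the fibres of `ρ_ℝ`, with the value given by `ψ'` at that time; around other points
  -- there is nothing to extend.
  by_cases h : ψ (rhoR w) = w
  -- The second factor keeps `ψ (rhoR w)` in the chart, so that its coordinates are smooth in `w`.
  · set U : Set (Phase π k) := {w | rhoE w ∈ e.source} ∩ (fun w => ψ (rhoR w)) ⁻¹' {w | rhoE w ∈ e.source}
    have hU : IsOpen U := (isOpen_rhoE_source he).inter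
      ((isOpen_rhoE_source he).preimage (hψ.continuous.comp hcR))
    refine ⟨U, hU.mem_nhds ⟨hw, by change rhoE (ψ (rhoR w)) ∈ e.source; rwa [h]⟩, inter_subset_left,
      fun w' => (deriv (fun s => phaseCoord e he (ψ s)) (rhoR w')).1.2 (Fin.last _), ?_, ?_⟩
    · intro w' hw'
      have h1 : ContDiffAt ℝ ∞ (fun s => phaseCoord e he (ψ s)) (rhoR w') :=
        ((contMDiffAt_phaseCoord he hw'.2).comp (rhoR w') (hψ _)).contDiffAt
      have h2 : ContDiffAt ℝ ∞ (fun t => (deriv (fun s => phaseCoord e he (ψ s)) t).1.2 (Fin.last _))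
          (rhoR w') := by
        have h3 := contDiffAt_iteratedDeriv h1 1
        rw [iteratedDeriv_one] at h3
        exact contDiffAt_pi.1 h3.fst.snd (Fin.last _)
      exact (h2.contMDiffAt.comp w' (contMDiff_rhoR w')).contMDiffWithinAt
    · intro t ht
      have h1 := (hasDerivAt_phaseCoord he (hψ t) ht.1).deriv
      simp only [hR]
      rw [h1]
  · have hcl : IsOpen {w : Phase π k | ψ (rhoR w) ≠ w} :=
      isOpen_ne_fun (hψ.continuous.comp hcR) continuous_id
    refine ⟨{w | rhoE w ∈ e.source} ∩ {w | ψ (rhoR w) ≠ w},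
      ((isOpen_rhoE_source he).inter hcl).mem_nhds ⟨hw, h⟩, inter_subset_left, fun _ => 0,
      contMDiffOn_const, fun t ht => absurd ?_ ht.2⟩
    rw [hR]

theorem convex_omega_eq_zero (hk : 1 ≤ k) (L : Jet π k → ℝ) (w : Phase π k) :
    Convex ℝ {u : TangentSpace (phaseModel n k) w | ∀ v ∈ tangentWo hk L w, omega w u v = 0} := by
  intro u hu u' hu' a b _ _ _ v hv
  refine (omega_add_smul_left hk w a b u u' v).trans ?_
  rw [hu v hv, hu' v hv, mul_zero, mul_zero, add_zero]

theorem isHolonomicVector_velocity (hk : 1 ≤ k) {σ : ℝ → Phase π k} {s : Set ℝ} (hs : IsOpen s)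
    (hσ : ContMDiffOn 𝓘(ℝ, ℝ) (phaseModel n k) ∞ σ s) (hR : ∀ t ∈ s, rhoR (σ t) = t)
    (hol : IsHolonomicOn σ s) {t : ℝ} (ht : t ∈ s) : IsHolonomicVector (σ t) (velocity σ t) := by
  obtain ⟨e, he, hw⟩ := π.exists_adapted (rhoE (σ t))
  exact (isHolonomicVector_iff he hk hw _).2 (truncate_velocity he hs hσ hR hol ht hw _ _)

/-- A linear map on `ℝ` is determined by its value at `1`; this turns a velocity into the derivative
demanded of integral curves. -/
theorem hasMFDerivAt_of_velocity {σ : ℝ → Phase π k} {t : ℝ}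
    (hσ : MDifferentiableAt 𝓘(ℝ, ℝ) (phaseModel n k) σ t) {u : TangentSpace (phaseModel n k) (σ t)}
    (hu : u = velocity σ t) :
    HasMFDerivAt 𝓘(ℝ, ℝ) (phaseModel n k) σ t ((1 : ℝ →L[ℝ] ℝ).smulRight u) := by
  subst hu
  have h : ∀ T : ℝ →L[ℝ] JetModel n (2 * k - 1) × (JetModel n (k - 1) →L[ℝ] ℝ),
      T = (1 : ℝ →L[ℝ] ℝ).smulRight (T 1) := fun T => ContinuousLinearMap.ext_ring (by simp)
  exact hσ.hasMFDerivAt.congr_mfderiv (h _)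

/-- A holonomic section which solves the dynamical equation is an integral curve of a semispray
which solves the equation on `W_1`. -/
theorem exists_semispray [T2Space E] [SecondCountableTopology E] (hk : 1 ≤ k) {L : Jet π k → ℝ}
    (hL : ContMDiff 𝓘(ℝ, JetModel n k) 𝓘(ℝ, ℝ) ∞ L)
    {ψ : ℝ → Phase π k} (hψ : IsSectionOn hk L ψ univ) (hol : IsHolonomicOn ψ univ)
    (heq : ∀ t : ℝ, ∀ v ∈ tangentWo hk L (ψ t), omega (ψ t) (velocity ψ t) v = 0) :
    ∃ X : ∀ w : Phase π k, TangentSpace (phaseModel n k) w, IsVectorFieldWo hk L X ∧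
      IsTransverse hk L X ∧ IsSemispray hk L X ∧
      (∀ w ∈ legendreGraph hk L, ∀ v ∈ tangentWo hk L w, omega w (X w) v = 0) ∧
      IsMIntegralCurve ψ X := by
  have hs : ContMDiff 𝓘(ℝ, ℝ) (phaseModel n k) ∞ ψ := contMDiffOn_univ.1 hψ.1
  have hR : ∀ t, rhoR (ψ t) = t := fun t => (hψ.2 t (mem_univ t)).2
  have hhol : ∀ t, IsHolonomicVector (ψ t) (velocity ψ t) := fun t =>
    isHolonomicVector_velocity hk isOpen_univ hψ.1 (fun t _ => hR t) hol (mem_univ t)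
  have htan : ∀ t, velocity ψ t ∈ tangentWo hk L (ψ t) := fun t =>
    velocity_mem_tangentWo hk hL (hs t) (Eventually.of_forall fun s => (hψ.2 s (mem_univ s)).1)
  -- Four convex conditions: tangency, holonomy, the equation if `w ∈ W_1`, and the value `ψ'` if
  -- `w` lies on the curve. The last two impose nothing at other points.
  have hloc : ∀ w : Phase π k, ∃ U ∈ 𝓝 w, ∃ X : ∀ w : Phase π k, TangentSpace (phaseModel n k) w,
      ContMDiffOn (phaseModel n k) (phaseModel n k).tangent ∞
        (fun w => (⟨w, X w⟩ : TangentBundle (phaseModel n k) (Phase π k))) U ∧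
      ∀ w ∈ U, X w ∈ tangentWo hk L w ∩
        ({u : TangentSpace (phaseModel n k) w | IsHolonomicVector w u} ∩
        ((⋂ _ : w ∈ legendreGraph hk L,
          {u : TangentSpace (phaseModel n k) w | ∀ v ∈ tangentWo hk L w, omega w u v = 0}) ∩
        ⋂ t, ⋂ h : ψ t = w, {(h ▸ velocity ψ t : TangentSpace (phaseModel n k) w)})) := by
    intro w
    obtain ⟨e, he, hw⟩ := π.exists_adapted (rhoE w)
    obtain ⟨U, hU, hUe, Q, hQ, hQψ⟩ := exists_extension_velocity he hs hR hw
    refine ⟨U, hU, fun w => vecMk he w (correct he hk L (phaseCoord e he w)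
      (localField he hk L (phaseCoord e he w) (Q w))), ?_, fun w' hw' => ⟨?_, ?_, ?_, ?_⟩⟩
    · refine contMDiffOn_vecMk_correct he hk hL hUe fun w' hw' => ?_
      have h1 : ContMDiffWithinAt (phaseModel n k) 𝓘(ℝ, PhaseCoord n k × (Fin n → ℝ)) ∞
          (fun w => (phaseCoord e he w, Q w)) U w' :=
        (contMDiffAt_phaseCoord he (hUe hw')).contMDiffWithinAt.prodMk_space (hQ w' hw')
      exact (contDiffAt_localField he hk hL (p := (phaseCoord e he w', Q w'))
        (phaseCoord_mem_target he (hUe hw'))).contMDiffAt.comp_contMDiffWithinAt w' h1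
    · exact vecMk_correct_mem he hk hL (hUe hw') _
    · refine (isHolonomicVector_iff he hk (hUe hw') _).2 ?_
      rw [vecCoord_vecMk he (hUe hw')]
      exact truncate_localField he hk L _ _
    · exact mem_iInter.2 fun h v hv => omega_localField he hk hL (hUe hw') h _ hv
    · refine mem_iInter.2 fun t => mem_iInter.2 fun h => ?_
      subst h
      change vecMk he (ψ t) (correct he hk L (phaseCoord e he (ψ t))
        (localField he hk L (phaseCoord e he (ψ t)) (Q (ψ t)))) = velocity ψ t
      -- On the curve `Q` is the top component of `ψ'`, and this singles out `ψ'` among the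
      -- solutions.
      rw [hQψ t hw']
      exact (eq_vecMk_localField he hk hL (hUe hw') (htan t) (hhol t) (heq t)).symm
  obtain ⟨X, hX, hX'⟩ := exists_vectorField_mem_convex _
    (fun w => (convex_tangentWo hk L w).inter ((convex_isHolonomicVector hk w).inter
      ((convex_iInter fun _ => convex_omega_eq_zero hk L w).inter
        (convex_iInter fun _ => convex_iInter fun _ => convex_singleton _)))) hloc
  have htime : ∀ w, timeComponent X w = 1 := fun w =>
    IsHolonomicVector.timeComponent hk (hX' w).2.1
  refine ⟨X, ⟨hX.contMDiffOn, fun w _ => (hX' w).1⟩, fun w _ => ?_, ?_,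
    fun w hw v hv => mem_iInter.1 (hX' w).2.2.1 hw v hv, fun t => ?_⟩
  · rw [htime]; exact one_ne_zero
  · intro a b σ hσ hint
    refine isHolonomicOn_of_velocity hk isOpen_Ioo hσ.1 (fun t ht => (hσ.2 t ht).2) fun t ht => ?_
    -- The time component of `X` is `1`, so the velocity of `σ` equals the holonomic vector `X (σ
    -- t)`.
    exact (congrArg (IsHolonomicVector (σ t)) ((hint t ht).trans
      ((congrArg (fun c : ℝ => c • velocity σ t) (htime (σ t))).trans (one_smul ℝ _)))).mp
        (hX' (σ t)).2.1
  · have h1 : X (ψ t) = velocity ψ t := mem_iInter.1 (mem_iInter.1 (hX' (ψ t)).2.2.2 t) rfl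
    exact hasMFDerivAt_of_velocity ((hs t).mdifferentiableAt (by simp)) h1

end Existence

/-- Each derivative raises the order of every entry by one. The equality is stated near `t` so that
the induction can differentiate it again. -/
theorem iteratedDeriv_jetCurve {X : Type*} [NormedAddCommGroup X] [NormedSpace ℝ X] {f : ℝ → X}
    {t : ℝ} (hf : ContDiffAt ℝ ∞ f t) (k j : ℕ) :
    iteratedDeriv j (fun s => fun m : Fin (k + 1) => iteratedDeriv m f s) =ᶠ[𝓝 t]
      fun s => fun m : Fin (k + 1) => iteratedDeriv (m + j) f s := by
  induction j with
  | zero => exact Eventually.of_forall fun s => by simp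
  | succ j ih =>
    rw [iteratedDeriv_succ]
    refine ih.deriv.trans ?_
    have h : ∀ᶠ s in 𝓝 t, ∀ m : Fin (k + 1), ContDiffAt ℝ 1 (iteratedDeriv (m + j) f) s :=
      eventually_all.2 fun m => ((contDiffAt_iteratedDeriv hf (m + j)).of_le
        (by exact_mod_cast le_top)).eventually (by simp)
    filter_upwards [h] with s hs
    refine (hasDerivAt_pi.2 fun m => ?_).deriv
    rw [← add_assoc, iteratedDeriv_succ]
    exact ((hs m).differentiableAt (by simp)).hasDerivAt

/-! ### Solutions lie in the graph of the Legendre–Ostrogradsky map -/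

section Legendre

variable {n k : ℕ} {E : Type*} [TopologicalSpace E] [ChartedSpace (BaseModel n) E] {π : Fibred n E}
variable {e : OpenPartialHomeomorph E (BaseModel n)} (he : IsAdapted π.proj e)

theorem jetChart_prolong_mem_target (r : ℕ) {φ : ℝ → E} {t : ℝ} (h : IsSectionNear π φ t)
    (ht : φ t ∈ e.source) : jetChart r e he (prolong π r φ t) ∈ (jetChart (π := π) r e he).target := by
  refine (jetChart r e he).map_source ?_
  rw [prolong_of h]
  exact ht

theorem contDiffAt_fderiv_apply_jetUnit {L : Jet π k → ℝ}
    (hL : ContMDiff 𝓘(ℝ, JetModel n k) 𝓘(ℝ, ℝ) ∞ L) {z : JetModel n k}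
    (hz : z ∈ (jetChart (π := π) k e he).target) (m : ℕ) (A : Fin n) :
    ContDiffAt ℝ ∞ (fun z => fderiv ℝ (localLagrangian he L) z (jetUnit k m A)) z := by
  have h : ContDiffAt ℝ ∞ (fderiv ℝ (localLagrangian he L)) z :=
    (contDiffAt_localLagrangian he hL hz).fderiv_right (by simp)
  exact h.clm_apply contDiffAt_const

theorem contDiffAt_partialDeriv_prolong {L : Jet π k → ℝ}
    (hL : ContMDiff 𝓘(ℝ, JetModel n k) 𝓘(ℝ, ℝ) ∞ L) (m : ℕ) (A : Fin n) {φ : ℝ → E} {t : ℝ}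
    (h : IsSectionNear π φ t) (ht : φ t ∈ e.source) :
    ContDiffAt ℝ ∞ (fun s => partialDeriv L he m A (prolong π k φ s)) t :=
  ContDiffAt.comp (f := fun s => jetChart k e he (prolong π k φ s)) t
    (contDiffAt_fderiv_apply_jetUnit he hL (jetChart_prolong_mem_target he k h ht) m A)
    (contDiffAt_jetChart_prolong he k h ht)

/-- The total derivatives of a function on `J^k π` of order at most `r - k` only depend on the
`r`-jet. -/
theorem iteratedDeriv_partialDeriv_congr {L : Jet π k → ℝ}
    (hL : ContMDiff 𝓘(ℝ, JetModel n k) 𝓘(ℝ, ℝ) ∞ L) (m : ℕ) (A : Fin n) {φ χ : ℝ → E} {t : ℝ}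
    (hφ : IsSectionNear π φ t) (hχ : IsSectionNear π χ t) (hφt : φ t ∈ e.source)
    (hχt : χ t ∈ e.source) {r i : ℕ} (hi : i + k ≤ r) (hjet : prolong π r φ t = prolong π r χ t) :
    iteratedDeriv i (fun s => partialDeriv L he m A (prolong π k φ s)) t =
      iteratedDeriv i (fun s => partialDeriv L he m A (prolong π k χ s)) t := by
  have hd : ∀ j ≤ r, iteratedDeriv j (fun s => (e (φ s)).2) t =
      iteratedDeriv j (fun s => (e (χ s)).2) t := by
    intro j hj
    have h := congrArg (jetChart r e he) hjet
    rw [jetChart_prolong he r hφ hφt, jetChart_prolong he r hχ hχt] at h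
    exact congrFun (congrArg Prod.snd h) ⟨j, by omega⟩
  have hcurve : ∀ {φ : ℝ → E}, IsSectionNear π φ t → φ t ∈ e.source → ∀ j,
      iteratedDeriv j (fun s => jetChart k e he (prolong π k φ s)) t =
        (iteratedDeriv j (fun s : ℝ => s) t,
          fun m : Fin (k + 1) => iteratedDeriv (m + j) (fun s => (e (φ s)).2) t) := by
    intro φ hφ hφt j
    have h1 : (fun s => jetChart k e he (prolong π k φ s)) =ᶠ[𝓝 t]
        fun s => (s, fun i : Fin (k + 1) => iteratedDeriv i (fun s => (e (φ s)).2) s) := by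
      filter_upwards [hφ.eventually, hφ.eventually_mem hφt] with s hs hs'
      exact jetChart_prolong he k hs hs'
    have h2 : ContDiffAt ℝ ∞ (fun s => (e (φ s)).2) t := (contDiffAt_of_isSectionNear he hφ hφt).snd
    rw [h1.iteratedDeriv_eq j, iteratedDeriv_pair (u := fun s : ℝ => s)
      (v := fun s => fun i : Fin (k + 1) => iteratedDeriv i (fun s => (e (φ s)).2) s) contDiffAt_id
      (contDiffAt_pi.2 fun i : Fin (k + 1) => contDiffAt_iteratedDeriv h2 i)]
    exact Prod.ext rfl (iteratedDeriv_jetCurve h2 k j).self_of_nhds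
  refine iteratedDeriv_comp_congr i
    (fun z => fderiv ℝ (localLagrangian he L) z (jetUnit k m A))
    (fun s => jetChart k e he (prolong π k φ s)) (fun s => jetChart k e he (prolong π k χ s)) t
    (contDiffAt_fderiv_apply_jetUnit he hL (jetChart_prolong_mem_target he k hφ hφt) m A)
    (contDiffAt_jetChart_prolong he k hφ hφt) (contDiffAt_jetChart_prolong he k hχ hχt) ?_
  intro j hj
  rw [hcurve hφ hφt, hcurve hχ hχt]
  -- The order is `m + j ≤ k + i ≤ r`, within the reach of the common jet.
  exact Prod.ext rfl (funext fun m => hd _ (by omega))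

theorem liftPartialDeriv_of_holonomic (hk : 1 ≤ k) (L : Jet π k → ℝ) (m : ℕ) (A : Fin n)
    {ψ : ℝ → Phase π k} (hol : IsHolonomicOn ψ univ) {t : ℝ}
    (hsec : IsSectionNear π (fun t' => rhoE (ψ t')) t) :
    liftPartialDeriv hk L he m A (ψ t) =
      partialDeriv L he m A (prolong π k (fun t' => rhoE (ψ t')) t) := by
  unfold liftPartialDeriv
  rw [hol t (mem_univ t), prolong_of hsec, prolong_of hsec, LocalSection.proj_jet]

/-- The momenta of a solution of the equations in natural coordinates are those of Ostrogradsky. -/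
theorem momentum_eq_sum (hk : 1 ≤ k) {L : Jet π k → ℝ}
    (hL : ContMDiff 𝓘(ℝ, JetModel n k) 𝓘(ℝ, ℝ) ∞ L) {ψ : ℝ → Phase π k}
    (hsec : ∀ t, IsSectionNear π (fun t' => rhoE (ψ t')) t) (hol : IsHolonomicOn ψ univ) (A : Fin n)
    (heq : ∀ t : ℝ, rhoE (ψ t) ∈ e.source →
      (∀ i : ℕ, 1 ≤ i → i ≤ k - 1 → HasDerivAt (fun s => momentum he i A (ψ s))
        (liftPartialDeriv hk L he i A (ψ t) - momentum he (i - 1) A (ψ t)) t) ∧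
      momentum he (k - 1) A (ψ t) = liftPartialDeriv hk L he k A (ψ t)) (j : ℕ) :
    ∀ r, 1 ≤ r → r + j = k → ∀ t, rhoE (ψ t) ∈ e.source → momentum he (r - 1) A (ψ t) =
      ∑ i ∈ Finset.range (j + 1), (-1) ^ i * iteratedDeriv i
        (fun s => partialDeriv L he (r + i) A (prolong π k (fun t' => rhoE (ψ t')) s)) t := by
  -- Here `r = k - j` descends from `k`: the constraint gives `p^{k-1}`, and the equation for `p^r`
  -- gives `p^{r-1} = ∂L/∂q_r - dp^r/dt`.
  induction j with
  | zero =>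
    intro r _ hrk t ht
    obtain rfl : r = k := hrk
    rw [(heq t ht).2, liftPartialDeriv_of_holonomic he hk L _ A hol (hsec t)]
    simp
  | succ j ih =>
    intro r hr hrk t ht
    have h1 := (heq t ht).1 r hr (by omega)
    rw [liftPartialDeriv_of_holonomic he hk L _ A hol (hsec t)] at h1
    have h2 : HasDerivAt (fun t => ∑ i ∈ Finset.range (j + 1), (-1) ^ i * iteratedDeriv i
        (fun s => partialDeriv L he (r + 1 + i) A (prolong π k (fun t' => rhoE (ψ t')) s)) t)
        (∑ i ∈ Finset.range (j + 1), (-1) ^ i * iteratedDeriv (i + 1)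
        (fun s => partialDeriv L he (r + 1 + i) A (prolong π k (fun t' => rhoE (ψ t')) s)) t) t := by
      refine HasDerivAt.fun_sum fun i _ => HasDerivAt.const_mul _ ?_
      rw [iteratedDeriv_succ]
      exact ((contDiffAt_iteratedDeriv (contDiffAt_partialDeriv_prolong he hL (r + 1 + i) A
        (hsec t) ht) i).differentiableAt (by simp)).hasDerivAt
    -- The induction hypothesis holds at all times near `t`, hence may be differentiated.
    have h3 : (fun s => momentum he r A (ψ s)) =ᶠ[𝓝 t] fun t => ∑ i ∈ Finset.range (j + 1),
        (-1) ^ i * iteratedDeriv i (fun s => partialDeriv L he (r + 1 + i) A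
          (prolong π k (fun t' => rhoE (ψ t')) s)) t := by
      filter_upwards [(hsec t).eventually_mem ht] with s hs
      exact ih (r + 1) (by omega) (by omega) s hs
    have h4 := h1.unique (h2.congr_of_eventuallyEq h3)
    -- Without the term `i = 0`, which is `∂L/∂q_r`, the sum is minus the derivative of the sum for
    -- `r + 1`.
    rw [Finset.sum_range_succ']
    simp only [pow_zero, one_mul, iteratedDeriv_zero, add_zero, pow_succ, mul_neg, mul_one, neg_mul,
      Finset.sum_neg_distrib]
    simp only [add_comm _ 1, ← add_assoc] at h4 ⊢
    linarith

/-- The recursion yields derivatives along the projection of `ψ` to `E`, whereas `legendreGraph`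
differentiates along a chosen representative of `ρ₁(ψ t)`. By holonomy the two curves have the same
`(2k-1)`-jet, and `i + k ≤ 2k - 1` makes that enough. -/
theorem mem_legendreGraph (hk : 1 ≤ k) {L : Jet π k → ℝ}
    (hL : ContMDiff 𝓘(ℝ, JetModel n k) 𝓘(ℝ, ℝ) ∞ L)
    {ψ : ℝ → Phase π k} (hψ : IsSectionOn hk L ψ univ) (hol : IsHolonomicOn ψ univ)
    (heq : ∀ t : ℝ, ∀ v ∈ tangentWo hk L (ψ t), omega (ψ t) (velocity ψ t) v = 0) (t : ℝ) :
    ψ t ∈ legendreGraph hk L := by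
  refine ⟨(hψ.2 t (mem_univ t)).1, fun e he hw r hr hrk A => ?_⟩
  have hR : rhoR (ψ t) = t := (hψ.2 t (mem_univ t)).2
  have hsec : ∀ t, IsSectionNear π (fun t' => rhoE (ψ t')) t := fun t =>
    isSectionNear_rhoE isOpen_univ hψ.1 (fun t ht => (hψ.2 t ht).2) (mem_univ t)
  obtain ⟨j, hj⟩ := Nat.exists_eq_add_of_le hrk
  have h1 := momentum_eq_sum he hk hL hsec hol A (fun t ht =>
    ((omega_velocity_eq_zero_iff he hk hL hψ hol ht).1 (heq t) A).2) j r hr hj.symm t hw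
  rw [h1, show k - r + 1 = j + 1 by omega, hR]
  refine Finset.sum_congr rfl fun i hi => congrArg _ ?_
  have hi' : i < j + 1 := Finset.mem_range.1 hi
  have hrep := isSectionNear_rep (ψ t)
  have hrep' := rep_map_time (ψ t)
  have hjet := prolong_rep (w := ψ t) (le_refl (2 * k - 1))
  rw [hR] at hrep hrep' hjet
  refine iteratedDeriv_partialDeriv_congr he hL (r + i) A (hsec t) hrep hw (by rwa [hrep'])
    (show i + k ≤ 2 * k - 1 by omega) ?_
  rw [hjet, proj_self]
  exact (hol t (mem_univ t)).symm

end Legendre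

/-! ### Velocities of curves in `W` -/

section Curves

variable {n k : ℕ} {E : Type*} [TopologicalSpace E] [ChartedSpace (BaseModel n) E] {π : Fibred n E}

/-- The tangent line of `ℝ` is spanned by `1`, so a pullback along the curve tests nothing but the
velocity. -/
theorem omega_mfderiv_curve (hk : 1 ≤ k) (σ : ℝ → Phase π k) (t : ℝ)
    (s : TangentSpace 𝓘(ℝ, ℝ) t) (v : TangentSpace (phaseModel n k) (σ t)) :
    omega (σ t) (mfderiv 𝓘(ℝ, ℝ) (phaseModel n k) σ t s) v =
      (show ℝ from s) * omega (σ t) (velocity σ t) v := by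
  have h : ∀ (T : ℝ →L[ℝ] JetModel n (2 * k - 1) × (JetModel n (k - 1) →L[ℝ] ℝ)) (s : ℝ),
      T s = s • T 1 + (0 : ℝ) • T 1 := fun T s => by
    rw [zero_smul, add_zero, ← map_smul, smul_eq_mul, mul_one]
  refine (congrArg (fun u => omega (σ t) u v)
    (h (mfderiv 𝓘(ℝ, ℝ) (phaseModel n k) σ t) s)).trans ?_
  exact (omega_add_smul_left hk (σ t) _ _ _ _ v).trans (by rw [zero_mul, add_zero]; rfl)

theorem velocity_of_isMIntegralCurve {σ : ℝ → Phase π k}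
    {X : ∀ w : Phase π k, TangentSpace (phaseModel n k) w} (h : IsMIntegralCurve σ X) (t : ℝ) :
    velocity σ t = X (σ t) := by
  have h1 : ∀ u : JetModel n (2 * k - 1) × (JetModel n (k - 1) →L[ℝ] ℝ),
      ((1 : ℝ →L[ℝ] ℝ).smulRight u) 1 = u := fun u => by simp
  exact (congrArg (fun T => T (1 : ℝ)) (h t).mfderiv).trans (h1 _)

end Curves

end SkinnerRusk
end

/-! ### The equivalence of the four conditions -/

open SkinnerRusk in
theorem mainTheorem1 {n k : ℕ} (hk : 1 ≤ k)
    {E : Type*} [TopologicalSpace E] [T2Space E] [SecondCountableTopology E]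
    [ChartedSpace (BaseModel n) E] [IsManifold 𝓘(ℝ, BaseModel n) ∞ E] (π : Fibred n E)
    (L : Jet π k → ℝ) (hL : ContMDiff 𝓘(ℝ, JetModel n k) 𝓘(ℝ, ℝ) ∞ L)
    (ψ : ℝ → Phase π k) (hψ : IsSectionOn hk L ψ univ) (hol : IsHolonomicOn ψ univ) :
    List.TFAE [
      -- `ψ^* i(Y) Ω_o = 0` for every vector field `Y` on `W_o`
      ∀ Y : (∀ w : Phase π k, TangentSpace (phaseModel n k) w), IsVectorFieldWo hk L Y →
        ∀ (t : ℝ) (s : TangentSpace 𝓘(ℝ, ℝ) t), omega (ψ t) (Y (ψ t))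
          (mfderiv 𝓘(ℝ, ℝ) (phaseModel n k) ψ t s) = 0,
      -- the equations in natural coordinates
      ∀ (e : OpenPartialHomeomorph E (BaseModel n)) (he : IsAdapted π.proj e) (t : ℝ),
        rhoE (ψ t) ∈ e.source → ∀ A : Fin n,
          HasDerivAt (fun s => momentum he 0 A (ψ s)) (liftPartialDeriv hk L he 0 A (ψ t)) t ∧
          (∀ i : ℕ, 1 ≤ i → i ≤ k - 1 → HasDerivAt (fun s => momentum he i A (ψ s))
            (liftPartialDeriv hk L he i A (ψ t) - momentum he (i - 1) A (ψ t)) t) ∧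
          momentum he (k - 1) A (ψ t) = liftPartialDeriv hk L he k A (ψ t),
      -- `i(ψ') (Ω_o ∘ ψ) = 0`
      ∀ t : ℝ, ∀ v ∈ tangentWo hk L (ψ t), omega (ψ t) (velocity ψ t) v = 0,
      -- `ψ` is an integral curve of a transverse semispray which solves the equation on `W_1`
      (∀ t : ℝ, ψ t ∈ legendreGraph hk L) ∧
        ∃ X : (∀ w : Phase π k, TangentSpace (phaseModel n k) w), IsVectorFieldWo hk L X ∧
          IsTransverse hk L X ∧ IsSemispray hk L X ∧
          (∀ w ∈ legendreGraph hk L, ∀ v ∈ tangentWo hk L w, omega w (X w) v = 0) ∧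
          IsMIntegralCurve ψ X] := by
  have hW : ∀ t, ψ t ∈ hamiltonianSubmanifold hk L := fun t => (hψ.2 t (mem_univ t)).1
  have hdiff : ∀ t, MDifferentiableAt 𝓘(ℝ, ℝ) (phaseModel n k) ψ t := fun t =>
    (contMDiffOn_univ.1 hψ.1 t).mdifferentiableAt (by simp)
  -- Every tangent vector of `W_o` at `ψ t` is the value of a vector field to which condition 1
  -- applies.
  tfae_have 1 → 3 := fun h t v hv => by
    obtain ⟨Y, hY, rfl⟩ := exists_vectorField_extending hk hL hv
    exact (omega_swap hk _ _ _).trans (neg_eq_zero.2 (h Y hY t (1 : ℝ)))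
  tfae_have 3 → 1 := fun h Y hY t s =>
    ((omega_swap hk _ _ _).trans (congrArg Neg.neg (omega_mfderiv_curve hk ψ t s _))).trans (by
      rw [h t _ (hY.2 _ (hW t)), mul_zero, neg_zero])
  tfae_have 3 → 2 := fun h e he t ht =>
    (omega_velocity_eq_zero_iff he hk hL hψ hol ht).1 (h t)
  tfae_have 2 → 3 := fun h t => by
    obtain ⟨e, he, ht⟩ := π.exists_adapted (rhoE (ψ t))
    exact (omega_velocity_eq_zero_iff he hk hL hψ hol ht).2 (h e he t ht)
  tfae_have 3 → 4 := fun h =>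
    ⟨mem_legendreGraph hk hL hψ hol h, exists_semispray hk hL hψ hol h⟩
  -- The equation for `X` is known on `W_1` only, so it matters that `ψ` stays in `W_1`.
  tfae_have 4 → 3 := fun ⟨hmem, X, _, _, _, hX, hψX⟩ t v hv => by
    rw [velocity_of_isMIntegralCurve hψX t]
    exact hX _ (hmem t) v hv
  tfae_finish
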